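/- **Setting.** Let $\mathbb{T}^2=[-\pi,\pi]^2$ with periodic boundary conditions. Functions are $2\pi$-periodic in each variable (a.e.), with complex (in particular real) values. $\|\phi\|_{L^p}$ is the norm of $L^p(\mathbb{T}^2,dx)$ over one period, $\langle\phi\rangle=\frac1{4\pi^2}\int_{\mathbb{T}^2}\phi\,dx$, and $\hat\phi(k)=\frac1{4\pi^2}\int_{\mathbb{T}^2}\phi(x)e^{-ik\cdot x}dx$ for $k\in\mathbb{Z}^2$. For $\sigma\in\mathbb{R}$ put $\|\phi\|_{\dot H^\sigma}^2=\sum_{k\ne0}|k|^{2\sigma}|\hat\phi(k)|^2$ and $\|\phi\|_{H^\sigma}^2=\sum_{k}(1+|k|^2)^{\sigma}|\hat\phi(k)|^2$. Let $\dot H^\sigma_{per}=\{\phi\in L^2_{per}:\|\phi\|_{\dot H^\sigma}<\infty\}$, let $\mathcal Z=\{\phi\in L^1_{per}:\int_{\mathbb{T}^2}\phi=0\}$, and for $\sigma\ge 0$ let $V_\sigma$ be the closure in the $H^\sigma$ norm of the trigonometric polynomials with mean zero. $\Lambda^\beta$ is the Fourier multiplier with symbol $|k|^\beta$ (for $\beta\neq0$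 it annihilates the mode $k=0$, and $\Lambda^0$ is the identity). **The operators.** (A) *Smooth volume elements.* Let $M\ge3$ be an integer, $h=\pi/M$, $\epsilon=h/10$ and $\mathcal J=\{-M,\dots,M-1\}^2$. For $\alpha=(i,j)\in\mathcal J$ let $\psi_\alpha$ be the $2\pi$-periodic extension of the indicator function of $[ih,(i+1)h)\times[jh,(j+1)h)$, and $\tilde\psi_\alpha=\rho_\epsilon*\psi_\alpha$ (convolution on $\mathbb{R}^2$), where $\rho_\epsilon(x)=\epsilon^{-2}\rho(x/\epsilon)$, $\rho(x)=K_0\exp\left(\frac{-1}{1-|x|^2}\right)$ for $|x|<1$, $\rho(x)=0$ for $|x|\ge1$, and $\int_{\mathbb{R}^2}\rho=1$. With $\tilde\phi_\alpha=\left(\int_{\mathbb{T}^2}\tilde\psi_\alpha\right)^{-1}\int_{\mathbb{T}^2}\phi\,\tilde\psi_\alpha$ put $\mathcal I_h\phi=\sum_{\alpha\in\mathcal J}\tilde\phi_\alpha\tilde\psi_\alpha$. (B) *Shifted smooth volume elements.* In the same notation, $I_h\phi=\sum_{\alpha\in\mathcal J}\tilde\phi_\alpha\left(\tilde\psi_\alpha-\langle\tilde\psi_\alpha\rangle\right)$.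 (C) *Rough modal projection.* For an integer $N\ge16$ and $h=2\pi/N$, $P_N\phi(x)=\frac1{4\pi^2}\int_{\mathbb{T}^2}D_N(x-y)\phi(y)\,dy$ with the Dirichlet kernel $D_N(x)=\sum_{|k_1|\le N,\,|k_2|\le N}e^{ik\cdot x}$. (D) *Smooth modal projection.* Let $\psi_0:\mathbb{R}^2\to[0,1]$ be smooth and radial, equal to $1$ on $\{|\xi|\le1/4\}$, with support $\{|\xi|\le1/2\}$. Let $\phi_{-1}=\psi_0$ and $\phi_j(\xi)=\psi_0(2^{-j}\xi/2)-\psi_0(2^{-j}\xi)$ for $j\ge0$, and $\triangle_j\phi(x)=\sum_{k\in\mathbb{Z}^2}\phi_j(k)\hat\phi(k)e^{ik\cdot x}$. For an integer $N\ge1$ and $h=2^{-N}$ put $S_N\phi=\sum_{j=-1}^N\triangle_j\phi$. **Proposition.** Let $J_h$ be given by (A), (B), (C) or (D). Then $J_h$ is linear on $L^1_{per}$ and has the following properties. The constants in $\lesssim$ are independent of $h$ (for all admissible $h$) and of $\phi$; they may depend on $p$, $\alpha$, $\beta$, and in case (D) on $\psi_0$. * (0.1) $\|J_h\phi\|_{L^p}\lesssim\|\phi\|_{L^p}$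 for $p\in(1,\infty)$ and $\phi\in L^p_{per}$. * (0.2) $\|J_h\phi\|_{L^p}\lesssim h^{2/p-1}\|\phi\|_{L^2}$ for $p\in[2,\infty)$ and $\phi\in L^2_{per}$. * (0.3) $\|J_h\phi\|_{\dot H^\beta}\lesssim h^{-\beta}\|\phi\|_{L^2}$ for $\beta\ge0$ and $\phi\in L^2_{per}$. In particular $J_h\phi$ lies in $L^p_{per}$, $L^p_{per}$ and $\dot H^\beta_{per}$ respectively. In the cases (A), (B), (D), (0.1) holds for all $p\in[1,\infty]$ and (0.2) for all $p\in[2,\infty]$, with constants that are also independent of $p$. In the cases (A) and (B), $J_h$ is of Type I: in addition, for every $\beta\in(0,1]$, * (1.1) $\|\phi-J_h\phi\|_{L^2}\lesssim h^\beta\|\phi\|_{\dot H^\beta}$ for $\phi\in\dot H^\beta_{per}$ in case (A), for $\phi\in V_\beta$ in case (B); * (1.2) $\|\phi-J_h\phi\|_{\dot H^{-\beta}}\lesssim h^\beta\|\phi\|_{L^2}$ for $\phi\in L^2_{per}$ in case (A), for $\phi\in L^2_{per}\cap\mathcal Z$ in case (B). In the cases (C) and (D), $J_h$ is of Type II: in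 addition, * (2.1) $\|\phi-J_h\phi\|_{\dot H^\alpha}\lesssim h^{\beta-\alpha}\|\phi\|_{\dot H^\beta}$ for all real $\alpha<\beta$ and $\phi\in\dot H^\beta_{per}$; * (2.2) for every $\beta\in\mathbb{R}$ and $\phi\in\dot H^\beta_{per}$, $\Lambda^\beta\phi$ and $\Lambda^\beta J_h\phi$ exist in $L^2_{per}$, and $\Lambda^\beta J_h\phi=J_h\Lambda^\beta\phi$. -/

import Mathlib

open MeasureTheory Set
open scoped ENNReal NNReal Real ContDiff

noncomputable section

namespace TorusInterp

/-- The plane; periodic functions on it represent functions on the torus. -/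
abbrev Plane : Type := EuclideanSpace ℝ (Fin 2)

/-- The fundamental cell `[-π, π]²` of the `2π`-periodic torus. -/
def cell : Set Plane := {x | ∀ i, x i ∈ Set.Icc (-π) π}

/-- Lebesgue measure on the cell (total mass `4π²`). -/
def cellMeasure : Measure Plane := volume.restrict cell

/-- Almost everywhere `2π`-periodicity in each variable. -/
def IsPeriodic (φ : Plane → ℂ) : Prop :=
  ∀ i : Fin 2, ∀ᵐ x : Plane, φ (x + EuclideanSpace.single i (2 * π)) = φ x

/-- The `L^p` norm over one period. -/
def lpNorm (p : ℝ≥0∞) (φ : Plane → ℂ) : ℝ≥0∞ := eLpNorm φ p cellMeasure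

/-- Membership in `L^p_per`. -/
def MemLpPer (p : ℝ≥0∞) (φ : Plane → ℂ) : Prop :=
  IsPeriodic φ ∧ MemLp φ p cellMeasure

/-- The class of integrable periodic functions with mean zero. -/
def MeanZero : Set (Plane → ℂ) := {φ | MemLpPer 1 φ ∧ ∫ x, φ x ∂cellMeasure = 0}

/-- A wave-number in `ℤ²`, seen as a point of the plane. -/
def freq (k : Fin 2 → ℤ) : Plane := WithLp.toLp 2 (fun i => (k i : ℝ))

/-- The character `x ↦ exp (i k · x)`. -/
def char (k : Fin 2 → ℤ) (x : Plane) : ℂ :=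
  Complex.exp (((inner ℝ (freq k) x : ℝ) : ℂ) * Complex.I)

/-- The Fourier coefficient `(2π)⁻² ∫ φ(x) exp (- i k · x) dx`. -/
def fourierCoef (φ : Plane → ℂ) (k : Fin 2 → ℤ) : ℂ :=
  (1 / (4 * (π : ℂ) ^ 2)) * ∫ x, φ x * char (-k) x ∂cellMeasure

/-- The homogeneous Sobolev (semi)norm `(∑_{k ≠ 0} |k|^{2σ} |φ̂(k)|²)^{1/2}`. -/
def hdotNorm (σ : ℝ) (φ : Plane → ℂ) : ℝ≥0∞ :=
  (∑' k : {k : Fin 2 → ℤ // k ≠ 0},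
    ENNReal.ofReal (‖freq k.1‖ ^ (2 * σ)) * ‖fourierCoef φ k.1‖ₑ ^ 2) ^ (1 / 2 : ℝ)

/-- The inhomogeneous Sobolev norm `(∑_k (1 + |k|²)^σ |φ̂(k)|²)^{1/2}`. -/
def hNorm (σ : ℝ) (φ : Plane → ℂ) : ℝ≥0∞ :=
  (∑' k : Fin 2 → ℤ,
    ENNReal.ofReal ((1 + ‖freq k‖ ^ 2) ^ σ) * ‖fourierCoef φ k‖ₑ ^ 2) ^ (1 / 2 : ℝ)

/-- The homogeneous Sobolev space, a subspace of `L²_per` for every real `σ`. -/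
def HdotPer (σ : ℝ) : Set (Plane → ℂ) := {φ | MemLpPer 2 φ ∧ hdotNorm σ φ < ⊤}

/-- Trigonometric polynomials with mean zero. -/
def MeanZeroTrigPoly : Set (Plane → ℂ) :=
  {q | ∃ (s : Finset (Fin 2 → ℤ)) (c : (Fin 2 → ℤ) → ℂ), 0 ∉ s ∧
    q = fun x => ∑ k ∈ s, c k * char k x}

/-- The closure of the mean-zero trigonometric polynomials in the `H^σ` norm
(as a space of functions, which is what it is for `σ ≥ 0`). -/
def V (σ : ℝ) : Set (Plane → ℂ) :=
  {φ | MemLpPer 2 φ ∧ ∀ ε : ℝ≥0∞, 0 < ε → ∃ q ∈ MeanZeroTrigPoly, hNorm σ (φ - q) < ε}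

/-- `g = Λ^β φ` with `Λ = (-Δ)^{1/2}`: the function `g ∈ L²_per` has the Fourier coefficients
`|k|^β φ̂(k)`. By the conventions of the real power, the mode `k = 0` is annihilated if
`β ≠ 0`, and `Λ⁰` is the identity. -/
def IsLambda (β : ℝ) (φ g : Plane → ℂ) : Prop :=
  MemLpPer 2 g ∧ ∀ k, fourierCoef g k = ((‖freq k‖ ^ β : ℝ) : ℂ) * fourierCoef φ k

section LocalAverages

/-- The bump `exp (-1 / (1 - |x|²))` on the unit disc, extended by zero. -/
def bumpProfile (x : Plane) : ℝ := if ‖x‖ < 1 then Real.exp (-1 / (1 - ‖x‖ ^ 2)) else 0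

/-- The bump, normalized to have integral one. -/
def rho (x : Plane) : ℝ := (∫ y, bumpProfile y)⁻¹ * bumpProfile x

/-- The rescaled mollifier `ε⁻² ρ(x / ε)`. -/
def rhoEps (ε : ℝ) (x : Plane) : ℝ := (ε ^ 2)⁻¹ * rho (ε⁻¹ • x)

/-- The side length `h = π / M`; the cell is divided into `4 M²` squares
(so `M` is the square root of the perfect square `N = M²`). -/
def side (M : ℕ) : ℝ := π / M

/-- The index set `{-M, …, M - 1}²`. -/
def idx (M : ℕ) : Finset (Fin 2 → ℤ) :=
  Fintype.piFinset (fun _ : Fin 2 => Finset.Ico (-(M : ℤ)) (M : ℤ))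

/-- The semi-open square `[α₀ h, (α₀ + 1) h) × [α₁ h, (α₁ + 1) h)`. -/
def square (M : ℕ) (α : Fin 2 → ℤ) : Set Plane :=
  {x | ∀ i, x i ∈ Set.Ico ((α i : ℝ) * side M) (((α i : ℝ) + 1) * side M)}

/-- The periodic extension of the indicator of the square, `∑_k 1_Q (x + 2 π k)`. -/
def psi (M : ℕ) (α : Fin 2 → ℤ) (x : Plane) : ℝ :=
  ∑' k : Fin 2 → ℤ, (square M α).indicator (fun _ => (1 : ℝ)) (x + (2 * π) • freq k)

/-- The mollified function `ρ_ε * ψ_α`, with `ε = h / 10`. -/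
def psiT (M : ℕ) (α : Fin 2 → ℤ) (x : Plane) : ℝ :=
  ∫ y : Plane, rhoEps (side M / 10) (x - y) * psi M α y

/-- The global average over the torus of a real function. -/
def avg (f : Plane → ℝ) : ℝ := (1 / (4 * π ^ 2)) * ∫ x, f x ∂cellMeasure

/-- The modified local average `(∫ φ ψ̃_α) / (∫ ψ̃_α)`. -/
def localAvg (M : ℕ) (α : Fin 2 → ℤ) (φ : Plane → ℂ) : ℂ :=
  (1 / ((∫ x, psiT M α x ∂cellMeasure : ℝ) : ℂ)) * ∫ x, φ x * (psiT M α x : ℂ) ∂cellMeasure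

/-- The smooth volume element interpolant. -/
def volElt (M : ℕ) (φ : Plane → ℂ) (x : Plane) : ℂ :=
  ∑ α ∈ idx M, localAvg M α φ * (psiT M α x : ℂ)

/-- The shifted smooth volume element interpolant. -/
def volEltShift (M : ℕ) (φ : Plane → ℂ) (x : Plane) : ℂ :=
  ∑ α ∈ idx M, localAvg M α φ * ((psiT M α x - avg (psiT M α) : ℝ) : ℂ)

end LocalAverages

section Modal

/-- The two-dimensional (square) Dirichlet kernel. -/
def dirichlet (N : ℕ) (x : Plane) : ℂ :=
  ∑ k ∈ Fintype.piFinset (fun _ : Fin 2 => Finset.Icc (-(N : ℤ)) (N : ℤ)), char k x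

/-- The rough modal projection: convolution on the torus (with respect to the normalized
measure) with the Dirichlet kernel. -/
def roughProj (N : ℕ) (φ : Plane → ℂ) (x : Plane) : ℂ :=
  (1 / (4 * (π : ℂ) ^ 2)) * ∫ y, dirichlet N (x - y) * φ y ∂cellMeasure

/-- The smooth radial bump functions on the frequency plane that generate a
Littlewood–Paley decomposition. -/
structure IsLPBump (ψ₀ : Plane → ℝ) : Prop where
  smooth : ContDiff ℝ ∞ ψ₀
  radial : ∀ ξ η : Plane, ‖ξ‖ = ‖η‖ → ψ₀ ξ = ψ₀ η
  eq_one : ∀ ξ : Plane, ‖ξ‖ ≤ 1 / 4 → ψ₀ ξ = 1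
  nonneg : ∀ ξ, 0 ≤ ψ₀ ξ
  le_one : ∀ ξ, ψ₀ ξ ≤ 1
  support_eq : tsupport ψ₀ = Metric.closedBall 0 (1 / 2)

/-- The dyadic symbols: `ψ₀` for `j = -1`, then `ψ₀(2^{-j} ξ / 2) - ψ₀(2^{-j} ξ)` for `j ≥ 0`,
and zero for `j < -1`. -/
def lpSymbol (ψ₀ : Plane → ℝ) (j : ℤ) (ξ : Plane) : ℝ :=
  if j < -1 then 0
  else if j = -1 then ψ₀ ξ
  else ψ₀ ((1 / 2 : ℝ) • ((2 : ℝ) ^ (-j)) • ξ) - ψ₀ (((2 : ℝ) ^ (-j)) • ξ)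

/-- The Littlewood–Paley block on the torus, the Fourier multiplier with the symbol
`lpSymbol ψ₀ j` (a sum with finitely many non-zero terms). -/
def lpBlock (ψ₀ : Plane → ℝ) (j : ℤ) (φ : Plane → ℂ) (x : Plane) : ℂ :=
  ∑' k : Fin 2 → ℤ, (lpSymbol ψ₀ j (freq k) : ℂ) * fourierCoef φ k * char k x

/-- The smooth modal projection `S_N = ∑_{j ≤ N} Δ_j` (the blocks with `j < -1` vanish). -/
def smoothProj (ψ₀ : Plane → ℝ) (N : ℕ) (φ : Plane → ℂ) (x : Plane) : ℂ :=
  ∑ j ∈ Finset.Icc (-1 : ℤ) (N : ℤ), lpBlock ψ₀ j φ x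

end Modal

section Properties

/-- The basic properties of a family of linear operators `J n`, `n ∈ S`, with the length
scales `h n`. No constant depends on `n` or on the function. -/
structure BasicBounds (S : Set ℕ) (h : ℕ → ℝ) (J : ℕ → (Plane → ℂ) → Plane → ℂ) : Prop where
  linear : ∀ n ∈ S, ∀ φ η : Plane → ℂ, MemLpPer 1 φ → MemLpPer 1 η → ∀ a b : ℂ,
    J n (a • φ + b • η) = a • J n φ + b • J n η
  lp_bound : ∀ p : ℝ≥0∞, 1 < p → p < ⊤ → ∃ C : ℝ≥0, ∀ n ∈ S, ∀ φ, MemLpPer p φ →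
    MemLpPer p (J n φ) ∧ lpNorm p (J n φ) ≤ C * lpNorm p φ
  l2_lp_bound : ∀ p : ℝ≥0∞, 2 ≤ p → p < ⊤ → ∃ C : ℝ≥0, ∀ n ∈ S, ∀ φ, MemLpPer 2 φ →
    MemLpPer p (J n φ) ∧
      lpNorm p (J n φ) ≤ C * ENNReal.ofReal (h n ^ (2 / p.toReal - 1)) * lpNorm 2 φ
  l2_hdot_bound : ∀ β : ℝ, 0 ≤ β → ∃ C : ℝ≥0, ∀ n ∈ S, ∀ φ, MemLpPer 2 φ →
    J n φ ∈ HdotPer β ∧ hdotNorm β (J n φ) ≤ C * ENNReal.ofReal (h n ^ (-β)) * lpNorm 2 φ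

/-- The `L^p` and `L² → L^p` bounds with the endpoints, and with constants independent of `p`
as well. For `p = ⊤` the exponent `2 / p.toReal - 1` is `-1`. -/
structure EndpointBounds (S : Set ℕ) (h : ℕ → ℝ) (J : ℕ → (Plane → ℂ) → Plane → ℂ) : Prop where
  lp_bound : ∃ C : ℝ≥0, ∀ p : ℝ≥0∞, 1 ≤ p → ∀ n ∈ S, ∀ φ, MemLpPer p φ →
    MemLpPer p (J n φ) ∧ lpNorm p (J n φ) ≤ C * lpNorm p φ
  l2_lp_bound : ∃ C : ℝ≥0, ∀ p : ℝ≥0∞, 2 ≤ p → ∀ n ∈ S, ∀ φ, MemLpPer 2 φ →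
    MemLpPer p (J n φ) ∧
      lpNorm p (J n φ) ≤ C * ENNReal.ofReal (h n ^ (2 / p.toReal - 1)) * lpNorm 2 φ

/-- Type I families: the first approximation estimate is required for `φ ∈ X β`,
the second one for `φ ∈ Y`. -/
structure IsTypeI (S : Set ℕ) (h : ℕ → ℝ) (J : ℕ → (Plane → ℂ) → Plane → ℂ)
    (X : ℝ → Set (Plane → ℂ)) (Y : Set (Plane → ℂ)) : Prop extends BasicBounds S h J where
  approx : ∀ β : ℝ, 0 < β → β ≤ 1 → ∃ C : ℝ≥0, ∀ n ∈ S, ∀ φ ∈ X β,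
    lpNorm 2 (φ - J n φ) ≤ C * ENNReal.ofReal (h n ^ β) * hdotNorm β φ
  approx_neg : ∀ β : ℝ, 0 < β → β ≤ 1 → ∃ C : ℝ≥0, ∀ n ∈ S, ∀ φ ∈ Y,
    hdotNorm (-β) (φ - J n φ) ≤ C * ENNReal.ofReal (h n ^ β) * lpNorm 2 φ

/-- Type II families. The last field says that `Λ^β φ` and `Λ^β (J φ)` exist in `L²_per`, and
that `Λ^β (J φ) = J (Λ^β φ)`. -/
structure IsTypeII (S : Set ℕ) (h : ℕ → ℝ) (J : ℕ → (Plane → ℂ) → Plane → ℂ) : Prop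
    extends BasicBounds S h J where
  approx : ∀ α β : ℝ, α < β → ∃ C : ℝ≥0, ∀ n ∈ S, ∀ φ ∈ HdotPer β,
    hdotNorm α (φ - J n φ) ≤ C * ENNReal.ofReal (h n ^ (β - α)) * hdotNorm β φ
  commute : ∀ β : ℝ, ∀ n ∈ S, ∀ φ ∈ HdotPer β,
    (∃ g, IsLambda β φ g) ∧ (∃ g, IsLambda β (J n φ) g) ∧
      ∀ g g', IsLambda β φ g → IsLambda β (J n φ) g' → g' =ᵐ[cellMeasure] J n g

end Properties

end TorusInterp

end

/-!
All four families act on functions on the torus `T2 = (ℝ/ℤ)²` with its Haar probability measure,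
through the covering map `toT` and its section `sec`, and the estimates are proved there.

*Modal projections.* Both are Fourier multipliers with symbols between `0` and `1` that are equal
to `1` at the frequencies below `c₂ / h` and vanish at those above `c₁ / h` (`IsModal`). By
Parseval's identity this gives the Sobolev estimates and the commutation with `Λ^β`, and, as there
are `O(h⁻²)` frequencies, the bound from `L²` to `L^∞` with the constant `O(h⁻¹)`; the bounds from
`L²` to `L^p` follow by interpolation with `L²`. What remains is the boundedness in `L^p`.

For the square partial sums this is M. Riesz's theorem (`exists_partialSum_bound`). For
`1 < p ≤ 2` there are constants with `|z|^p ≤ A (Re z)^p - B Re (z^p)` on the right half-plane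
(`exists_norm_rpow_le`). If `f` is a positive trigonometric polynomial, the multiplier
`1 + sgn kᵢ` makes it, along each circle in the `i`-th direction, the boundary value of an entire
function `F` with real part `f`; the mean of `Re (F^p)` over the circle is `Re (F(0)^p) ≥ 0`, so
that `‖F‖_p^p ≤ A ‖f‖_p^p` (`exists_riesz_pos`). A general function is a combination of four
nonnegative ones, up to a uniformly small error that is treated in `L²`. Translations and products
of such multipliers give the indicators of the squares in frequency space, and duality gives
`p ≥ 2`. For the smooth projection the Littlewood–Paley sum telescopes to a rescaling of `ψ₀`, the
Fourier transform of an integrable function; so its kernel on the torus is bounded in `L¹`,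
uniformly in the scale (`exists_sup_bound`, `lintegral_trig_le`), and Young's inequality applies.

*Volume elements.* The mollified squares `Psi M α` are a partition of unity with equal integrals
`m = 1 / (4 M²)`, and the interpolation is an integral operator with the symmetric nonnegative
kernel `∑ α, m⁻¹ Psi α t * Psi α u`. The kernel has integral one in each variable, is at most
`m⁻¹`, and is supported at distances `O(h)`. Schur's test gives the `L^p` bounds with the
constant one, the Cauchy–Schwarz inequality the bound from `L²` to `L^∞`. The mollification of the
squares multiplies Fourier coefficients by the rapidly decaying `ρ̂(ε k)`, and without it the
operator is bounded in `L²`; this gives the bound from `L²` to `Ḣ^β` (`exists_hdotT_volOp_le`).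
The error `f - J f` is an average of differences `f - f(· - v)` with `|v| = O(h)`, whose `L²` norms
are at most `C h^β ‖f‖_{Ḣ^β}` for `β ≤ 1` (`eLpNorm_sub_translate_le`), and the symmetry of the
kernel turns this into the estimate in `Ḣ^{-β}` (`IsPartition.hdotT_neg_sub_avgOp_le`). The shifted
operator subtracts the mean value of `f`, which vanishes for the functions in the approximation
estimates.
-/

noncomputable section

namespace TorusInterp

open UnitAddTorus (mFourier)
open scoped FourierTransform

/-! ### The torus and its fundamental cell -/

/-- The two-dimensional torus `(ℝ/ℤ)²`, on which the analysis takes place. -/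
abbrev T2 : Type := UnitAddTorus (Fin 2)

/-- The Haar probability measure of the torus. -/
def haarT : Measure T2 := Measure.pi fun _ => AddCircle.haarAddCircle

instance : IsProbabilityMeasure haarT := by unfold haarT; infer_instance
instance : haarT.IsAddHaarMeasure := by unfold haarT; infer_instance

/-- The covering map of the torus, scaled so that its periods are `2π`. -/
def toT (x : Plane) : T2 := fun i => ((x i / (2 * π) : ℝ) : UnitAddCircle)

/-- The section of `toT` with values in `[-π, π)²`. -/
def sec (t : T2) : Plane :=
  WithLp.toLp 2 fun i => 2 * π * (AddCircle.equivIco (1 : ℝ) (-1 / 2) (t i) : ℝ)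

lemma sec_apply (t : T2) (i : Fin 2) :
    sec t i = 2 * π * (AddCircle.equivIco (1 : ℝ) (-1 / 2) (t i) : ℝ) := rfl

lemma toT_sec (t : T2) : toT (sec t) = t := by
  funext i
  have h : (2 * π * (AddCircle.equivIco (1 : ℝ) (-1 / 2) (t i) : ℝ)) / (2 * π) =
      AddCircle.equivIco (1 : ℝ) (-1 / 2) (t i) := by
    field_simp
  rw [toT, sec_apply, h]
  exact AddCircle.coe_equivIco

lemma sec_mem (t : T2) (i : Fin 2) : sec t i ∈ Ico (-π) π := by
  have h := (AddCircle.equivIco (1 : ℝ) (-1 / 2) (t i)).2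
  have hp := Real.pi_pos
  rw [sec_apply]
  constructor <;> [skip; skip] <;> nlinarith [h.1, h.2]

lemma sec_toT {x : Plane} (hx : ∀ i, x i ∈ Ico (-π) π) : sec (toT x) = x := by
  ext i
  have hp := Real.pi_pos
  have h : x i / (2 * π) ∈ Ico (-1 / 2 : ℝ) (-1 / 2 + 1) := by
    constructor
    · rw [le_div_iff₀ (by positivity)]; linarith [(hx i).1]
    · rw [div_lt_iff₀ (by positivity)]; linarith [(hx i).2]
  rw [sec_apply, toT, AddCircle.equivIco_coe_of_mem h]
  field_simp

lemma continuous_toT : Continuous toT := by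
  refine continuous_pi fun i => ?_
  exact (AddCircle.continuous_mk' 1).comp (by fun_prop)

lemma measurable_toT : Measurable toT := continuous_toT.measurable

lemma measurable_sec : Measurable sec := by
  refine (WithLp.measurable_toLp 2 (Fin 2 → ℝ)).comp (measurable_pi_lambda _ fun i => ?_)
  exact (measurable_subtype_coe.comp ((AddCircle.measurableEquivIco 1 (-1 / 2)).measurable.comp
    (measurable_pi_apply i))).const_mul _

lemma measurableEmbedding_sec : MeasurableEmbedding sec := by
  refine MeasurableEmbedding.of_measurable_inverse measurable_sec ?_ measurable_toT toT_sec
  have : range sec = {x | ∀ i, x i ∈ Ico (-π) π} := by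
    ext x
    refine ⟨?_, fun h => ⟨toT x, sec_toT h⟩⟩
    rintro ⟨t, rfl⟩
    exact sec_mem t
  rw [this, ofPred_forall]
  exact MeasurableSet.iInter fun i => measurableSet_Ico.preimage (by fun_prop)

lemma toT_add (x y : Plane) : toT (x + y) = toT x + toT y := by
  funext i; simp [toT, add_div]

lemma toT_sub (x y : Plane) : toT (x - y) = toT x - toT y := by
  funext i; simp [toT, sub_div]

lemma toT_add_period (x : Plane) (k : Fin 2 → ℤ) : toT (x + (2 * π) • freq k) = toT x := by
  rw [toT_add]
  have : toT ((2 * π) • freq k) = 0 := by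
    funext i
    have : (2 * π * (k i : ℝ)) / (2 * π) = k i := by field_simp
    simp only [toT, freq, PiLp.smul_apply, smul_eq_mul, this, Pi.zero_apply]
    rw [AddCircle.coe_eq_zero_iff]
    exact ⟨k i, by simp⟩
  rw [this, add_zero]

lemma isPeriodic_comp_toT (g : T2 → ℂ) : IsPeriodic fun x => g (toT x) := by
  intro i
  refine Filter.Eventually.of_forall fun x => ?_
  have : EuclideanSpace.single i (2 * π) = (2 * π) • freq (Pi.single i 1) := by
    ext j
    by_cases h : j = i
    · subst h; simp [freq]
    · simp [freq, h]
  show g (toT _) = g (toT x)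
  rw [this, toT_add_period]

lemma char_eq (k : Fin 2 → ℤ) (x : Plane) : char k x = UnitAddTorus.mFourier k (toT x) := by
  have h : UnitAddTorus.mFourier k (toT x) = ∏ i, fourier (k i) (toT x i) := rfl
  rw [h, Fin.prod_univ_two]
  simp only [toT, fourier_coe_apply, char, freq, PiLp.inner_apply, Fin.sum_univ_two, ← Complex.exp_add]
  congr 1
  have := Real.pi_ne_zero
  have : (π : ℂ) ≠ 0 := by exact_mod_cast this
  simp
  field_simp

lemma cellMeasure_eq : cellMeasure =
    (Measure.pi fun _ : Fin 2 => (volume : Measure ℝ).restrict (Icc (-π) π)).map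
      (WithLp.toLp 2) := by
  rw [← Measure.restrict_pi_pi, ← volume_pi]
  have h := (MeasurableEquiv.toLp 2 (Fin 2 → ℝ)).restrict_map volume cell
  have h2 : Measure.map (MeasurableEquiv.toLp 2 (Fin 2 → ℝ)) volume = volume :=
    (PiLp.volume_preserving_toLp (Fin 2)).map_eq
  rw [h2] at h
  rw [cellMeasure, h]
  congr 2
  ext y
  simp [cell, Pi.le_def]
  tauto

lemma ae_mem_Ico : ∀ᵐ x ∂cellMeasure, ∀ i, x i ∈ Ico (-π) π := by
  rw [cellMeasure_eq]
  refine (MeasurableEquiv.toLp 2 (Fin 2 → ℝ)).measurableEmbedding.ae_map_iff.2 ?_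
  rw [ae_all_iff]
  intro i
  have h : ∀ᵐ s ∂((volume : Measure ℝ).restrict (Icc (-π) π)), s ∈ Ico (-π) π := by
    rw [← Measure.restrict_congr_set Ico_ae_eq_Icc]
    exact ae_restrict_mem measurableSet_Ico
  exact (Measure.quasiMeasurePreserving_eval
    (fun _ : Fin 2 => (volume : Measure ℝ).restrict (Icc (-π) π)) i).ae h

/-- The covering map of the circle, from an interval of length `2π`. -/
lemma map_circle : Measure.map (fun s : ℝ => ((s / (2 * π) : ℝ) : UnitAddCircle))
    (volume.restrict (Icc (-π) π)) = ENNReal.ofReal (2 * π) • AddCircle.haarAddCircle := by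
  have hp := Real.pi_pos
  have h1 := UnitAddCircle.measurePreserving_mk (-1 / 2)
  have h2 := Real.map_volume_mul_left (a := (2 * π)⁻¹) (by positivity)
  have h3 : Measure.map (fun s : ℝ => (2 * π)⁻¹ * s) (volume.restrict (Icc (-π) π)) =
      ENNReal.ofReal (2 * π) • volume.restrict (Ioc (-1 / 2) (-1 / 2 + 1)) := by
    rw [← Measure.restrict_congr_set Ioc_ae_eq_Icc]
    have : Ioc (-π) π = (fun s : ℝ => (2 * π)⁻¹ * s) ⁻¹' (Ioc (-1 / 2) (-1 / 2 + 1)) := by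
      ext s
      simp only [mem_Ioc, mem_preimage, inv_mul_eq_div]
      rw [lt_div_iff₀ (by positivity), div_le_iff₀ (by positivity)]
      constructor <;> rintro ⟨a, b⟩ <;> constructor <;> linarith
    rw [this, ← Measure.restrict_map (by fun_prop) measurableSet_Ioc, h2, Measure.restrict_smul]
    congr 2
    rw [inv_inv, abs_of_pos (by positivity)]
  have h4 : (fun s : ℝ => ((s / (2 * π) : ℝ) : UnitAddCircle)) =
      (fun s : ℝ => (s : UnitAddCircle)) ∘ fun s : ℝ => (2 * π)⁻¹ * s := by
    funext s; simp [div_eq_inv_mul]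
  rw [h4, ← Measure.map_map AddCircle.measurable_mk' (by fun_prop), h3, Measure.map_smul, h1.map_eq,
    AddCircle.volume_eq_smul_haarAddCircle]
  simp

lemma map_toT : Measure.map toT cellMeasure = ENNReal.ofReal (4 * π ^ 2) • haarT := by
  have hg : Measurable fun s : ℝ => ((s / (2 * π) : ℝ) : UnitAddCircle) :=
    AddCircle.measurable_mk'.comp (by fun_prop)
  have h : toT ∘ (WithLp.toLp 2) = fun (y : Fin 2 → ℝ) i => ((y i / (2 * π) : ℝ) : UnitAddCircle) :=
    rfl
  rw [cellMeasure_eq, Measure.map_map measurable_toT (WithLp.measurable_toLp 2 _), h,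
    Measure.pi_map_pi (fun _ => hg.aemeasurable)]
  have : IsFiniteMeasure (ENNReal.ofReal (2 * π) • (AddCircle.haarAddCircle (T := 1))) :=
    Measure.smul_finite _ ENNReal.ofReal_ne_top
  simp_rw [map_circle]
  refine Measure.pi_eq fun s hs => ?_
  rw [haarT, Measure.smul_apply, Measure.pi_pi]
  simp only [Fin.prod_univ_two, Measure.smul_apply, smul_eq_mul]
  have : ENNReal.ofReal (4 * π ^ 2) = ENNReal.ofReal (2 * π) * ENNReal.ofReal (2 * π) := by
    rw [← ENNReal.ofReal_mul (by positivity)]; ring_nf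
  rw [this]
  ring

lemma map_sec : Measure.map sec haarT = (ENNReal.ofReal (4 * π ^ 2))⁻¹ • cellMeasure := by
  have h : Measure.map (sec ∘ toT) cellMeasure = cellMeasure := by
    conv_rhs => rw [← Measure.map_id (μ := cellMeasure)]
    refine Measure.map_congr ?_
    filter_upwards [ae_mem_Ico] with x hx using sec_toT hx
  rw [← Measure.map_map measurable_sec measurable_toT, map_toT, Measure.map_smul] at h
  rw [← h, smul_smul, ENNReal.inv_mul_cancel, one_smul]
  · simp
  · exact ENNReal.ofReal_ne_top

lemma cellMeasure_eq_map_sec : cellMeasure = ENNReal.ofReal (4 * π ^ 2) • Measure.map sec haarT := by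
  rw [map_sec, smul_smul, ENNReal.mul_inv_cancel, one_smul]
  · simp
  · exact ENNReal.ofReal_ne_top

instance : IsFiniteMeasure cellMeasure := by
  rw [cellMeasure_eq]; infer_instance

/-- Integrals over the cell are integrals over the torus, up to the area `4π²` of the cell. -/
lemma integral_cell {E : Type*} [NormedAddCommGroup E] [NormedSpace ℝ E] (φ : Plane → E) :
    ∫ x, φ x ∂cellMeasure = (4 * π ^ 2) • ∫ t, φ (sec t) ∂haarT := by
  rw [cellMeasure_eq_map_sec, integral_smul_measure, measurableEmbedding_sec.integral_map,
    ENNReal.toReal_ofReal (by positivity)]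

lemma lpNorm_eq (p : ℝ≥0∞) (φ : Plane → ℂ) : lpNorm p φ =
    ENNReal.ofReal (4 * π ^ 2) ^ (1 / p.toReal) * eLpNorm (fun t => φ (sec t)) p haarT := by
  rw [lpNorm, cellMeasure_eq_map_sec, eLpNorm_smul_measure_of_ne_zero, smul_eq_mul]
  · congr 1
    · simp
    · exact measurableEmbedding_sec.eLpNorm_map_measure
  · simp

lemma ae_cell_iff {P : Plane → Prop} : (∀ᵐ x ∂cellMeasure, P x) ↔ ∀ᵐ t ∂haarT, P (sec t) := by
  rw [cellMeasure_eq_map_sec, Measure.ae_ennreal_smul_measure_iff,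
    measurableEmbedding_sec.ae_map_iff]
  simp

lemma aestronglyMeasurable_cell_iff {φ : Plane → ℂ} : AEStronglyMeasurable φ cellMeasure ↔
    AEStronglyMeasurable (fun t => φ (sec t)) haarT := by
  have h : AEStronglyMeasurable φ (Measure.map sec haarT) ↔
    AEStronglyMeasurable (fun t => φ (sec t)) haarT :=
    measurableEmbedding_sec.aestronglyMeasurable_map_iff
  rw [← h, cellMeasure_eq_map_sec]
  refine ⟨fun h => ?_, fun h => h.smul_measure _⟩
  rw [map_sec, cellMeasure_eq_map_sec]
  exact h.smul_measure _

lemma memLp_cell_iff {p : ℝ≥0∞} {φ : Plane → ℂ} : MemLp φ p cellMeasure ↔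
    MemLp (fun t => φ (sec t)) p haarT := by
  rw [MemLp, MemLp, aestronglyMeasurable_cell_iff]
  have h := lpNorm_eq p φ
  rw [lpNorm] at h
  have h0 : ENNReal.ofReal (4 * π ^ 2) ^ (1 / p.toReal) ≠ 0 := by
    simp [ENNReal.rpow_eq_zero_iff]
  have h1 : ENNReal.ofReal (4 * π ^ 2) ^ (1 / p.toReal) ≠ ⊤ :=
    ENNReal.rpow_ne_top_of_nonneg (by positivity) ENNReal.ofReal_ne_top
  refine and_congr_right fun _ => ?_
  rw [h]
  refine ⟨fun h2 => ?_, fun h2 => ENNReal.mul_lt_top h1.lt_top h2⟩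
  by_contra h3
  rw [not_lt, top_le_iff] at h3
  rw [h3, ENNReal.mul_top h0] at h2
  exact lt_irrefl _ h2

/-- The Fourier coefficient of a function on the torus. -/
def coef (f : T2 → ℂ) (k : Fin 2 → ℤ) : ℂ := ∫ t, f t * UnitAddTorus.mFourier (-k) t ∂haarT

lemma fourierCoef_eq (φ : Plane → ℂ) (k : Fin 2 → ℤ) :
    fourierCoef φ k = coef (fun t => φ (sec t)) k := by
  rw [fourierCoef, integral_cell]
  simp only [char_eq, toT_sec, coef]
  have : (π : ℂ) ≠ 0 := by exact_mod_cast Real.pi_ne_zero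
  rw [Complex.real_smul]
  push_cast
  field_simp

lemma memLpPer_comp_toT {p : ℝ≥0∞} {g : T2 → ℂ} (hg : MemLp g p haarT) :
    MemLpPer p fun x => g (toT x) := by
  refine ⟨isPeriodic_comp_toT g, memLp_cell_iff.2 ?_⟩
  simpa only [toT_sec] using hg

/-! ### Fourier coefficients and trigonometric polynomials -/

lemma norm_mFourier_apply (k : Fin 2 → ℤ) (t : T2) : ‖mFourier k t‖ = 1 := by
  simp only [UnitAddTorus.mFourier, ContinuousMap.coe_mk, norm_prod, fourier_apply, Circle.norm_coe,
    Finset.prod_const_one]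

lemma mFourier_add_apply (k : Fin 2 → ℤ) (s t : T2) :
    mFourier k (s + t) = mFourier k s * mFourier k t := by
  simp only [UnitAddTorus.mFourier, ContinuousMap.coe_mk, Pi.add_apply, fourier_apply, smul_add,
    AddCircle.toCircle_add, Circle.coe_mul, Finset.prod_mul_distrib]

lemma mFourier_neg_apply (k : Fin 2 → ℤ) (t : T2) : mFourier k (-t) = mFourier (-k) t := by
  simp [UnitAddTorus.mFourier, fourier_apply]

lemma mFourier_sub_apply (k : Fin 2 → ℤ) (s t : T2) :
    mFourier k (s - t) = mFourier k s * mFourier (-k) t := by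
  rw [sub_eq_add_neg, mFourier_add_apply, mFourier_neg_apply]

lemma integral_mFourier (k : Fin 2 → ℤ) :
    ∫ t, mFourier k t ∂haarT = if k = 0 then 1 else 0 := by
  have h := orthonormal_iff_ite.1 (UnitAddTorus.orthonormal_mFourier (d := Fin 2)) 0 k
  rw [ContinuousMap.inner_toLp] at h
  simp only [UnitAddTorus.mFourier_zero, ContinuousMap.one_apply, map_one, mul_one] at h
  simp only [eq_comm (a := k)]
  exact h

lemma coef_mFourier (j k : Fin 2 → ℤ) : coef (mFourier j) k = if j = k then 1 else 0 := by
  simp only [coef, ← UnitAddTorus.mFourier_add, ← sub_eq_add_neg, integral_mFourier, sub_eq_zero]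

lemma integrable_mul_mFourier {f : T2 → ℂ} (hf : Integrable f haarT) (k : Fin 2 → ℤ) :
    Integrable (fun t => f t * mFourier k t) haarT :=
  hf.mul_bdd (c := 1) (mFourier k).continuous.aestronglyMeasurable
    (Filter.Eventually.of_forall fun t => (norm_mFourier_apply k t).le)

lemma coef_add {f g : T2 → ℂ} (hf : Integrable f haarT) (hg : Integrable g haarT)
    (k : Fin 2 → ℤ) : coef (fun t => f t + g t) k = coef f k + coef g k := by
  simp only [coef, add_mul]
  exact integral_add (integrable_mul_mFourier hf _) (integrable_mul_mFourier hg _)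

lemma coef_sub {f g : T2 → ℂ} (hf : Integrable f haarT) (hg : Integrable g haarT)
    (k : Fin 2 → ℤ) : coef (fun t => f t - g t) k = coef f k - coef g k := by
  simp only [coef, sub_mul]
  exact integral_sub (integrable_mul_mFourier hf _) (integrable_mul_mFourier hg _)

lemma coef_const_mul (c : ℂ) (f : T2 → ℂ) (k : Fin 2 → ℤ) :
    coef (fun t => c * f t) k = c * coef f k := by
  simp only [coef, mul_assoc, integral_const_mul]

lemma coef_sum {ι : Type*} (s : Finset ι) {f : ι → T2 → ℂ} (hf : ∀ i ∈ s, Integrable (f i) haarT)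
    (k : Fin 2 → ℤ) : coef (fun t => ∑ i ∈ s, f i t) k = ∑ i ∈ s, coef (f i) k := by
  simp only [coef, Finset.sum_mul]
  exact integral_finsetSum _ fun i hi => integrable_mul_mFourier (hf i hi) _

/-- The trigonometric polynomial with the frequencies `s` and the coefficients `c`. -/
def trig (s : Finset (Fin 2 → ℤ)) (c : (Fin 2 → ℤ) → ℂ) (t : T2) : ℂ :=
  ∑ k ∈ s, c k * mFourier k t

lemma continuous_trig (s : Finset (Fin 2 → ℤ)) (c : (Fin 2 → ℤ) → ℂ) : Continuous (trig s c) := by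
  unfold trig; fun_prop

lemma memLp_of_continuous {f : T2 → ℂ} (hf : Continuous f) (p : ℝ≥0∞) : MemLp f p haarT := by
  obtain ⟨C, hC⟩ := (isCompact_range hf).isBounded.exists_norm_le
  exact MemLp.of_bound hf.aestronglyMeasurable C
    (Filter.Eventually.of_forall fun t => hC _ (mem_range_self t))

lemma integrable_of_continuous {f : T2 → ℂ} (hf : Continuous f) : Integrable f haarT :=
  memLp_one_iff_integrable.1 (memLp_of_continuous hf 1)

lemma coef_trig (s : Finset (Fin 2 → ℤ)) (c : (Fin 2 → ℤ) → ℂ) (k : Fin 2 → ℤ) :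
    coef (trig s c) k = if k ∈ s then c k else 0 := by
  have h := coef_sum s (f := fun j t => c j * mFourier j t)
    (fun j _ => integrable_of_continuous (by fun_prop)) k
  unfold trig
  rw [h]
  simp only [coef_const_mul, coef_mFourier]
  simp

/-- Parseval's identity. -/
lemma tsum_coef_sq {f : T2 → ℂ} (hf : MemLp f 2 haarT) :
    ∑' k, ‖coef f k‖ₑ ^ 2 = eLpNorm f 2 haarT ^ 2 := by
  have hc : ∀ k, UnitAddTorus.mFourierCoeff (d := Fin 2) hf.toLp k = coef f k := by
    intro k
    refine integral_congr_ae ?_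
    filter_upwards [hf.coeFn_toLp] with t ht
    rw [smul_eq_mul, mul_comm]
    exact congrArg (· * _) ht
  have h : HasSum (fun k => ‖coef f k‖ ^ 2) (∫ t, ‖hf.toLp f t‖ ^ 2 ∂haarT) :=
    (UnitAddTorus.hasSum_sq_mFourierCoeff (d := Fin 2) hf.toLp).congr_fun fun k => by rw [← hc k]; rfl
  have h2 : ∑' k, ‖coef f k‖ₑ ^ 2 = ENNReal.ofReal (∑' k, ‖coef f k‖ ^ 2) := by
    rw [ENNReal.ofReal_tsum_of_nonneg (fun _ => by positivity) h.summable]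
    congr 1; funext k
    rw [ENNReal.ofReal_pow (norm_nonneg _), ofReal_norm]
  have h3 : ∫ t, ‖hf.toLp f t‖ ^ 2 ∂haarT = ∫ t, ‖f t‖ ^ 2 ∂haarT := by
    refine integral_congr_ae ?_
    filter_upwards [hf.coeFn_toLp] with t ht
    rw [ht]
  rw [h2, h.tsum_eq]
  rw [h3, hf.eLpNorm_eq_integral_rpow_norm (by norm_num) (by norm_num)]
  rw [← ENNReal.ofReal_pow (by positivity)]
  congr 1
  simp only [ENNReal.toReal_ofNat, Real.rpow_two]
  rw [← Real.rpow_natCast, ← Real.rpow_mul (by positivity)]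
  norm_num

lemma ae_eq_of_coef_eq {f g : T2 → ℂ} (hf : MemLp f 2 haarT) (hg : MemLp g 2 haarT)
    (h : ∀ k, coef f k = coef g k) : f =ᵐ[haarT] g := by
  have hs := tsum_coef_sq (hf.sub hg)
  have h0 : ∀ k, coef (f - g) k = 0 := fun k => by
    have := coef_sub (hf.integrable (by norm_num)) (hg.integrable (by norm_num)) k
    rw [h, sub_self] at this
    exact this
  simp only [h0, enorm_zero] at hs
  have h1 : eLpNorm (f - g) 2 haarT = 0 := by simpa using hs.symm
  rw [eLpNorm_eq_zero_iff (hf.sub hg).1 (by norm_num)] at h1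
  filter_upwards [h1] with t ht
  exact sub_eq_zero.1 ht

/-- The Riesz–Fischer theorem. -/
lemma exists_coef_eq {c : (Fin 2 → ℤ) → ℂ} (hc : ∑' k, ‖c k‖ₑ ^ 2 < ⊤) :
    ∃ f : T2 → ℂ, MemLp f 2 haarT ∧ ∀ k, coef f k = c k := by
  have hm : Memℓp c 2 := by
    refine memℓp_gen ?_
    simp only [ENNReal.toReal_ofNat, Real.rpow_two]
    have : ∀ k, ‖c k‖ ^ 2 = (‖c k‖ₑ ^ 2).toReal := fun k => by simp
    simp only [this]
    exact ENNReal.summable_toReal hc.ne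
  let u : lp (fun _ : Fin 2 → ℤ => ℂ) 2 := ⟨c, hm⟩
  let F := (UnitAddTorus.mFourierBasis (d := Fin 2)).repr.symm u
  refine ⟨F, Lp.memLp F, fun k => ?_⟩
  have h := UnitAddTorus.mFourierBasis_repr F k
  rw [LinearIsometryEquiv.apply_symm_apply] at h
  refine Eq.trans ?_ h.symm
  simp only [coef, UnitAddTorus.mFourierCoeff, smul_eq_mul, mul_comm]
  rfl

lemma coef_translate (f : T2 → ℂ) (u : T2) (k : Fin 2 → ℤ) :
    coef (fun t => f (t - u)) k = mFourier (-k) u * coef f k := by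
  have h := integral_add_right_eq_self (μ := haarT) (fun t => f (t - u) * mFourier (-k) t) u
  rw [coef, ← h, coef, ← integral_const_mul]
  congr 1; funext t
  rw [add_sub_cancel_right, mFourier_add_apply]
  ring

lemma enorm_coef_le {f : T2 → ℂ} (k : Fin 2 → ℤ) : ‖coef f k‖ₑ ≤ eLpNorm f 1 haarT := by
  refine (enorm_integral_le_lintegral_enorm _).trans_eq ?_
  rw [eLpNorm_one_eq_lintegral_enorm]
  congr 1; funext t
  rw [enorm_mul, ← ofReal_norm (mFourier _ _), norm_mFourier_apply]; simp

/-- Trigonometric polynomials are uniformly dense in the continuous functions. -/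
lemma exists_trig_near {f : T2 → ℂ} (hf : Continuous f) {ε : ℝ} (hε : 0 < ε) :
    ∃ s c, ∀ t, ‖f t - trig s c t‖ ≤ ε := by
  let F : C(T2, ℂ) := ⟨f, hf⟩
  have h : F ∈ (Submodule.span ℂ (range <| mFourier (d := Fin 2))).topologicalClosure := by
    rw [UnitAddTorus.span_mFourier_closure_eq_top]; trivial
  obtain ⟨g, hg, hd⟩ := Metric.mem_closure_iff.1 h ε hε
  obtain ⟨c, rfl⟩ := Finsupp.mem_span_range_iff_exists_finsupp.1 hg
  refine ⟨c.support, c, fun t => ?_⟩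
  rw [dist_eq_norm] at hd
  have h2 := (ContinuousMap.norm_coe_le_norm _ t).trans hd.le
  have h3 : (F - c.sum fun i a => a • mFourier i) t = f t - trig c.support c t := by
    rw [ContinuousMap.sub_apply, Finsupp.sum, ContinuousMap.coe_sum, Finset.sum_apply]
    rfl
  rwa [h3] at h2

/-- Trigonometric polynomials are dense in `L^p` for finite `p`. -/
lemma exists_trig_near_Lp {f : T2 → ℂ} {p : ℝ≥0∞} (h1 : 1 ≤ p) (hp : p ≠ ⊤)
    (hf : MemLp f p haarT) {ε : ℝ≥0∞} (hε : ε ≠ 0) : ∃ s c, eLpNorm (fun t => f t - trig s c t) p haarT ≤ ε := by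
  have hε2 : ε / 2 ≠ 0 := by simpa using hε
  obtain ⟨g, -, hg, hgc, -⟩ := hf.exists_hasCompactSupport_eLpNorm_sub_le hp hε2
  obtain ⟨δ, hδ, hδε⟩ : ∃ δ : ℝ, 0 < δ ∧ ENNReal.ofReal δ ≤ ε / 2 := by
    by_cases h : ε / 2 = ⊤
    · exact ⟨1, one_pos, by simp [h]⟩
    · exact ⟨(ε / 2).toReal, ENNReal.toReal_pos hε2 h, by rw [ENNReal.ofReal_toReal h]⟩
  obtain ⟨s, c, hsc⟩ := exists_trig_near hgc hδ
  refine ⟨s, c, ?_⟩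
  have h2 : eLpNorm (g - trig s c) p haarT ≤ ε / 2 := by
    refine (eLpNorm_le_of_ae_bound (C := δ) (Filter.Eventually.of_forall hsc)).trans ?_
    simpa using hδε
  have h3 : (fun t => f t - trig s c t) = (f - g) + (g - trig s c) := by
    funext t; simp
  rw [h3, ← ENNReal.add_halves ε]
  exact (eLpNorm_add_le (hf.1.sub hgc.aestronglyMeasurable)
    (hgc.sub (continuous_trig s c)).aestronglyMeasurable h1).trans (add_le_add hg h2)

/-! ### Bounds for integral operators -/

/-- Hölder's inequality for the measure with density `k`. -/
lemma lintegral_mul_rpow_le {X : Type*} [MeasurableSpace X] {μ : Measure X} {k F : X → ℝ≥0∞}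
    (hk : AEMeasurable k μ) (hF : AEMeasurable F μ) {r : ℝ} (hr : 1 ≤ r) {A : ℝ≥0∞}
    (hA : ∫⁻ x, k x ∂μ ≤ A) :
    (∫⁻ x, k x * F x ∂μ) ^ r ≤ A ^ (r - 1) * ∫⁻ x, k x * F x ^ r ∂μ := by
  rcases hr.eq_or_lt with rfl | hr
  · simp
  have hpq := Real.HolderConjugate.conjExponent hr
  set q := Real.conjExponent r
  have hr0 : 0 < r := by linarith
  have hq0 : 0 < q := hpq.symm.pos
  have h := ENNReal.lintegral_mul_le_Lp_mul_Lq μ hpq.symm (f := fun x => k x ^ (1 / q))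
    (g := fun x => k x ^ (1 / r) * F x) (hk.pow_const _) ((hk.pow_const _).mul hF)
  have e1 : ∀ x, ((fun x => k x ^ (1 / q)) * fun x => k x ^ (1 / r) * F x) x = k x * F x := by
    intro x
    rw [Pi.mul_apply, ← mul_assoc, ← ENNReal.rpow_add_of_nonneg _ _ (by positivity) (by positivity)]
    have : 1 / q + 1 / r = 1 := by simpa using hpq.symm.inv_add_inv_eq_one
    rw [this, ENNReal.rpow_one]
  have e2 : ∀ x, (k x ^ (1 / q)) ^ q = k x := fun x => by
    rw [← ENNReal.rpow_mul, one_div_mul_cancel hq0.ne', ENNReal.rpow_one]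
  have e3 : ∀ x, (k x ^ (1 / r) * F x) ^ r = k x * F x ^ r := fun x => by
    rw [ENNReal.mul_rpow_of_nonneg _ _ hr0.le, ← ENNReal.rpow_mul, one_div_mul_cancel hr0.ne',
      ENNReal.rpow_one]
  simp only [e1, e2, e3] at h
  have h2 := ENNReal.rpow_le_rpow h hr0.le
  rw [ENNReal.mul_rpow_of_nonneg _ _ hr0.le, ← ENNReal.rpow_mul, ← ENNReal.rpow_mul,
    one_div_mul_cancel hr0.ne', ENNReal.rpow_one] at h2
  refine h2.trans ?_
  gcongr
  have : 1 / q * r = r - 1 := by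
    have := hpq.symm.inv_add_inv_eq_one
    field_simp at this ⊢
    linarith
  rw [this]
  exact ENNReal.rpow_le_rpow hA (by linarith)

/-- Schur's test with equal bounds for rows and columns. -/
lemma eLpNorm_le_of_schur {X : Type*} [MeasurableSpace X] {μ : Measure X} [SFinite μ]
    {k : X → X → ℝ≥0∞} (hk : Measurable (Function.uncurry k)) {A : ℝ≥0}
    (h1 : ∀ x, ∫⁻ y, k x y ∂μ ≤ A) (h2 : ∀ y, ∫⁻ x, k x y ∂μ ≤ A) {f g : X → ℂ}
    (hf : AEStronglyMeasurable f μ) (hg : ∀ x, ‖g x‖ₑ ≤ ∫⁻ y, k x y * ‖f y‖ₑ ∂μ)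
    {p : ℝ≥0∞} (hp : 1 ≤ p) : eLpNorm g p μ ≤ A * eLpNorm f p μ := by
  rcases eq_or_ne p ⊤ with rfl | hpt
  · rw [eLpNorm_exponent_top, eLpNorm_exponent_top]
    refine essSup_le_of_ae_le _ (Filter.Eventually.of_forall fun x => (hg x).trans ?_)
    have : ∫⁻ y, k x y * ‖f y‖ₑ ∂μ ≤ ∫⁻ y, k x y * eLpNormEssSup f μ ∂μ := by
      refine lintegral_mono_ae ?_
      filter_upwards [enorm_ae_le_eLpNormEssSup f μ] with y hy
      gcongr
    refine this.trans ?_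
    rw [lintegral_mul_const _ (show Measurable (k x) from hk.comp measurable_prodMk_left)]
    dsimp only
    gcongr
    exact h1 x
  have hp0 : p ≠ 0 := (one_pos.trans_le hp).ne'
  have hr : 1 ≤ p.toReal := by
    rw [← ENNReal.toReal_one]
    exact ENNReal.toReal_mono hpt hp
  set r := p.toReal with hrdef
  have hr0 : 0 < r := by linarith
  rw [eLpNorm_eq_lintegral_rpow_enorm_toReal hp0 hpt, eLpNorm_eq_lintegral_rpow_enorm_toReal hp0 hpt,
    ← hrdef]
  have hkx : ∀ x, Measurable (k x) := fun x => hk.comp measurable_prodMk_left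
  have key : ∫⁻ x, ‖g x‖ₑ ^ r ∂μ ≤ (A : ℝ≥0∞) ^ r * ∫⁻ y, ‖f y‖ₑ ^ r ∂μ := by
    calc ∫⁻ x, ‖g x‖ₑ ^ r ∂μ ≤ ∫⁻ x, (A : ℝ≥0∞) ^ (r - 1) * ∫⁻ y, k x y * ‖f y‖ₑ ^ r ∂μ ∂μ := by
          refine lintegral_mono fun x => ?_
          exact (ENNReal.rpow_le_rpow (hg x) hr0.le).trans
            (lintegral_mul_rpow_le (hkx x).aemeasurable hf.enorm hr (h1 x))
      _ ≤ (A : ℝ≥0∞) ^ (r - 1) * ∫⁻ x, ∫⁻ y, k x y * ‖f y‖ₑ ^ r ∂μ ∂μ := by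
          rw [lintegral_const_mul' _ _
            (ENNReal.rpow_ne_top_of_nonneg (by linarith) ENNReal.coe_ne_top)]
      _ = (A : ℝ≥0∞) ^ (r - 1) * ∫⁻ y, ∫⁻ x, k x y * ‖f y‖ₑ ^ r ∂μ ∂μ := by
          rw [lintegral_lintegral_swap]
          exact hk.aemeasurable.mul ((hf.enorm.pow_const r).comp_snd)
      _ ≤ (A : ℝ≥0∞) ^ (r - 1) * ∫⁻ y, A * ‖f y‖ₑ ^ r ∂μ := by
          gcongr with y
          rw [lintegral_mul_const _
            (show Measurable fun x => k x y from hk.comp measurable_prodMk_right)]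
          gcongr
          exact h2 y
      _ = (A : ℝ≥0∞) ^ r * ∫⁻ y, ‖f y‖ₑ ^ r ∂μ := by
          rw [lintegral_const_mul'' _ (hf.enorm.pow_const r), ← mul_assoc]
          congr 1
          conv_lhs => enter [2]; rw [← ENNReal.rpow_one (A : ℝ≥0∞)]
          rw [← ENNReal.rpow_add_of_nonneg _ _ (by linarith) zero_le_one]
          simp
  calc (∫⁻ x, ‖g x‖ₑ ^ r ∂μ) ^ (1 / r) ≤ ((A : ℝ≥0∞) ^ r * ∫⁻ y, ‖f y‖ₑ ^ r ∂μ) ^ (1 / r) := by gcongr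
    _ = A * (∫⁻ y, ‖f y‖ₑ ^ r ∂μ) ^ (1 / r) := by
      rw [ENNReal.mul_rpow_of_nonneg _ _ (by positivity), ← ENNReal.rpow_mul,
        mul_one_div_cancel hr0.ne', ENNReal.rpow_one]

/-- Interpolation between `L²` and `L^∞`; for `p = ⊤` the exponents are `1` and `0`. -/
lemma eLpNorm_le_of_two_of_top {X : Type*} [MeasurableSpace X] {μ : Measure X} {g : X → ℂ}
    {p : ℝ≥0∞} (hp : 2 ≤ p) {a b : ℝ≥0∞} (hat : a ≠ ⊤)
    (ha : ∀ x, ‖g x‖ₑ ≤ a) (hb : eLpNorm g 2 μ ≤ b) :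
    eLpNorm g p μ ≤ a ^ (1 - 2 / p.toReal) * b ^ (2 / p.toReal) := by
  rcases eq_or_ne p ⊤ with rfl | hpt
  · simp only [ENNReal.toReal_top, div_zero, sub_zero, ENNReal.rpow_one, ENNReal.rpow_zero, mul_one]
    rw [eLpNorm_exponent_top]
    exact essSup_le_of_ae_le _ (Filter.Eventually.of_forall ha)
  have hp0 : p ≠ 0 := (two_pos.trans_le hp).ne'
  have hr : 2 ≤ p.toReal := by
    rw [← ENNReal.toReal_ofNat]
    exact ENNReal.toReal_mono hpt hp
  rw [eLpNorm_eq_lintegral_rpow_enorm_toReal hp0 hpt]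
  rw [eLpNorm_eq_lintegral_rpow_enorm_toReal (by norm_num) (by norm_num)] at hb
  set r := p.toReal with hrdef
  have hr0 : 0 < r := by linarith
  have h1 : ∫⁻ x, ‖g x‖ₑ ^ r ∂μ ≤ a ^ (r - 2) * ∫⁻ x, ‖g x‖ₑ ^ (2 : ℝ) ∂μ := by
    rw [← lintegral_const_mul' _ _ (ENNReal.rpow_ne_top_of_nonneg (by linarith) hat)]
    refine lintegral_mono fun x => ?_
    have : ‖g x‖ₑ ^ r = ‖g x‖ₑ ^ (r - 2) * ‖g x‖ₑ ^ (2 : ℝ) := by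
      rw [← ENNReal.rpow_add_of_nonneg _ _ (by linarith) (by norm_num)]
      congr 1; ring
    rw [this]
    gcongr
    exact ha x
  calc (∫⁻ x, ‖g x‖ₑ ^ r ∂μ) ^ (1 / r)
      ≤ (a ^ (r - 2) * ∫⁻ x, ‖g x‖ₑ ^ (2 : ℝ) ∂μ) ^ (1 / r) := by gcongr
    _ = a ^ (1 - 2 / r) * ((∫⁻ x, ‖g x‖ₑ ^ (2 : ℝ) ∂μ) ^ (1 / 2 : ℝ)) ^ (2 / r) := by
      rw [ENNReal.mul_rpow_of_nonneg _ _ (by positivity), ← ENNReal.rpow_mul, ← ENNReal.rpow_mul]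
      congr 2
      · field_simp
      · field_simp
    _ ≤ a ^ (1 - 2 / r) * b ^ (2 / r) := by
      gcongr
      simpa using hb

/-! ### Transfer of norms and bounds between the plane and the torus -/

/-- The homogeneous Sobolev norm of a function on the torus. -/
def hdotT (σ : ℝ) (f : T2 → ℂ) : ℝ≥0∞ :=
  (∑' k : {k : Fin 2 → ℤ // k ≠ 0},
    ENNReal.ofReal (‖freq k.1‖ ^ (2 * σ)) * ‖coef f k.1‖ₑ ^ 2) ^ (1 / 2 : ℝ)

lemma hdotNorm_eq (σ : ℝ) (φ : Plane → ℂ) : hdotNorm σ φ = hdotT σ fun t => φ (sec t) := by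
  simp only [hdotNorm, hdotT, fourierCoef_eq]

lemma hdotT_congr {σ : ℝ} {f g : T2 → ℂ} (h : ∀ k, k ≠ 0 → coef f k = coef g k) :
    hdotT σ f = hdotT σ g := by
  unfold hdotT
  congr 2
  funext k
  rw [h k.1 k.2]

lemma lpNorm_comp_toT (p : ℝ≥0∞) (g : T2 → ℂ) : lpNorm p (fun x => g (toT x)) =
    ENNReal.ofReal (4 * π ^ 2) ^ (1 / p.toReal) * eLpNorm g p haarT := by
  rw [lpNorm_eq]
  simp only [toT_sec]

lemma MemLpPer.sec {p : ℝ≥0∞} {φ : Plane → ℂ} (h : MemLpPer p φ) :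
    MemLp (fun t => φ (sec t)) p haarT := memLp_cell_iff.1 h.2

lemma MemLpPer.mono {p q : ℝ≥0∞} {φ : Plane → ℂ} (h : MemLpPer q φ) (hpq : p ≤ q) :
    MemLpPer p φ := ⟨h.1, h.2.mono_exponent hpq⟩

section Transfer

variable {S : Set ℕ} {h : ℕ → ℝ} {J : ℕ → (Plane → ℂ) → Plane → ℂ}
  {Op : ℕ → (T2 → ℂ) → T2 → ℂ}

/-- An `L^p` bound for operators on the torus gives one for the operators `J n` that they
represent. -/
lemma lp_bound_of_torus
    (hJ : ∀ n ∈ S, ∀ φ, MemLpPer 1 φ → J n φ = fun x => Op n (fun t => φ (sec t)) (toT x))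
    (hm : ∀ n ∈ S, ∀ f, Integrable f haarT → AEStronglyMeasurable (Op n f) haarT)
    {p : ℝ≥0∞} (hp : 1 ≤ p) {C : ℝ≥0}
    (hC : ∀ n ∈ S, ∀ f, MemLp f p haarT → eLpNorm (Op n f) p haarT ≤ C * eLpNorm f p haarT) :
    ∀ n ∈ S, ∀ φ, MemLpPer p φ → MemLpPer p (J n φ) ∧ lpNorm p (J n φ) ≤ C * lpNorm p φ := by
  intro n hn φ hφ
  rw [hJ n hn φ (hφ.mono hp)]
  have h1 := hφ.sec
  have h2 := hC n hn _ h1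
  refine ⟨memLpPer_comp_toT ⟨hm n hn _ (h1.integrable hp), h2.trans_lt
    (ENNReal.mul_lt_top ENNReal.coe_lt_top h1.2)⟩, ?_⟩
  rw [lpNorm_comp_toT, lpNorm_eq, mul_left_comm]
  gcongr

/-- Bounds from `L²` to `L²` and, with the loss of `1 / h n`, from `L²` to `L^∞` give the
`L² → L^p` bounds by interpolation. -/
lemma l2_lp_bound_of_torus (hh : ∀ n ∈ S, 0 < h n)
    (hJ : ∀ n ∈ S, ∀ φ, MemLpPer 1 φ → J n φ = fun x => Op n (fun t => φ (sec t)) (toT x))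
    (hm : ∀ n ∈ S, ∀ f, Integrable f haarT → AEStronglyMeasurable (Op n f) haarT)
    {C : ℝ≥0} (hC : ∀ n ∈ S, ∀ f, MemLp f 2 haarT → eLpNorm (Op n f) 2 haarT ≤ C * eLpNorm f 2 haarT)
    {D : ℝ≥0} (hD : ∀ n ∈ S, ∀ f, MemLp f 2 haarT →
      ∀ t, ‖Op n f t‖ₑ ≤ D * ENNReal.ofReal (h n)⁻¹ * eLpNorm f 2 haarT) :
    ∃ C : ℝ≥0, ∀ p : ℝ≥0∞, 2 ≤ p → ∀ n ∈ S, ∀ φ, MemLpPer 2 φ →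
      MemLpPer p (J n φ) ∧
        lpNorm p (J n φ) ≤ C * ENNReal.ofReal (h n ^ (2 / p.toReal - 1)) * lpNorm 2 φ := by
  set B : ℝ≥0 := max C D
  refine ⟨Real.toNNReal (4 * π ^ 2) * B, fun p hp n hn φ hφ => ?_⟩
  rw [hJ n hn φ (hφ.mono (by norm_num))]
  have h1 := hφ.sec
  set f : T2 → ℂ := fun t => φ (sec t)
  have hpos := hh n hn
  set θ := 2 / p.toReal with hθ
  have hr : p = ⊤ ∨ 2 ≤ p.toReal := by
    rcases eq_or_ne p ⊤ with hpt | hpt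
    · exact Or.inl hpt
    · right
      rw [← ENNReal.toReal_ofNat]
      exact ENNReal.toReal_mono hpt hp
  have hθ0 : 0 ≤ θ := by positivity
  have hθ1 : θ ≤ 1 := by
    rcases hr with rfl | hr
    · simp [hθ]
    · rw [hθ, div_le_one (by linarith)]; exact hr
  have hθ2 : 1 / p.toReal ≤ 1 := by
    have : 1 / p.toReal ≤ θ := by rw [hθ]; gcongr; norm_num
    linarith
  have key : eLpNorm (Op n f) p haarT ≤
      B * ENNReal.ofReal (h n ^ (θ - 1)) * eLpNorm f 2 haarT := by
    have ha : (B * ENNReal.ofReal (h n)⁻¹ * eLpNorm f 2 haarT) ≠ ⊤ := by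
      finiteness [h1.2.ne]
    refine (eLpNorm_le_of_two_of_top hp ha (fun t => (hD n hn f h1 t).trans ?_)
      ((hC n hn f h1).trans ?_) (b := B * eLpNorm f 2 haarT)).trans_eq ?_
    · gcongr; exact le_max_right _ _
    · gcongr; exact le_max_left _ _
    · have e : ∀ x : ℝ≥0∞, x ^ (1 - θ) * x ^ θ = x := fun x => by
        rw [← ENNReal.rpow_add_of_nonneg _ _ (by linarith) hθ0]; simp
      have e2 : ENNReal.ofReal (h n)⁻¹ ^ (1 - θ) = ENNReal.ofReal (h n ^ (θ - 1)) := by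
        rw [ENNReal.ofReal_rpow_of_pos (by positivity), Real.inv_rpow hpos.le,
          ← Real.rpow_neg hpos.le, neg_sub]
      rw [← hθ, mul_assoc, ENNReal.mul_rpow_of_nonneg _ _ (by linarith),
        ENNReal.mul_rpow_of_nonneg _ _ (by linarith), ENNReal.mul_rpow_of_nonneg _ _ hθ0, e2]
      calc _ = ((B : ℝ≥0∞) ^ (1 - θ) * (B : ℝ≥0∞) ^ θ) * ENNReal.ofReal (h n ^ (θ - 1)) *
            (eLpNorm f 2 haarT ^ (1 - θ) * eLpNorm f 2 haarT ^ θ) := by ring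
        _ = _ := by rw [e, e]
  refine ⟨memLpPer_comp_toT ⟨hm n hn _ (h1.integrable (by norm_num)), key.trans_lt ?_⟩, ?_⟩
  · have := h1.2
    finiteness
  rw [lpNorm_comp_toT, lpNorm_eq]
  have hc1 : (1 : ℝ≥0∞) ≤ ENNReal.ofReal (4 * π ^ 2) := by
    rw [ENNReal.one_le_ofReal]; nlinarith [Real.pi_gt_three]
  have hc2 : ENNReal.ofReal (4 * π ^ 2) ^ (1 / p.toReal) ≤ ENNReal.ofReal (4 * π ^ 2) := by
    conv_rhs => rw [← ENNReal.rpow_one (ENNReal.ofReal (4 * π ^ 2))]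
    exact ENNReal.rpow_le_rpow_of_exponent_le hc1 hθ2
  have hc3 : (1 : ℝ≥0∞) ≤ ENNReal.ofReal (4 * π ^ 2) ^ (1 / (2 : ℝ≥0∞).toReal) :=
    ENNReal.one_le_rpow hc1 (by norm_num)
  calc _ ≤ ENNReal.ofReal (4 * π ^ 2) *
        (B * ENNReal.ofReal (h n ^ (θ - 1)) * (1 * eLpNorm f 2 haarT)) := by
        rw [one_mul]; gcongr
    _ ≤ ENNReal.ofReal (4 * π ^ 2) * (B * ENNReal.ofReal (h n ^ (θ - 1)) *
        (ENNReal.ofReal (4 * π ^ 2) ^ (1 / (2 : ℝ≥0∞).toReal) * eLpNorm f 2 haarT)) := by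
        gcongr
    _ = _ := by
        rw [ENNReal.coe_mul]
        change _ = ENNReal.ofReal (4 * π ^ 2) * _ * _ * _
        ring

end Transfer

/-! ### Sobolev norms and the operators `Λ^β` -/

lemma MemLpPer.linear_comb {p : ℝ≥0∞} {φ η : Plane → ℂ} (hφ : MemLpPer p φ) (hη : MemLpPer p η)
    (a b : ℂ) : MemLpPer p (a • φ + b • η) := by
  refine ⟨fun i => ?_, (hφ.2.const_smul a).add (hη.2.const_smul b)⟩
  filter_upwards [hφ.1 i, hη.1 i] with x h1 h2
  simp [h1, h2]

lemma eLpNorm_sec_le (φ : Plane → ℂ) : eLpNorm (fun t => φ (sec t)) 2 haarT ≤ lpNorm 2 φ := by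
  rw [lpNorm_eq]
  refine le_mul_of_one_le_left (by simp) (ENNReal.one_le_rpow ?_ (by norm_num))
  rw [ENNReal.one_le_ofReal]; nlinarith [Real.pi_gt_three]

lemma norm_freq_pos {k : Fin 2 → ℤ} (hk : k ≠ 0) : 0 < ‖freq k‖ := by
  rw [norm_pos_iff]
  contrapose! hk
  funext i
  have := congrArg (fun x : Plane => x i) hk
  simpa [freq] using this

lemma norm_freq_zero : ‖freq 0‖ = 0 := by
  rw [norm_eq_zero]; ext i; simp [freq]

lemma freq_neg (k : Fin 2 → ℤ) : freq (-k) = -freq k := by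
  ext i; simp [freq]

lemma abs_le_norm_freq (k : Fin 2 → ℤ) (i : Fin 2) : |(k i : ℝ)| ≤ ‖freq k‖ := by
  simpa [freq] using PiLp.norm_apply_le (freq k) i

lemma hdotT_eq (σ : ℝ) (f : T2 → ℂ) : hdotT σ f =
    (∑' k : {k : Fin 2 → ℤ // k ≠ 0},
      (ENNReal.ofReal (‖freq k.1‖ ^ σ) * ‖coef f k.1‖ₑ) ^ 2) ^ (1 / 2 : ℝ) := by
  unfold hdotT
  congr 2
  funext k
  rw [mul_pow, ← ENNReal.ofReal_pow (by positivity), ← Real.rpow_natCast,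
    ← Real.rpow_mul (norm_nonneg _), mul_comm σ]
  norm_num

/-- A bound between the Fourier coefficients of two functions, weighted by powers of the
frequency, gives the corresponding bound between their Sobolev norms. -/
lemma hdotT_le {σ τ : ℝ} {f g : T2 → ℂ} {K : ℝ≥0∞}
    (h : ∀ k, k ≠ 0 → ENNReal.ofReal (‖freq k‖ ^ σ) * ‖coef f k‖ₑ ≤
      K * (ENNReal.ofReal (‖freq k‖ ^ τ) * ‖coef g k‖ₑ)) :
    hdotT σ f ≤ K * hdotT τ g := by
  rw [hdotT_eq, hdotT_eq]
  calc _ ≤ (∑' k : {k : Fin 2 → ℤ // k ≠ 0}, K ^ 2 *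
        (ENNReal.ofReal (‖freq k.1‖ ^ τ) * ‖coef g k.1‖ₑ) ^ 2) ^ (1 / 2 : ℝ) := by
        gcongr with k
        rw [← mul_pow]
        exact pow_le_pow_left₀ zero_le (h k.1 k.2) 2
    _ = _ := by
        rw [ENNReal.tsum_mul_left, ENNReal.mul_rpow_of_nonneg _ _ (by norm_num),
          ← ENNReal.rpow_natCast, ← ENNReal.rpow_mul]
        norm_num

lemma hdotT_zero_le {f : T2 → ℂ} (hf : MemLp f 2 haarT) : hdotT 0 f ≤ eLpNorm f 2 haarT := by
  unfold hdotT
  have h : ∑' k : {k : Fin 2 → ℤ // k ≠ 0},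
      ENNReal.ofReal (‖freq k.1‖ ^ (2 * (0 : ℝ))) * ‖coef f k.1‖ₑ ^ 2 ≤ eLpNorm f 2 haarT ^ 2 := by
    rw [← tsum_coef_sq hf]
    simp only [mul_zero, Real.rpow_zero, ENNReal.ofReal_one, one_mul]
    exact ENNReal.tsum_comp_le_tsum_of_injective Subtype.val_injective _
  calc _ ≤ (eLpNorm f 2 haarT ^ 2) ^ (1 / 2 : ℝ) := by gcongr
    _ = _ := by
      rw [← ENNReal.rpow_natCast, ← ENNReal.rpow_mul]; norm_num

/-- `Λ^β φ` exists in `L²`, by the Riesz–Fischer theorem. -/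
lemma exists_isLambda {β : ℝ} {φ : Plane → ℂ} (hφ : φ ∈ HdotPer β) : ∃ g, IsLambda β φ g := by
  obtain ⟨hm, hd⟩ := hφ
  have hfin : ∑' k, ‖((‖freq k‖ ^ β : ℝ) : ℂ) * fourierCoef φ k‖ₑ ^ 2 < ⊤ := by
    have e : ∀ k : Fin 2 → ℤ, ‖((‖freq k‖ ^ β : ℝ) : ℂ) * fourierCoef φ k‖ₑ ^ 2 =
        (ENNReal.ofReal (‖freq k‖ ^ β) * ‖fourierCoef φ k‖ₑ) ^ 2 := fun k => by
      rw [enorm_mul, ← ofReal_norm ((‖freq k‖ ^ β : ℝ) : ℂ), Complex.norm_real, Real.norm_of_nonneg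
        (by positivity)]
    have hs := ENNReal.summable.tsum_add_tsum_compl (s := ({0} : Set (Fin 2 → ℤ)))
      (f := fun k => ‖((‖freq k‖ ^ β : ℝ) : ℂ) * fourierCoef φ k‖ₑ ^ 2) ENNReal.summable
    rw [← hs]
    refine ENNReal.add_lt_top.2 ⟨?_, ?_⟩
    · rw [tsum_singleton (0 : Fin 2 → ℤ)
        (fun k => ‖((‖freq k‖ ^ β : ℝ) : ℂ) * fourierCoef φ k‖ₑ ^ 2)]
      finiteness
    · rw [hdotNorm_eq, hdotT_eq] at hd
      simp only [← fourierCoef_eq] at hd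
      have := (ENNReal.rpow_lt_top_iff_of_pos (by norm_num)).1 hd
      simp only [← e] at this
      exact this
  obtain ⟨f, hf, hc⟩ := exists_coef_eq hfin
  refine ⟨fun x => f (toT x), memLpPer_comp_toT hf, fun k => ?_⟩
  rw [fourierCoef_eq]
  simp only [toT_sec]
  exact hc k

/-! ### Modal cutoffs -/

section Modal

variable {S : Set ℕ} {h : ℕ → ℝ} {J : ℕ → (Plane → ℂ) → Plane → ℂ}

/-- The family `J` acts on Fourier series by the finitely supported symbols `m n`, which are
cutoffs at frequencies comparable to `1 / h n`. -/
structure IsModal (S : Set ℕ) (h : ℕ → ℝ) (J : ℕ → (Plane → ℂ) → Plane → ℂ)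
    (s : ℕ → Finset (Fin 2 → ℤ)) (m : ℕ → (Fin 2 → ℤ) → ℝ) (c₁ c₂ : ℝ) : Prop where
  pos : ∀ n ∈ S, 0 < h n
  le_one : ∀ n ∈ S, h n ≤ 1
  c₁_pos : 0 < c₁
  c₂_pos : 0 < c₂
  nonneg : ∀ n ∈ S, ∀ k, 0 ≤ m n k
  m_le_one : ∀ n ∈ S, ∀ k, m n k ≤ 1
  eq_zero : ∀ n ∈ S, ∀ k ∉ s n, m n k = 0
  norm_le : ∀ n ∈ S, ∀ k ∈ s n, ‖freq k‖ ≤ c₁ / h n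
  eq_one : ∀ n ∈ S, ∀ k, ‖freq k‖ < c₂ / h n → m n k = 1
  apply_eq : ∀ n ∈ S, ∀ φ, MemLpPer 1 φ → J n φ =
    fun x => trig (s n) (fun k => m n k * coef (fun t => φ (sec t)) k) (toT x)

namespace IsModal

variable {s : ℕ → Finset (Fin 2 → ℤ)} {m : ℕ → (Fin 2 → ℤ) → ℝ} {c₁ c₂ : ℝ}

lemma coef_trig (H : IsModal S h J s m c₁ c₂) {n : ℕ} (hn : n ∈ S) (f : T2 → ℂ)
    (k : Fin 2 → ℤ) : coef (trig (s n) (fun k => m n k * coef f k)) k = m n k * coef f k := by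
  rw [TorusInterp.coef_trig]
  split_ifs with hk
  · rfl
  · rw [H.eq_zero n hn k hk]; simp

lemma enorm_coef_trig_le (H : IsModal S h J s m c₁ c₂) {n : ℕ} (hn : n ∈ S) (f : T2 → ℂ)
    (k : Fin 2 → ℤ) : ‖coef (trig (s n) (fun k => m n k * coef f k)) k‖ₑ ≤ ‖coef f k‖ₑ := by
  rw [H.coef_trig hn, enorm_mul, ← ofReal_norm (m n k : ℂ), Complex.norm_real,
    Real.norm_of_nonneg (H.nonneg n hn k)]
  exact mul_le_of_le_one_left (by simp) (by simpa using H.m_le_one n hn k)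

lemma linear (H : IsModal S h J s m c₁ c₂) : ∀ n ∈ S, ∀ φ η : Plane → ℂ, MemLpPer 1 φ →
    MemLpPer 1 η → ∀ a b : ℂ, J n (a • φ + b • η) = a • J n φ + b • J n η := by
  intro n hn φ η hφ hη a b
  rw [H.apply_eq n hn _ hφ, H.apply_eq n hn _ hη, H.apply_eq n hn _ (hφ.linear_comb hη a b)]
  have hc : ∀ k, coef (fun t => (a • φ + b • η) (sec t)) k =
      a * coef (fun t => φ (sec t)) k + b * coef (fun t => η (sec t)) k := fun k => by
    have := coef_add ((hφ.sec.integrable le_rfl).const_mul a)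
      ((hη.sec.integrable le_rfl).const_mul b) k
    rw [coef_const_mul, coef_const_mul] at this
    exact this
  funext x
  simp only [hc]
  simp only [trig, Pi.add_apply, Pi.smul_apply, smul_eq_mul, Finset.mul_sum,
    ← Finset.sum_add_distrib]
  refine Finset.sum_congr rfl fun k _ => ?_
  ring

lemma eLpNorm_two_le (H : IsModal S h J s m c₁ c₂) {n : ℕ} (hn : n ∈ S) {f : T2 → ℂ}
    (hf : MemLp f 2 haarT) :
    eLpNorm (trig (s n) (fun k => m n k * coef f k)) 2 haarT ≤ eLpNorm f 2 haarT := by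
  rw [← ENNReal.pow_le_pow_left_iff two_ne_zero, ← tsum_coef_sq hf,
    ← tsum_coef_sq (memLp_of_continuous (continuous_trig _ _) 2)]
  gcongr with k
  exact H.enorm_coef_trig_le hn f k

/-- The number of frequencies is of the order `(h n)⁻²`. -/
lemma card_le (H : IsModal S h J s m c₁ c₂) {n : ℕ} (hn : n ∈ S) :
    ((s n).card : ℝ) ≤ ((2 * c₁ + 1) * (h n)⁻¹) ^ 2 := by
  have hpos := H.pos n hn
  set R := c₁ / h n
  have hR : 0 ≤ R := (div_pos H.c₁_pos hpos).le
  have hsub : s n ⊆ Fintype.piFinset fun _ : Fin 2 => Finset.Icc (-⌊R⌋) ⌊R⌋ := by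
    intro k hk
    rw [Fintype.mem_piFinset]
    intro i
    have h1 := abs_le.1 ((abs_le_norm_freq k i).trans (H.norm_le n hn k hk))
    rw [Finset.mem_Icc, neg_le, Int.le_floor, Int.le_floor]
    push_cast
    exact ⟨by linarith [h1.1], h1.2⟩
  have h2 := Finset.card_le_card hsub
  rw [Fintype.card_piFinset_const, Int.card_Icc] at h2
  have h3 : ((⌊R⌋ + 1 - -⌊R⌋).toNat : ℝ) ≤ (2 * c₁ + 1) * (h n)⁻¹ := by
    have h4 : (((⌊R⌋ + 1 - -⌊R⌋).toNat : ℤ) : ℝ) = 2 * ⌊R⌋ + 1 := by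
      rw [Int.toNat_of_nonneg (by have := Int.floor_nonneg.2 hR; omega)]
      push_cast; ring
    rw [Int.cast_natCast] at h4
    rw [h4]
    have h5 := Int.floor_le R
    have h6 : 1 ≤ (h n)⁻¹ := (one_le_inv₀ hpos).2 (H.le_one n hn)
    have h7 : R = c₁ * (h n)⁻¹ := div_eq_mul_inv _ _
    nlinarith
  calc ((s n).card : ℝ) ≤ (((⌊R⌋ + 1 - -⌊R⌋).toNat : ℝ)) ^ 2 := by exact_mod_cast h2
    _ ≤ _ := by gcongr

/-- The bound from `L²` to `L^∞` is the Cauchy–Schwarz inequality on the frequency side. -/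
lemma enorm_apply_le (H : IsModal S h J s m c₁ c₂) {n : ℕ} (hn : n ∈ S) {f : T2 → ℂ}
    (hf : MemLp f 2 haarT) (t : T2) :
    ‖trig (s n) (fun k => m n k * coef f k) t‖ₑ ≤
      ENNReal.ofReal ((2 * c₁ + 1) * (h n)⁻¹) * eLpNorm f 2 haarT := by
  have h1 : ‖trig (s n) (fun k => m n k * coef f k) t‖ₑ ≤ ∑ k ∈ s n, 1 * ‖coef f k‖ₑ := by
    refine (enorm_sum_le _ _).trans (Finset.sum_le_sum fun k hk => ?_)
    have := H.enorm_coef_trig_le hn f k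
    rw [H.coef_trig hn] at this
    rw [enorm_mul, ← ofReal_norm (mFourier k t), norm_mFourier_apply, ENNReal.ofReal_one, mul_one,
      one_mul]
    exact this
  have h2 := ENNReal.inner_le_Lp_mul_Lq (s n) (fun _ => 1) (fun k => ‖coef f k‖ₑ)
    (p := 2) (q := 2) (by constructor <;> norm_num)
  refine h1.trans (h2.trans ?_)
  simp only [ENNReal.one_rpow, Finset.sum_const, nsmul_eq_mul, mul_one]
  gcongr
  · calc ((s n).card : ℝ≥0∞) ^ (1 / 2 : ℝ)
        ≤ (ENNReal.ofReal (((2 * c₁ + 1) * (h n)⁻¹) ^ 2)) ^ (1 / 2 : ℝ) := by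
          gcongr
          rw [← ENNReal.ofReal_natCast]
          exact ENNReal.ofReal_le_ofReal (H.card_le hn)
      _ = _ := by
          have := H.c₁_pos
          have := H.pos n hn
          rw [ENNReal.ofReal_rpow_of_nonneg (by positivity) (by norm_num), ← Real.sqrt_eq_rpow,
            Real.sqrt_sq (by positivity)]
  · calc (∑ k ∈ s n, ‖coef f k‖ₑ ^ (2 : ℝ)) ^ (1 / 2 : ℝ)
        ≤ (eLpNorm f 2 haarT ^ 2) ^ (1 / 2 : ℝ) := by
          rw [← tsum_coef_sq hf]
          gcongr
          simp only [ENNReal.rpow_two]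
          exact ENNReal.sum_le_tsum _
      _ = _ := by rw [← ENNReal.rpow_natCast, ← ENNReal.rpow_mul]; norm_num

lemma l2_lp_bound (H : IsModal S h J s m c₁ c₂) : ∃ C : ℝ≥0, ∀ p : ℝ≥0∞, 2 ≤ p → ∀ n ∈ S, ∀ φ,
    MemLpPer 2 φ → MemLpPer p (J n φ) ∧
      lpNorm p (J n φ) ≤ C * ENNReal.ofReal (h n ^ (2 / p.toReal - 1)) * lpNorm 2 φ :=
  l2_lp_bound_of_torus (Op := fun n f => trig (s n) (fun k => m n k * coef f k)) H.pos H.apply_eq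
    (fun _ _ _ _ => (continuous_trig _ _).aestronglyMeasurable) (C := 1)
    (fun n hn f hf => by simpa using H.eLpNorm_two_le hn hf)
    (D := (2 * c₁ + 1).toNNReal) (fun n hn f hf t => by
      refine (H.enorm_apply_le hn hf t).trans_eq ?_
      rw [ENNReal.ofReal_mul (by linarith [H.c₁_pos])]
      rfl)

lemma memLpPer (H : IsModal S h J s m c₁ c₂) {n : ℕ} (hn : n ∈ S) {φ : Plane → ℂ}
    (hφ : MemLpPer 1 φ) (p : ℝ≥0∞) : MemLpPer p (J n φ) := by
  rw [H.apply_eq n hn _ hφ]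
  exact memLpPer_comp_toT (memLp_of_continuous (continuous_trig _ _) p)

lemma fourierCoef_apply (H : IsModal S h J s m c₁ c₂) {n : ℕ} (hn : n ∈ S) {φ : Plane → ℂ}
    (hφ : MemLpPer 1 φ) (k : Fin 2 → ℤ) : fourierCoef (J n φ) k = m n k * fourierCoef φ k := by
  rw [H.apply_eq n hn _ hφ, fourierCoef_eq, fourierCoef_eq]
  simp only [toT_sec]
  exact H.coef_trig hn _ k

lemma enorm_m (H : IsModal S h J s m c₁ c₂) {n : ℕ} (hn : n ∈ S) (k : Fin 2 → ℤ) :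
    ‖(m n k : ℂ)‖ₑ = ENNReal.ofReal (m n k) := by
  rw [← ofReal_norm (m n k : ℂ), Complex.norm_real, Real.norm_of_nonneg (H.nonneg n hn k)]

lemma l2_hdot_bound (H : IsModal S h J s m c₁ c₂) {β : ℝ} (hβ : 0 ≤ β) :
    ∃ C : ℝ≥0, ∀ n ∈ S, ∀ φ, MemLpPer 2 φ → J n φ ∈ HdotPer β ∧
      hdotNorm β (J n φ) ≤ C * ENNReal.ofReal (h n ^ (-β)) * lpNorm 2 φ := by
  refine ⟨(c₁ ^ β).toNNReal, fun n hn φ hφ => ?_⟩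
  have hφ1 : MemLpPer 1 φ := hφ.mono (by norm_num)
  have hpos := H.pos n hn
  have hc := H.c₁_pos
  have key : hdotNorm β (J n φ) ≤
      (c₁ ^ β).toNNReal * ENNReal.ofReal (h n ^ (-β)) * lpNorm 2 φ := by
    rw [hdotNorm_eq]
    have h1 : hdotT β (fun t => J n φ (sec t)) ≤
        ((c₁ ^ β).toNNReal * ENNReal.ofReal (h n ^ (-β))) * hdotT 0 (fun t => φ (sec t)) := by
      refine hdotT_le fun k hk => ?_
      rw [← fourierCoef_eq, ← fourierCoef_eq, H.fourierCoef_apply hn hφ1, Real.rpow_zero,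
        ENNReal.ofReal_one, one_mul, enorm_mul, H.enorm_m hn, ← mul_assoc]
      gcongr ?_ * _
      by_cases hks : k ∈ s n
      · calc ENNReal.ofReal (‖freq k‖ ^ β) * ENNReal.ofReal (m n k)
            ≤ ENNReal.ofReal ((c₁ / h n) ^ β) * ENNReal.ofReal 1 := by
              gcongr
              · exact H.norm_le n hn k hks
              · exact H.m_le_one n hn k
          _ = _ := by
              rw [ENNReal.ofReal_one, mul_one, Real.div_rpow hc.le hpos.le, div_eq_mul_inv,
                ← Real.rpow_neg hpos.le, ENNReal.ofReal_mul (by positivity)]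
              rfl
      · rw [H.eq_zero n hn k hks]; simp
    refine h1.trans ?_
    gcongr
    exact (hdotT_zero_le hφ.sec).trans (eLpNorm_sec_le φ)
  refine ⟨⟨H.memLpPer hn hφ1 2, key.trans_lt ?_⟩, key⟩
  have : lpNorm 2 φ < ⊤ := hφ.2.2
  finiteness

lemma approx (H : IsModal S h J s m c₁ c₂) {α β : ℝ} (hαβ : α < β) :
    ∃ C : ℝ≥0, ∀ n ∈ S, ∀ φ ∈ HdotPer β,
      hdotNorm α (φ - J n φ) ≤ C * ENNReal.ofReal (h n ^ (β - α)) * hdotNorm β φ := by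
  have hc := H.c₂_pos
  refine ⟨(c₂ ^ (α - β)).toNNReal, fun n hn φ hφ => ?_⟩
  have hφ1 : MemLpPer 1 φ := hφ.1.mono (by norm_num)
  have hpos := H.pos n hn
  rw [hdotNorm_eq, hdotNorm_eq]
  refine hdotT_le fun k hk => ?_
  have hck : coef (fun t => (φ - J n φ) (sec t)) k = (1 - m n k : ℝ) * coef (fun t => φ (sec t)) k := by
    have := coef_sub (hφ1.sec.integrable le_rfl) ((H.memLpPer hn hφ1 1).sec.integrable le_rfl) k
    rw [← fourierCoef_eq (J n φ), H.fourierCoef_apply hn hφ1, fourierCoef_eq] at this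
    refine Eq.trans this ?_
    push_cast; ring
  rw [hck, enorm_mul, ← ofReal_norm, Complex.norm_real, Real.norm_of_nonneg
    (sub_nonneg.2 (H.m_le_one n hn k)), ← mul_assoc, ← mul_assoc]
  gcongr ?_ * _
  by_cases hks : ‖freq k‖ < c₂ / h n
  · rw [H.eq_one n hn k hks]; simp
  · push Not at hks
    have hkp := norm_freq_pos hk
    have e : ‖freq k‖ ^ α = ‖freq k‖ ^ (α - β) * ‖freq k‖ ^ β := by
      rw [← Real.rpow_add hkp]; simp
    have e2 : (c₂ / h n) ^ (α - β) = c₂ ^ (α - β) * h n ^ (β - α) := by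
      rw [Real.div_rpow hc.le hpos.le, div_eq_mul_inv, ← Real.rpow_neg hpos.le, neg_sub]
    calc ENNReal.ofReal (‖freq k‖ ^ α) * ENNReal.ofReal (1 - m n k)
        ≤ ENNReal.ofReal ((c₂ / h n) ^ (α - β) * ‖freq k‖ ^ β) * ENNReal.ofReal 1 := by
          rw [e]
          have h1 : ‖freq k‖ ^ (α - β) ≤ (c₂ / h n) ^ (α - β) :=
            Real.rpow_le_rpow_of_nonpos (by positivity) hks (by linarith)
          have h2 : 1 - m n k ≤ 1 := by linarith [H.nonneg n hn k]
          gcongr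
      _ = _ := by
          rw [ENNReal.ofReal_one, mul_one, e2, ENNReal.ofReal_mul (by positivity),
            ENNReal.ofReal_mul (by positivity)]
          rfl

lemma commute (H : IsModal S h J s m c₁ c₂) (β : ℝ) : ∀ n ∈ S, ∀ φ ∈ HdotPer β,
    (∃ g, IsLambda β φ g) ∧ (∃ g, IsLambda β (J n φ) g) ∧
      ∀ g g', IsLambda β φ g → IsLambda β (J n φ) g' → g' =ᵐ[cellMeasure] J n g := by
  intro n hn φ hφ
  have hφ1 : MemLpPer 1 φ := hφ.1.mono (by norm_num)
  refine ⟨exists_isLambda hφ, exists_isLambda ⟨H.memLpPer hn hφ1 2, ?_⟩, fun g g' hg hg' => ?_⟩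
  · have h1 : hdotNorm β (J n φ) ≤ 1 * hdotNorm β φ := by
      rw [hdotNorm_eq, hdotNorm_eq]
      refine hdotT_le fun k _ => ?_
      rw [one_mul]
      gcongr ENNReal.ofReal _ * ?_
      rw [H.apply_eq n hn φ hφ1]
      simp only [toT_sec]
      exact H.enorm_coef_trig_le hn _ k
    rw [one_mul] at h1
    exact h1.trans_lt hφ.2
  · have hg1 : MemLpPer 1 g := hg.1.mono (by norm_num)
    refine ae_cell_iff.2 (ae_eq_of_coef_eq hg'.1.sec (H.memLpPer hn hg1 2).sec fun k => ?_)
    rw [← fourierCoef_eq, ← fourierCoef_eq, hg'.2, H.fourierCoef_apply hn hg1,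
      H.fourierCoef_apply hn hφ1, hg.2]
    ring

/-- A modal family with the `L^p` bounds is of Type II. -/
lemma isTypeII (H : IsModal S h J s m c₁ c₂)
    (hp : ∀ p : ℝ≥0∞, 1 < p → p < ⊤ → ∃ C : ℝ≥0, ∀ n ∈ S, ∀ φ, MemLpPer p φ →
      MemLpPer p (J n φ) ∧ lpNorm p (J n φ) ≤ C * lpNorm p φ) : IsTypeII S h J where
  linear := H.linear
  lp_bound := hp
  l2_lp_bound p h2 _ := by
    obtain ⟨C, hC⟩ := H.l2_lp_bound
    exact ⟨C, hC p h2⟩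
  l2_hdot_bound _ hβ := H.l2_hdot_bound hβ
  approx _ _ hαβ := H.approx hαβ
  commute := H.commute

end IsModal

end Modal

/-! ### M. Riesz's inequality on the disc -/

/-- The trigonometric form of the pointwise inequality in M. Riesz's theorem. -/
lemma exists_cos_rpow_bound {p : ℝ} (hp : 1 < p) (hp2 : p ≤ 2) : ∃ A B : ℝ, 0 ≤ A ∧ 0 ≤ B ∧
    ∀ θ : ℝ, |θ| ≤ π / 2 → 1 ≤ A * Real.cos θ ^ p - B * Real.cos (θ * p) := by
  have hpi := Real.pi_pos
  have hp0 : 0 < p := by linarith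
  -- beyond the angle `θ₁ < π / 2` the cosine of `p θ` is bounded above by a negative number
  set θ₁ := π / 4 * (1 + 1 / p) with hθ₁
  have h1p : 1 / p < 1 := by rw [div_lt_one hp0]; exact hp
  have h1p0 : 0 < 1 / p := by positivity
  have hθ₁p : θ₁ * p = π / 4 * (p + 1) := by rw [hθ₁]; field_simp
  have hκ : Real.cos (θ₁ * p) < 0 := by
    refine Real.cos_neg_of_pi_div_two_lt_of_lt ?_ ?_ <;> rw [hθ₁p] <;> nlinarith
  have hc : 0 < Real.cos θ₁ := by
    refine Real.cos_pos_of_mem_Ioo ⟨?_, ?_⟩ <;> nlinarith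
  set κ := -Real.cos (θ₁ * p) with hκdef
  have hκ0 : 0 < κ := by linarith
  refine ⟨(1 + κ⁻¹) / Real.cos θ₁ ^ p, κ⁻¹, by positivity, by positivity, fun θ hθ => ?_⟩
  have hcos0 : 0 ≤ Real.cos θ := Real.cos_nonneg_of_mem_Icc ⟨by linarith [(abs_le.1 hθ).1],
    (abs_le.1 hθ).2⟩
  rcases le_total θ₁ |θ| with h | h
  · have h2 : Real.cos (θ * p) ≤ Real.cos (θ₁ * p) := by
      rw [← Real.cos_abs (θ * p), abs_mul, abs_of_pos hp0]
      refine Real.cos_le_cos_of_nonneg_of_le_pi (by positivity) (by nlinarith) (by gcongr)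
    have h3 : 1 ≤ -(κ⁻¹ * Real.cos (θ * p)) := by
      rw [← mul_neg, ← div_eq_inv_mul, le_div_iff₀ hκ0]
      linarith
    have h4 : 0 ≤ (1 + κ⁻¹) / Real.cos θ₁ ^ p * Real.cos θ ^ p := by positivity
    linarith
  · have h2 : Real.cos θ₁ ≤ Real.cos θ := by
      rw [← Real.cos_abs θ]
      refine Real.cos_le_cos_of_nonneg_of_le_pi (abs_nonneg _) ?_ h
      nlinarith
    have h3 : 1 + κ⁻¹ ≤ (1 + κ⁻¹) / Real.cos θ₁ ^ p * Real.cos θ ^ p := by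
      rw [div_mul_eq_mul_div, le_div_iff₀ (by positivity)]
      gcongr
    have h4 : κ⁻¹ * Real.cos (θ * p) ≤ κ⁻¹ * 1 := by
      gcongr
      exact Real.cos_le_one _
    linarith

/-- On the right half-plane, `|z|^p` is controlled by `(Re z)^p` and a harmonic function. -/
lemma exists_norm_rpow_le {p : ℝ} (hp : 1 < p) (hp2 : p ≤ 2) : ∃ A B : ℝ, 0 ≤ A ∧ 0 ≤ B ∧
    ∀ z : ℂ, 0 < z.re → ‖z‖ ^ p ≤ A * z.re ^ p - B * (z ^ (p : ℂ)).re := by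
  obtain ⟨A, B, hA, hB, h⟩ := exists_cos_rpow_bound hp hp2
  refine ⟨A, B, hA, hB, fun z hz => ?_⟩
  have h1 := h z.arg (Complex.abs_arg_le_pi_div_two_iff.2 hz.le)
  have hcos : 0 ≤ Real.cos z.arg := Real.cos_nonneg_of_mem_Icc
    (abs_le.1 (Complex.abs_arg_le_pi_div_two_iff.2 hz.le))
  rw [Complex.cpow_ofReal_re, ← Complex.norm_mul_cos_arg z, Real.mul_rpow (norm_nonneg _) hcos]
  have : 0 ≤ ‖z‖ ^ p := by positivity
  nlinarith

/-- The minimum principle for the real part, from the maximum principle for `exp (-F)`. -/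
lemma re_pos_of_re_pos_sphere {F : ℂ → ℂ} (hF : Differentiable ℂ F)
    (hpos : ∀ z ∈ Metric.sphere (0 : ℂ) 1, 0 < (F z).re) :
    ∀ z ∈ Metric.closedBall (0 : ℂ) 1, 0 < (F z).re := by
  obtain ⟨w, hw, hmin⟩ := (isCompact_sphere (0 : ℂ) 1).exists_isMinOn
    (NormedSpace.sphere_nonempty.2 zero_le_one) (Complex.continuous_re.comp hF.continuous).continuousOn
  intro z hz
  have h := Complex.norm_le_of_forall_mem_frontier_norm_le (U := Metric.ball (0 : ℂ) 1)
    (f := fun z => Complex.exp (-F z)) (C := Real.exp (-(F w).re)) Metric.isBounded_ball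
    hF.neg.cexp.diffContOnCl ?_ (z := z) ?_
  · rw [Complex.norm_exp, Real.exp_le_exp, Complex.neg_re] at h
    linarith [hpos w hw]
  · intro y hy
    rw [frontier_ball _ one_ne_zero] at hy
    rw [Complex.norm_exp, Real.exp_le_exp, Complex.neg_re, neg_le_neg_iff]
    exact hmin hy
  · rwa [closure_ball _ one_ne_zero]

/-- M. Riesz's inequality for an entire function with positive real part on the unit circle. -/
lemma exists_circleAverage_norm_rpow_le {p : ℝ} (hp : 1 < p) (hp2 : p ≤ 2) : ∃ A : ℝ, 0 ≤ A ∧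
    ∀ F : ℂ → ℂ, Differentiable ℂ F → (∀ z ∈ Metric.sphere (0 : ℂ) 1, 0 < (F z).re) →
    (F 0).im = 0 →
    Real.circleAverage (fun z => ‖F z‖ ^ p) 0 1 ≤ A * Real.circleAverage (fun z => (F z).re ^ p) 0 1 := by
  obtain ⟨A, B, hA, hB, h⟩ := exists_norm_rpow_le hp hp2
  refine ⟨A, hA, fun F hF hpos him => ?_⟩
  have hball := re_pos_of_re_pos_sphere hF hpos
  have hp0 : 0 < p := by linarith
  have hslit : ∀ z ∈ Metric.closedBall (0 : ℂ) 1, F z ∈ Complex.slitPlane := fun z hz =>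
    Or.inl (hball z hz)
  have hd : DiffContOnCl ℂ (fun z => F z ^ (p : ℂ)) (Metric.ball (0 : ℂ) |1|) := by
    refine DifferentiableOn.diffContOnCl fun z hz => ?_
    rw [abs_one, closure_ball _ one_ne_zero] at hz
    exact ((hF z).cpow_const (hslit z hz)).differentiableWithinAt
  have hcp : ContinuousOn (fun z => F z ^ (p : ℂ)) (Metric.sphere (0 : ℂ) 1) := by
    refine (hd.continuousOn).mono ?_
    rw [abs_one, closure_ball _ one_ne_zero]
    exact Metric.sphere_subset_closedBall
  -- `Re (F^p)` is harmonic, and its mean `Re (F(0)^p)` is nonnegative, as `F(0) > 0`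
  have hmean := hd.circleAverage
  have hci := hcp.circleIntegrable zero_le_one
  have hcre : CircleIntegrable (fun z => (F z ^ (p : ℂ)).re) 0 1 :=
    (Complex.continuous_re.comp_continuousOn hcp).circleIntegrable zero_le_one
  have hmre : Real.circleAverage (fun z => (F z ^ (p : ℂ)).re) 0 1 = (F 0 ^ (p : ℂ)).re := by
    rw [← hmean]
    exact Complex.reCLM.circleAverage_comp_comm hci
  have h0 : 0 ≤ (F 0 ^ (p : ℂ)).re := by
    have : F 0 = ((F 0).re : ℂ) := Complex.ext rfl (by simpa using him)
    rw [Complex.cpow_ofReal_re, this, Complex.arg_ofReal_of_nonneg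
      (hball 0 (Metric.mem_closedBall_self zero_le_one)).le, zero_mul, Real.cos_zero, mul_one]
    positivity
  have hcn : CircleIntegrable (fun z => ‖F z‖ ^ p) 0 1 :=
    ((hF.continuous.norm.rpow_const fun _ => Or.inr hp0.le).continuousOn).circleIntegrable
      zero_le_one
  have hcF : CircleIntegrable (fun z => (F z).re ^ p) 0 1 :=
    (((Complex.continuous_re.comp hF.continuous).rpow_const
      fun _ => Or.inr hp0.le).continuousOn).circleIntegrable zero_le_one
  have hm := Real.circleAverage_mono (f₁ := fun z => ‖F z‖ ^ p)
    (f₂ := fun z => A • (F z).re ^ p - B • (F z ^ (p : ℂ)).re) hcn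
    ((hcF.const_smul (a := A)).sub (hcre.const_smul (a := B))) (fun z hz => by
      rw [abs_one] at hz
      simpa using h (F z) (hpos z hz))
  replace hm := hm.trans_eq (Real.circleAverage_fun_sub (f₁ := fun z => A • (F z).re ^ p)
    (f₂ := fun z => B • (F z ^ (p : ℂ)).re) (hcF.const_smul (a := A)) (hcre.const_smul (a := B)))
  rw [Real.circleAverage_fun_smul, Real.circleAverage_fun_smul, hmre] at hm
  simp only [smul_eq_mul] at hm
  nlinarith

/-! ### M. Riesz's inequality on the torus -/

/-- The rotation of the `i`-th circle by the angle `θ`. -/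
def rot (i : Fin 2) (θ : ℝ) : T2 := Pi.single i ((θ / (2 * π) : ℝ) : UnitAddCircle)

lemma mFourier_rot (k : Fin 2 → ℤ) (i : Fin 2) (θ : ℝ) :
    mFourier k (rot i θ) = circleMap 0 1 θ ^ k i := by
  have h : mFourier k (rot i θ) = ∏ j, fourier (k j) (rot i θ j) := rfl
  rw [h, Finset.prod_eq_single i]
  · rw [rot, Pi.single_eq_same, fourier_coe_apply, circleMap_zero, Complex.ofReal_one, one_mul,
      ← Complex.exp_int_mul]
    congr 1
    have : (π : ℂ) ≠ 0 := by exact_mod_cast Real.pi_ne_zero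
    push_cast
    field_simp
  · intro j _ hj
    rw [rot, Pi.single_eq_of_ne hj, fourier_eval_zero]
  · simp

lemma continuous_rot (i : Fin 2) : Continuous (rot i) := by
  refine continuous_pi fun j => ?_
  by_cases h : j = i
  · subst h
    simp only [rot, Pi.single_eq_same]
    exact (AddCircle.continuous_mk' 1).comp (by fun_prop)
  · simp only [rot, Pi.single_eq_of_ne h]
    exact continuous_const

/-- The mean over the torus is the mean of the means over the circles in the `i`-th direction. -/
lemma integral_eq_integral_circle {G : T2 → ℝ} (hG : Continuous G) (i : Fin 2) :
    ∫ t, G t ∂haarT = ∫ t, ((2 * π)⁻¹ * ∫ θ in 0..2 * π, G (t + rot i θ)) ∂haarT := by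
  have hpi := Real.pi_pos
  have hc : Continuous (Function.uncurry fun (t : T2) (θ : ℝ) => G (t + rot i θ)) :=
    hG.comp (continuous_fst.add ((continuous_rot i).comp continuous_snd))
  obtain ⟨C, hC⟩ := (isCompact_range hG).isBounded.exists_norm_le
  have hint : Integrable (Function.uncurry fun (t : T2) (θ : ℝ) => G (t + rot i θ))
      (haarT.prod (volume.restrict (Ioc 0 (2 * π)))) :=
    Integrable.of_bound hc.aestronglyMeasurable C
      (Filter.Eventually.of_forall fun t => hC _ (mem_range_self _))
  rw [integral_const_mul]
  simp only [intervalIntegral.integral_of_le (by positivity : (0 : ℝ) ≤ 2 * π)]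
  rw [integral_integral_swap hint]
  simp only [integral_add_right_eq_self]
  rw [setIntegral_const]
  simp [hpi.le]
  field_simp

/-- For a real trigonometric polynomial, the conjugation of a multiplier reflects its symbol. -/
lemma conj_trig {s : Finset (Fin 2 → ℤ)} {c : (Fin 2 → ℤ) → ℂ} (hs : ∀ k ∈ s, -k ∈ s)
    (hc : ∀ k, c (-k) = starRingEnd ℂ (c k)) (w : (Fin 2 → ℤ) → ℝ) (t : T2) :
    starRingEnd ℂ (trig s (fun k => w k * c k) t) = trig s (fun k => w (-k) * c k) t := by
  unfold trig
  rw [map_sum]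
  refine Finset.sum_nbij' (fun k => -k) (fun k => -k) hs hs (by simp) (by simp) fun k _ => ?_
  simp only [map_mul, Complex.conj_ofReal, neg_neg, hc, UnitAddTorus.mFourier_neg]

/-- The symbol `1 + sgn kᵢ`: twice the projection to the positive frequencies. -/
def symH (i : Fin 2) (k : Fin 2 → ℤ) : ℝ := 1 + SignType.sign (k i)

lemma symH_of_neg {i : Fin 2} {k : Fin 2 → ℤ} (h : k i < 0) : symH i k = 0 := by
  simp [symH, sign_neg h]

lemma symH_of_pos {i : Fin 2} {k : Fin 2 → ℤ} (h : 0 < k i) : symH i k = 2 := by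
  simp [symH, sign_pos h]; norm_num

lemma symH_of_zero {i : Fin 2} {k : Fin 2 → ℤ} (h : k i = 0) : symH i k = 1 := by
  simp [symH, h]

/-- By this identity the multiplier `symH i` leaves the real part of a real function unchanged. -/
lemma symH_add_neg (i : Fin 2) (k : Fin 2 → ℤ) : symH i k + symH i (-k) = 2 := by
  simp [symH, Left.sign_neg]; ring

/-- M. Riesz's inequality for positive trigonometric polynomials. -/
lemma exists_riesz_pos {p : ℝ≥0∞} (hp : 1 < p) (hp2 : p ≤ 2) (i : Fin 2) : ∃ C : ℝ≥0,
    ∀ (s : Finset (Fin 2 → ℤ)) (c : (Fin 2 → ℤ) → ℂ), (∀ k ∈ s, -k ∈ s) →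
      (∀ k, c (-k) = starRingEnd ℂ (c k)) → (∀ t, 0 < (trig s c t).re) →
      eLpNorm (trig s fun k => symH i k * c k) p haarT ≤ C * eLpNorm (trig s c) p haarT := by
  have hpt : p ≠ ⊤ := (hp2.trans_lt (by norm_num)).ne
  have hp0 : p ≠ 0 := (one_pos.trans hp).ne'
  set r := p.toReal with hr
  have hr1 : 1 < r := by
    rw [hr, ← ENNReal.toReal_one]; exact ENNReal.toReal_strict_mono hpt hp
  have hr2 : r ≤ 2 := by
    rw [hr, ← ENNReal.toReal_ofNat]; exact ENNReal.toReal_mono (by norm_num) hp2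
  obtain ⟨A, hA, hF⟩ := exists_circleAverage_norm_rpow_le hr1 hr2
  refine ⟨(A ^ (1 / r)).toNNReal, fun s c hs hc hpos => ?_⟩
  set Hq := trig s fun k => symH i k * c k with hHq
  have hre : ∀ t, (Hq t).re = (trig s c t).re := fun t => by
    have h1 := conj_trig hs hc (symH i) t
    have h2 : Hq t + starRingEnd ℂ (Hq t) = 2 * trig s c t := by
      rw [hHq, h1]
      simp only [trig, ← Finset.sum_add_distrib, Finset.mul_sum]
      refine Finset.sum_congr rfl fun k _ => ?_
      have := congrArg (fun x : ℝ => (x : ℂ)) (symH_add_neg i k)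
      push_cast at this
      rw [← add_mul, ← add_mul, this]
      ring
    rw [Complex.add_conj] at h2
    have h3 := congrArg Complex.re h2
    simp at h3
    exact h3
  have him : ∀ t, (trig s c t).im = 0 := fun t => by
    have h1 := conj_trig hs hc (fun _ => 1) t
    simp only [Complex.ofReal_one, one_mul] at h1
    exact Complex.conj_eq_iff_im.1 h1
  have hnorm : ∀ t, ‖trig s c t‖ = (Hq t).re := fun t => by
    rw [hre]
    have : trig s c t = ((trig s c t).re : ℂ) := Complex.ext rfl (by simpa using him t)
    rw [this, Complex.norm_real, Real.norm_of_nonneg (by simpa using (hpos t).le), Complex.ofReal_re]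
  have hHc : Continuous Hq := continuous_trig _ _
  -- the analytic extension of `Hq` to the disc in the `i`-th variable
  have key : ∀ t, (2 * π)⁻¹ * ∫ θ in 0..2 * π, ‖Hq (t + rot i θ)‖ ^ r ≤
      A * ((2 * π)⁻¹ * ∫ θ in 0..2 * π, (Hq (t + rot i θ)).re ^ r) := by
    intro t
    set F : ℂ → ℂ := fun z => ∑ k ∈ s, symH i k * c k * mFourier k t * z ^ (k i).toNat with hFdef
    have hval : ∀ θ, F (circleMap 0 1 θ) = Hq (t + rot i θ) := fun θ => by
      simp only [hFdef, hHq, trig]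
      refine Finset.sum_congr rfl fun k _ => ?_
      rcases lt_or_ge (k i) 0 with h | h
      · simp [symH_of_neg h]
      · rw [mFourier_add_apply, mFourier_rot, ← zpow_natCast, Int.toNat_of_nonneg h]
        ring
    have hFd : Differentiable ℂ F := by
      rw [hFdef]; fun_prop
    have h0 : (F 0).im = 0 := by
      have e : F 0 = trig s (fun k => (if k i = 0 then 1 else 0 : ℝ) * c k) t := by
        simp only [hFdef, trig]
        refine Finset.sum_congr rfl fun k _ => ?_
        rcases lt_trichotomy (k i) 0 with h | h | h
        · simp [symH_of_neg h, h.ne]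
        · simp [symH_of_zero h, h]
        · simp [h.ne', h]
      rw [e, ← Complex.conj_eq_iff_im, conj_trig hs hc]
      simp
    have h1 := hF F hFd (fun z hz => ?_) h0
    · simp only [Real.circleAverage, hval, smul_eq_mul] at h1
      exact h1
    · obtain ⟨θ, rfl⟩ : z ∈ range (circleMap 0 1) := by
        rw [range_circleMap, abs_one]; exact hz
      rw [hval, hre]
      exact hpos _
  have hc1 : Continuous fun t => ‖Hq t‖ ^ r := hHc.norm.rpow_const fun _ => Or.inr (by linarith)
  have hc2 : Continuous fun t => (Hq t).re ^ r :=
    (Complex.continuous_re.comp hHc).rpow_const fun _ => Or.inr (by linarith)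
  have hle : ∫ t, ‖Hq t‖ ^ r ∂haarT ≤ A * ∫ t, (Hq t).re ^ r ∂haarT := by
    have hcc : ∀ {G : T2 → ℝ}, Continuous G →
        Integrable (fun t => (2 * π)⁻¹ * ∫ θ in 0..2 * π, G (t + rot i θ)) haarT := by
      intro G hG
      have : Continuous fun t => (2 * π)⁻¹ * ∫ θ in 0..2 * π, G (t + rot i θ) := by
        refine continuous_const.mul ?_
        refine intervalIntegral.continuous_parametric_intervalIntegral_of_continuous' ?_ _ _
        exact hG.comp (continuous_fst.add ((continuous_rot i).comp continuous_snd))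
      obtain ⟨C, hC⟩ := (isCompact_range this).isBounded.exists_norm_le
      exact Integrable.of_bound this.aestronglyMeasurable C
        (Filter.Eventually.of_forall fun t => hC _ (mem_range_self t))
    rw [integral_eq_integral_circle hc1 i, integral_eq_integral_circle hc2 i, ← integral_const_mul]
    exact integral_mono (hcc hc1) ((hcc hc2).const_mul A) key
  rw [(memLp_of_continuous hHc p).eLpNorm_eq_integral_rpow_norm hp0 hpt,
    (memLp_of_continuous (continuous_trig s c) p).eLpNorm_eq_integral_rpow_norm hp0 hpt]
  simp only [hnorm, ← hr]
  change _ ≤ ENNReal.ofReal _ * _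
  rw [← ENNReal.ofReal_mul (by positivity)]
  refine ENNReal.ofReal_le_ofReal ?_
  have hnn : 0 ≤ ∫ t, (Hq t).re ^ r ∂haarT :=
    integral_nonneg fun t => Real.rpow_nonneg (by rw [hre]; exact (hpos t).le) _
  rw [← one_div, ← Real.mul_rpow hA hnn]
  exact Real.rpow_le_rpow (integral_nonneg fun t => by positivity) hle (by positivity)

/-! ### Fourier multipliers on `L^p` -/

/-- Being a trigonometric polynomial. -/
def IsTrig (f : T2 → ℂ) : Prop := ∃ s c, f = trig s c

/-- The Fourier multiplier with the symbol `m`, for use on trigonometric polynomials, where the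
sum has finitely many nonzero terms. -/
def mul (m : (Fin 2 → ℤ) → ℝ) (f : T2 → ℂ) (t : T2) : ℂ := ∑' k, m k * coef f k * mFourier k t

lemma isTrig_trig (s : Finset (Fin 2 → ℤ)) (c : (Fin 2 → ℤ) → ℂ) : IsTrig (trig s c) := ⟨s, c, rfl⟩

lemma IsTrig.continuous {f : T2 → ℂ} (hf : IsTrig f) : Continuous f := by
  obtain ⟨s, c, rfl⟩ := hf
  exact continuous_trig s c

lemma trig_eq_of_subset {s S : Finset (Fin 2 → ℤ)} (h : s ⊆ S) (c : (Fin 2 → ℤ) → ℂ) :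
    trig s c = trig S fun k => if k ∈ s then c k else 0 := by
  funext t
  simp only [trig, ite_mul, zero_mul]
  rw [← Finset.sum_filter, Finset.filter_mem_eq_inter, Finset.inter_eq_right.2 h]

lemma IsTrig.exists_pair {f g : T2 → ℂ} (hf : IsTrig f) (hg : IsTrig g) :
    ∃ S c d, f = trig S c ∧ g = trig S d := by
  obtain ⟨s, c, rfl⟩ := hf
  obtain ⟨s', d, rfl⟩ := hg
  exact ⟨s ∪ s', _, _, trig_eq_of_subset Finset.subset_union_left c,
    trig_eq_of_subset Finset.subset_union_right d⟩

lemma trig_add (s : Finset (Fin 2 → ℤ)) (c d : (Fin 2 → ℤ) → ℂ) :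
    (fun t => trig s c t + trig s d t) = trig s (c + d) := by
  funext t
  simp only [trig, ← Finset.sum_add_distrib, Pi.add_apply, add_mul]

lemma trig_smul (s : Finset (Fin 2 → ℤ)) (a : ℂ) (c : (Fin 2 → ℤ) → ℂ) :
    (fun t => a * trig s c t) = trig s (fun k => a * c k) := by
  funext t
  simp only [trig, Finset.mul_sum, mul_assoc]

lemma mul_trig (m : (Fin 2 → ℤ) → ℝ) (s : Finset (Fin 2 → ℤ)) (c : (Fin 2 → ℤ) → ℂ) :
    mul m (trig s c) = trig s fun k => m k * c k := by
  funext t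
  rw [mul, tsum_eq_sum (s := s)]
  · refine Finset.sum_congr rfl fun k hk => ?_
    rw [coef_trig, if_pos hk]
  · intro k hk
    rw [coef_trig, if_neg hk]; simp

lemma IsTrig.mul {f : T2 → ℂ} (hf : IsTrig f) (m : (Fin 2 → ℤ) → ℝ) : IsTrig (mul m f) := by
  obtain ⟨s, c, rfl⟩ := hf
  rw [mul_trig]
  exact ⟨_, _, rfl⟩

lemma IsTrig.add {f g : T2 → ℂ} (hf : IsTrig f) (hg : IsTrig g) : IsTrig fun t => f t + g t := by
  obtain ⟨S, c, d, rfl, rfl⟩ := hf.exists_pair hg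
  exact ⟨S, _, trig_add S c d⟩

lemma IsTrig.smul {f : T2 → ℂ} (hf : IsTrig f) (a : ℂ) : IsTrig fun t => a * f t := by
  obtain ⟨s, c, rfl⟩ := hf
  exact ⟨s, _, trig_smul s a c⟩

lemma mul_add_fun (m : (Fin 2 → ℤ) → ℝ) {f g : T2 → ℂ} (hf : IsTrig f) (hg : IsTrig g) :
    mul m (fun t => f t + g t) = fun t => mul m f t + mul m g t := by
  obtain ⟨S, c, d, rfl, rfl⟩ := hf.exists_pair hg
  rw [trig_add, mul_trig, mul_trig, mul_trig, trig_add]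
  congr 1; funext k
  simp [mul_add]

lemma mul_smul_fun (m : (Fin 2 → ℤ) → ℝ) {f : T2 → ℂ} (hf : IsTrig f) (a : ℂ) :
    mul m (fun t => a * f t) = fun t => a * mul m f t := by
  obtain ⟨s, c, rfl⟩ := hf
  rw [trig_smul, mul_trig, mul_trig, trig_smul]
  congr 1; funext k; ring

lemma mul_mul_fun (m m' : (Fin 2 → ℤ) → ℝ) {f : T2 → ℂ} (hf : IsTrig f) :
    mul m (mul m' f) = mul (fun k => m k * m' k) f := by
  obtain ⟨s, c, rfl⟩ := hf
  rw [mul_trig, mul_trig, mul_trig]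
  congr 1; funext k; push_cast; ring

lemma trig_mul_mFourier (s : Finset (Fin 2 → ℤ)) (c : (Fin 2 → ℤ) → ℂ) (a : Fin 2 → ℤ) :
    (fun t => mFourier a t * trig s c t) =
      trig (s.map (addRightEmbedding a)) (fun k => c (k - a)) := by
  funext t
  simp only [trig, Finset.sum_map, addRightEmbedding_apply, add_sub_cancel_right,
    UnitAddTorus.mFourier_add, Finset.mul_sum]
  exact Finset.sum_congr rfl fun k _ => by ring

/-- The multiplier with the symbol `m` is bounded by `C` in the `L^p` norm, on trigonometric
polynomials. -/
def IsMultiplier (p : ℝ≥0∞) (m : (Fin 2 → ℤ) → ℝ) (C : ℝ≥0) : Prop :=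
  ∀ f, IsTrig f → eLpNorm (mul m f) p haarT ≤ C * eLpNorm f p haarT

namespace IsMultiplier

variable {p : ℝ≥0∞} {m m' : (Fin 2 → ℤ) → ℝ} {C C' : ℝ≥0}

lemma comp (h : IsMultiplier p m C) (h' : IsMultiplier p m' C') :
    IsMultiplier p (fun k => m k * m' k) (C * C') := by
  intro f hf
  rw [← mul_mul_fun m m' hf, ENNReal.coe_mul, mul_assoc]
  refine (h _ (hf.mul m')).trans ?_
  gcongr
  exact h' f hf

lemma add (hp : 1 ≤ p) (h : IsMultiplier p m C) (h' : IsMultiplier p m' C') :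
    IsMultiplier p (fun k => m k + m' k) (C + C') := by
  intro f hf
  have e : TorusInterp.mul (fun k => m k + m' k) f =
      TorusInterp.mul m f + TorusInterp.mul m' f := by
    obtain ⟨s, c, rfl⟩ := hf
    rw [mul_trig, mul_trig, mul_trig]
    refine Eq.trans ?_ (trig_add s _ _).symm
    congr 1; funext k; push_cast; simp [add_mul]
  rw [e, ENNReal.coe_add, add_mul]
  exact (eLpNorm_add_le (hf.mul m).continuous.aestronglyMeasurable
    (hf.mul m').continuous.aestronglyMeasurable hp).trans (add_le_add (h f hf) (h' f hf))

lemma const_mul (h : IsMultiplier p m C) (a : ℝ) :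
    IsMultiplier p (fun k => a * m k) (‖a‖₊ * C) := by
  intro f hf
  have e : TorusInterp.mul (fun k => a * m k) f = (a : ℂ) • TorusInterp.mul m f := by
    obtain ⟨s, c, rfl⟩ := hf
    rw [mul_trig, mul_trig]
    refine Eq.trans ?_ (trig_smul s a _).symm
    congr 1; funext k; push_cast; ring
  rw [e, eLpNorm_const_smul, ENNReal.coe_mul, mul_assoc]
  have : ‖(a : ℂ)‖ₑ = ‖a‖₊ := by
    rw [← ofReal_norm, Complex.norm_real]
    exact ofReal_norm a
  rw [this]
  gcongr
  exact h f hf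

/-- A translation of the symbol is a conjugation with a character, which has modulus one. -/
lemma translate (h : IsMultiplier p m C) (a : Fin 2 → ℤ) :
    IsMultiplier p (fun k => m (k + a)) C := by
  intro f hf
  obtain ⟨s, c, rfl⟩ := hf
  have hn : ∀ g : T2 → ℂ, eLpNorm (fun t => mFourier a t * g t) p haarT = eLpNorm g p haarT :=
    fun g => eLpNorm_congr_norm_ae (Filter.Eventually.of_forall fun t => by
      rw [norm_mul, norm_mFourier_apply, one_mul])
  have h1 := h _ (isTrig_trig (s.map (addRightEmbedding a)) (fun k => c (k - a)))
  rw [← trig_mul_mFourier, hn] at h1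
  rw [trig_mul_mFourier, mul_trig] at h1
  have e : trig (s.map (addRightEmbedding a)) (fun k => m k * c (k - a)) =
      fun t => mFourier a t * TorusInterp.mul (fun k => m (k + a)) (trig s c) t := by
    rw [mul_trig, trig_mul_mFourier]
    simp
  rwa [e, hn] at h1

end IsMultiplier

lemma isMultiplier_two_of_bounded {m : (Fin 2 → ℤ) → ℝ} {B : ℝ≥0} (hm : ∀ k, |m k| ≤ B) :
    IsMultiplier 2 m B := by
  intro f hf
  obtain ⟨s, c, rfl⟩ := hf
  rw [mul_trig, ← ENNReal.pow_le_pow_left_iff two_ne_zero, mul_pow,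
    ← tsum_coef_sq (memLp_of_continuous (continuous_trig _ _) 2),
    ← tsum_coef_sq (memLp_of_continuous (continuous_trig _ _) 2), ← ENNReal.tsum_mul_left]
  refine ENNReal.tsum_le_tsum fun k => ?_
  rw [← mul_pow]
  refine pow_le_pow_left₀ zero_le ?_ 2
  rw [coef_trig, coef_trig]
  split_ifs with hk
  · rw [enorm_mul]
    gcongr
    rw [← ofReal_norm, Complex.norm_real, Real.norm_eq_abs]
    exact ENNReal.ofReal_le_of_le_toReal (hm k)
  · simp

/-- A nonnegative continuous function is uniformly close to trigonometric polynomials that are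
real and strictly positive. -/
lemma exists_pos_trig_near {f : T2 → ℝ} (hf : Continuous f) (h0 : ∀ t, 0 ≤ f t) {ε : ℝ}
    (hε : 0 < ε) : ∃ s c, (∀ k ∈ s, -k ∈ s) ∧ (∀ k, c (-k) = starRingEnd ℂ (c k)) ∧
      (∀ t, 0 < (trig s c t).re) ∧ ∀ t, ‖(f t : ℂ) - trig s c t‖ ≤ ε := by
  obtain ⟨s, c, h⟩ := exists_trig_near (f := fun t => ((f t + ε / 2 : ℝ) : ℂ)) (by fun_prop)
    (ε := ε / 4) (by positivity)
  set d : (Fin 2 → ℤ) → ℂ := fun k => if k ∈ s then c k else 0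
  set S := s ∪ s.map (Equiv.neg (Fin 2 → ℤ)).toEmbedding with hS
  have hSsub : s ⊆ S := Finset.subset_union_left
  have hSneg : ∀ k ∈ S, -k ∈ S := by
    intro k hk
    simp only [hS, Finset.mem_union, Finset.mem_map, Equiv.coe_toEmbedding, Equiv.neg_apply] at hk ⊢
    rcases hk with hk | ⟨j, hj, rfl⟩
    · exact Or.inr ⟨k, hk, rfl⟩
    · exact Or.inl (by simpa using hj)
  have hq : ∀ t, trig S (fun k => (d k + starRingEnd ℂ (d (-k))) / 2) t = ((trig s c t).re : ℂ) := by
    intro t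
    have h1 : starRingEnd ℂ (trig S d t) = trig S (fun k => starRingEnd ℂ (d (-k))) t := by
      unfold trig
      rw [map_sum]
      refine Finset.sum_nbij' (fun k => -k) (fun k => -k) hSneg hSneg (by simp) (by simp)
        fun k _ => ?_
      simp only [map_mul, neg_neg, UnitAddTorus.mFourier_neg]
    rw [trig_eq_of_subset hSsub c, Complex.re_eq_add_conj, h1]
    simp only [trig, ← Finset.sum_add_distrib, Finset.sum_div]
    refine Finset.sum_congr rfl fun k _ => ?_
    ring
  have hre : ∀ t, |f t + ε / 2 - (trig s c t).re| ≤ ε / 4 := fun t => by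
    have := (Complex.abs_re_le_norm _).trans (h t)
    simpa using this
  refine ⟨S, fun k => (d k + starRingEnd ℂ (d (-k))) / 2, hSneg, fun k => ?_, fun t => ?_, fun t => ?_⟩
  · rw [map_div₀, Complex.conj_ofNat]
    simp [add_comm]
  · rw [hq, Complex.ofReal_re]
    linarith [abs_le.1 (hre t), h0 t, (abs_le.1 (hre t)).2]
  · rw [hq, ← Complex.ofReal_sub, Complex.norm_real, Real.norm_eq_abs, abs_le]
    constructor <;> linarith [(abs_le.1 (hre t)).1, (abs_le.1 (hre t)).2]

/-! ### Square partial sums of Fourier series -/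

/-- M. Riesz's theorem for exponents at most `2`: the passage from positive to general
trigonometric polynomials. -/
lemma exists_isMultiplier_symH {p : ℝ≥0∞} (hp : 1 < p) (hp2 : p ≤ 2) (i : Fin 2) :
    ∃ C, IsMultiplier p (symH i) C := by
  obtain ⟨C, hC⟩ := exists_riesz_pos hp hp2 i
  refine ⟨4 * C, fun f hf => ENNReal.le_of_forall_pos_le_add fun δ hδ _ => ?_⟩
  -- the total error of the approximation below is at most `(4 C + 8) ε`
  obtain ⟨ε, hε, hεδ⟩ : ∃ ε : ℝ≥0, 0 < ε ∧ (4 * C + 8) * ε ≤ δ :=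
    ⟨δ / (4 * C + 8), by positivity, by rw [mul_div_cancel₀ _ (by positivity)]⟩
  have hfc := hf.continuous
  have part : ∀ g : T2 → ℝ, Continuous g → (∀ t, |g t| ≤ ‖f t‖) → ∃ q : T2 → ℂ, IsTrig q ∧
      (∀ t, ‖((max (g t) 0 : ℝ) : ℂ) - q t‖ ≤ ε) ∧
      eLpNorm (mul (symH i) q) p haarT ≤ C * (eLpNorm f p haarT + ε) := by
    intro g hg hgf
    obtain ⟨s, c, hs, hc, hpos, hnear⟩ := exists_pos_trig_near (f := fun t => max (g t) 0)
      (by fun_prop) (fun t => le_max_right _ _) (ε := ε) (by exact_mod_cast hε)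
    refine ⟨trig s c, isTrig_trig s c, hnear, ?_⟩
    rw [mul_trig]
    refine (hC s c hs hc hpos).trans ?_
    gcongr
    have e : trig s c = (fun t => ((max (g t) 0 : ℝ) : ℂ)) -
        fun t => ((max (g t) 0 : ℝ) : ℂ) - trig s c t := by
      funext t; simp
    have hcc : Continuous fun t => ((max (g t) 0 : ℝ) : ℂ) := by fun_prop
    rw [e]
    refine (eLpNorm_sub_le hcc.aestronglyMeasurable
      (hcc.sub (continuous_trig s c)).aestronglyMeasurable hp.le).trans (add_le_add ?_ ?_)
    · refine eLpNorm_mono fun t => ?_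
      rw [Complex.norm_real, Real.norm_of_nonneg (le_max_right _ _)]
      exact (max_le (le_abs_self _) (abs_nonneg _)).trans (hgf t)
    · refine (eLpNorm_le_of_ae_bound (C := ε) (Filter.Eventually.of_forall hnear)).trans ?_
      simp
  obtain ⟨q₁, h₁, n₁, b₁⟩ := part (fun t => (f t).re) (Complex.continuous_re.comp hfc)
    fun t => Complex.abs_re_le_norm _
  obtain ⟨q₂, h₂, n₂, b₂⟩ := part (fun t => -(f t).re) (Complex.continuous_re.comp hfc).neg
    fun t => by rw [abs_neg]; exact Complex.abs_re_le_norm _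
  obtain ⟨q₃, h₃, n₃, b₃⟩ := part (fun t => (f t).im) (Complex.continuous_im.comp hfc)
    fun t => Complex.abs_im_le_norm _
  obtain ⟨q₄, h₄, n₄, b₄⟩ := part (fun t => -(f t).im) (Complex.continuous_im.comp hfc).neg
    fun t => by rw [abs_neg]; exact Complex.abs_im_le_norm _
  -- the part of `f` that is not captured is uniformly small, and is treated in `L²`
  have hg : IsTrig fun t => (q₁ t + (-1) * q₂ t) + (Complex.I * q₃ t + (-Complex.I) * q₄ t) :=
    (h₁.add (h₂.smul _)).add ((h₃.smul _).add (h₄.smul _))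
  set g := fun t => (q₁ t + (-1) * q₂ t) + (Complex.I * q₃ t + (-Complex.I) * q₄ t) with hgdef
  have he : IsTrig fun t => f t + (-1) * g t := hf.add (hg.smul _)
  set e := fun t => f t + (-1) * g t with hedef
  have hen : ∀ t, ‖e t‖ ≤ 4 * ε := by
    intro t
    have hpm : ∀ x : ℝ, x = max x 0 - max (-x) 0 := fun x => by
      rcases le_total x 0 with h | h
      · rw [max_eq_right h, max_eq_left (by linarith)]; ring
      · rw [max_eq_left h, max_eq_right (by linarith)]; ring
    have hft : f t = ((max (f t).re 0 : ℝ) - (max (-(f t).re) 0 : ℝ) : ℂ) +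
        Complex.I * ((max (f t).im 0 : ℝ) - (max (-(f t).im) 0 : ℝ) : ℂ) := by
      rw [← Complex.ofReal_sub, ← Complex.ofReal_sub, ← hpm, ← hpm, mul_comm, Complex.re_add_im]
    have e1 : e t = (((max (f t).re 0 : ℝ) : ℂ) - q₁ t) - (((max (-(f t).re) 0 : ℝ) : ℂ) - q₂ t) +
        (Complex.I * (((max (f t).im 0 : ℝ) : ℂ) - q₃ t) -
          Complex.I * (((max (-(f t).im) 0 : ℝ) : ℂ) - q₄ t)) := by
      rw [hedef, hgdef]
      dsimp only
      conv_lhs => rw [hft]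
      ring
    rw [e1]
    refine (norm_add_le _ _).trans ?_
    have a1 := norm_sub_le (((max (f t).re 0 : ℝ) : ℂ) - q₁ t)
      (((max (-(f t).re) 0 : ℝ) : ℂ) - q₂ t)
    have a2 := norm_sub_le (Complex.I * (((max (f t).im 0 : ℝ) : ℂ) - q₃ t))
      (Complex.I * (((max (-(f t).im) 0 : ℝ) : ℂ) - q₄ t))
    rw [norm_mul, norm_mul, Complex.norm_I, one_mul, one_mul] at a2
    linarith [n₁ t, n₂ t, n₃ t, n₄ t]
  have heb : eLpNorm (mul (symH i) e) p haarT ≤ 8 * ε := by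
    have hsym : ∀ k, |symH i k| ≤ (2 : ℝ≥0) := fun k => by
      rcases lt_trichotomy (k i) 0 with h | h | h
      · simp [symH_of_neg h]
      · simp [symH_of_zero h]
      · simp [symH_of_pos h]
    calc eLpNorm (mul (symH i) e) p haarT ≤ eLpNorm (mul (symH i) e) 2 haarT :=
          eLpNorm_le_eLpNorm_of_exponent_le hp2 (he.mul _).continuous.aestronglyMeasurable
      _ ≤ (2 : ℝ≥0) * eLpNorm e 2 haarT := isMultiplier_two_of_bounded hsym e he
      _ ≤ (2 : ℝ≥0) * (4 * ε) := by
          gcongr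
          refine (eLpNorm_le_of_ae_bound (C := 4 * ε) (Filter.Eventually.of_forall hen)).trans ?_
          simp [ENNReal.ofReal_mul]
      _ = 8 * ε := by rw [← mul_assoc]; norm_num
  have hsum : mul (symH i) f = ((mul (symH i) q₁ - mul (symH i) q₂) +
      (Complex.I • mul (symH i) q₃ - Complex.I • mul (symH i) q₄)) + mul (symH i) e := by
    have hfe : f = fun t => g t + e t := by funext t; rw [hedef]; ring
    conv_lhs => rw [hfe, mul_add_fun _ hg he, hgdef,
      mul_add_fun _ (h₁.add (h₂.smul _)) ((h₃.smul _).add (h₄.smul _)),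
      mul_add_fun _ h₁ (h₂.smul _), mul_add_fun _ (h₃.smul _) (h₄.smul _),
      mul_smul_fun _ h₂, mul_smul_fun _ h₃, mul_smul_fun _ h₄]
    funext t
    simp only [Pi.add_apply, Pi.sub_apply, Pi.smul_apply, smul_eq_mul]
    ring
  have mm : ∀ {q : T2 → ℂ}, IsTrig q → AEStronglyMeasurable (mul (symH i) q) haarT := fun hq =>
    (hq.mul _).continuous.aestronglyMeasurable
  have hI : ∀ q : T2 → ℂ, eLpNorm (Complex.I • q) p haarT = eLpNorm q p haarT := fun q => by
    rw [eLpNorm_const_smul]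
    simp [← ofReal_norm]
  rw [hsum]
  calc _ ≤ (C * (eLpNorm f p haarT + ε) + C * (eLpNorm f p haarT + ε)) +
        (C * (eLpNorm f p haarT + ε) + C * (eLpNorm f p haarT + ε)) + 8 * ε := by
        refine (eLpNorm_add_le ((((mm h₁).sub (mm h₂))).add (((mm h₃).const_smul _).sub
          ((mm h₄).const_smul _))) (mm he) hp.le).trans (add_le_add ?_ heb)
        refine (eLpNorm_add_le ((mm h₁).sub (mm h₂)) (((mm h₃).const_smul _).sub
          ((mm h₄).const_smul _)) hp.le).trans (add_le_add ?_ ?_)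
        · exact (eLpNorm_sub_le (mm h₁) (mm h₂) hp.le).trans (add_le_add b₁ b₂)
        · refine (eLpNorm_sub_le ((mm h₃).const_smul _) ((mm h₄).const_smul _) hp.le).trans ?_
          rw [hI, hI]
          exact add_le_add b₃ b₄
    _ = ((4 * C : ℝ≥0) : ℝ≥0∞) * eLpNorm f p haarT + (((4 * C + 8) * ε : ℝ≥0) : ℝ≥0∞) := by
        push_cast; ring
    _ ≤ _ := by gcongr

/-- The frequencies of the square Dirichlet kernel. -/
def box (N : ℕ) : Finset (Fin 2 → ℤ) := Fintype.piFinset fun _ : Fin 2 => Finset.Icc (-(N : ℤ)) N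

lemma mem_box {N : ℕ} {k : Fin 2 → ℤ} : k ∈ box N ↔ ∀ i, -(N : ℤ) ≤ k i ∧ k i ≤ N := by
  simp [box, Fintype.mem_piFinset]

lemma neg_mem_box {N : ℕ} {k : Fin 2 → ℤ} (h : k ∈ box N) : -k ∈ box N := by
  rw [mem_box] at h ⊢
  intro i
  have := h i
  simp only [Pi.neg_apply]
  omega

/-- The square partial sums are bounded in `L^p`, uniformly in `N`, as their symbol is a
combination of products of translates of `symH`. -/
lemma exists_isMultiplier_box {p : ℝ≥0∞} (hp : 1 < p) (hp2 : p ≤ 2) :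
    ∃ C, ∀ N : ℕ, IsMultiplier p (fun k => if k ∈ box N then 1 else 0) C := by
  have hstep : ∀ i : Fin 2, ∃ C, ∀ N : ℕ,
      IsMultiplier p (fun k => if -(N : ℤ) ≤ k i ∧ k i ≤ N then 1 else 0) C := by
    intro i
    obtain ⟨C, hC⟩ := exists_isMultiplier_symH hp hp2 i
    -- the indicator of the half-plane `kᵢ ≥ 0` is `(3 m - m²) / 2` for `m = 1 + sgn kᵢ`
    have h1 := (hC.const_mul (3 / 2)).add hp.le ((hC.comp hC).const_mul (-1 / 2))
    have e : (fun k => 3 / 2 * symH i k + -1 / 2 * (symH i k * symH i k)) =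
        fun k : Fin 2 → ℤ => if 0 ≤ k i then (1 : ℝ) else 0 := by
      funext k
      rcases lt_trichotomy (k i) 0 with h | h | h
      · simp [symH_of_neg h, not_le.2 h]
      · simp [symH_of_zero h, h]; norm_num
      · simp [symH_of_pos h, h.le]; norm_num
    rw [e] at h1
    obtain ⟨D, h1⟩ : ∃ D, IsMultiplier p (fun k => if 0 ≤ k i then 1 else 0) D := ⟨_, h1⟩
    refine ⟨D + ‖(-1 : ℝ)‖₊ * D, fun N => ?_⟩
    -- the strip `-N ≤ kᵢ ≤ N` is a difference of two half-planes
    have h2 := (h1.translate (Pi.single i (N : ℤ))).add hp.le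
      ((h1.translate (Pi.single i (-(N : ℤ) - 1))).const_mul (-1))
    convert h2 using 2 with k
    simp only [Pi.add_apply, Pi.single_eq_same]
    split_ifs <;> first | (exfalso; omega) | norm_num
  obtain ⟨C₀, h₀⟩ := hstep 0
  obtain ⟨C₁, h₁⟩ := hstep 1
  refine ⟨C₀ * C₁, fun N => ?_⟩
  convert (h₀ N).comp (h₁ N) using 2 with k
  simp only [mem_box, Fin.forall_fin_two]
  split_ifs <;> first | (exfalso; omega) | norm_num

/-- The square partial sum of the Fourier series. -/
def partialSum (N : ℕ) (f : T2 → ℂ) : T2 → ℂ := trig (box N) (coef f)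

lemma continuous_partialSum (N : ℕ) (f : T2 → ℂ) : Continuous (partialSum N f) :=
  continuous_trig _ _

lemma partialSum_eq_mul (N : ℕ) {f : T2 → ℂ} (hf : IsTrig f) :
    partialSum N f = mul (fun k => if k ∈ box N then 1 else 0) f := by
  obtain ⟨s, c, rfl⟩ := hf
  funext t
  rw [mul_trig]
  simp only [partialSum, trig, coef_trig, ite_mul, zero_mul]
  rw [← Finset.sum_filter, Finset.filter_mem_eq_inter]
  have : ∀ k, ((if k ∈ box N then (1 : ℝ) else 0 : ℝ) : ℂ) * c k * mFourier k t =
      if k ∈ box N then c k * mFourier k t else 0 := fun k => by split_ifs <;> simp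
  simp only [this]
  rw [← Finset.sum_filter, Finset.filter_mem_eq_inter, Finset.inter_comm]

lemma enorm_partialSum_le (N : ℕ) (f : T2 → ℂ) (t : T2) :
    ‖partialSum N f t‖ₑ ≤ (box N).card * eLpNorm f 1 haarT := by
  refine (enorm_sum_le _ _).trans ?_
  rw [← nsmul_eq_mul, ← Finset.sum_const]
  refine Finset.sum_le_sum fun k _ => ?_
  rw [enorm_mul, ← ofReal_norm (mFourier k t), norm_mFourier_apply, ENNReal.ofReal_one, mul_one]
  exact enorm_coef_le k

lemma partialSum_sub (N : ℕ) {f g : T2 → ℂ} (hf : Integrable f haarT) (hg : Integrable g haarT) :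
    partialSum N (fun t => f t - g t) = partialSum N f - partialSum N g := by
  funext t
  simp only [partialSum, trig, coef_sub hf hg, Pi.sub_apply, sub_mul, Finset.sum_sub_distrib]

/-- The passage from trigonometric polynomials to `L^p`, by density; for a fixed `N` the partial
sum is continuous from `L^p` to `L^∞`, which controls the remainder. -/
lemma exists_partialSum_bound_le_two {p : ℝ≥0∞} (hp : 1 < p) (hp2 : p ≤ 2) :
    ∃ C : ℝ≥0, ∀ (N : ℕ) (f : T2 → ℂ), MemLp f p haarT →
      eLpNorm (partialSum N f) p haarT ≤ C * eLpNorm f p haarT := by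
  obtain ⟨C, hC⟩ := exists_isMultiplier_box hp hp2
  have hpt : p ≠ ⊤ := (hp2.trans_lt (by norm_num)).ne
  refine ⟨C, fun N f hf => ENNReal.le_of_forall_pos_le_add fun δ hδ _ => ?_⟩
  obtain ⟨ε, hε, hεδ⟩ : ∃ ε : ℝ≥0, 0 < ε ∧ (C + (box N).card) * ε ≤ δ := by
    refine ⟨δ / (C + (box N).card + 1), by positivity, ?_⟩
    calc (C + (box N).card) * (δ / (C + (box N).card + 1))
        ≤ (C + (box N).card + 1) * (δ / (C + (box N).card + 1)) :=
          mul_le_mul_of_nonneg_right le_self_add zero_le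
      _ = δ := mul_div_cancel₀ _ (by positivity)
  obtain ⟨s, c, hsc⟩ := exists_trig_near_Lp hp.le hpt hf (ε := ε) (by exact_mod_cast hε.ne')
  set q := trig s c
  have hqc : Continuous q := continuous_trig s c
  have hq := memLp_of_continuous hqc p
  have e1 : partialSum N f = partialSum N q + partialSum N (fun t => f t - q t) := by
    rw [partialSum_sub N (hf.integrable hp.le) (hq.integrable hp.le)]; abel
  have e2 : q = f - fun t => f t - q t := by funext t; simp
  have h1 : eLpNorm q p haarT ≤ eLpNorm f p haarT + ε := by
    conv_lhs => rw [e2]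
    exact (eLpNorm_sub_le hf.1 (hf.sub hq).1 hp.le).trans (add_le_add le_rfl hsc)
  have h2 : eLpNorm (partialSum N fun t => f t - q t) p haarT ≤ (box N).card * ε := by
    calc _ ≤ eLpNorm (partialSum N fun t => f t - q t) ⊤ haarT :=
          eLpNorm_le_eLpNorm_of_exponent_le le_top (continuous_partialSum _ _).aestronglyMeasurable
      _ ≤ (box N).card * eLpNorm (fun t => f t - q t) 1 haarT := by
          rw [eLpNorm_exponent_top]
          exact essSup_le_of_ae_le _ (Filter.Eventually.of_forall (enorm_partialSum_le N _))
      _ ≤ (box N).card * ε := by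
          gcongr
          exact (eLpNorm_le_eLpNorm_of_exponent_le hp.le (hf.sub hq).1).trans hsc
  rw [e1]
  calc _ ≤ eLpNorm (partialSum N q) p haarT + eLpNorm (partialSum N fun t => f t - q t) p haarT :=
        eLpNorm_add_le (continuous_partialSum _ _).aestronglyMeasurable
          (continuous_partialSum _ _).aestronglyMeasurable hp.le
    _ ≤ C * (eLpNorm f p haarT + ε) + (box N).card * ε := by
        gcongr
        rw [partialSum_eq_mul N (isTrig_trig s c)]
        exact (hC N q (isTrig_trig s c)).trans (by gcongr)
    _ = C * eLpNorm f p haarT + (((C + (box N).card) * ε : ℝ≥0) : ℝ≥0∞) := by push_cast; ring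
    _ ≤ _ := by gcongr

/-- The square partial sums are symmetric for the bilinear pairing. -/
lemma integral_partialSum_mul (N : ℕ) {f u : T2 → ℂ} (hf : Integrable f haarT)
    (hu : Integrable u haarT) :
    ∫ t, partialSum N f t * u t ∂haarT = ∫ t, f t * partialSum N u t ∂haarT := by
  have h : ∀ {a b : T2 → ℂ}, Integrable b haarT →
      ∫ t, partialSum N a t * b t ∂haarT = ∑ k ∈ box N, coef a k * coef b (-k) := by
    intro a b hb
    simp only [partialSum, trig, Finset.sum_mul]
    rw [integral_finsetSum]
    · refine Finset.sum_congr rfl fun k _ => ?_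
      rw [coef, coef, neg_neg, ← integral_const_mul]
      congr 1; funext t; ring
    · intro k _
      have := (integrable_mul_mFourier hb k).const_mul (coef a k)
      refine this.congr (Filter.Eventually.of_forall fun t => ?_)
      ring
  have h2 := h (a := u) hf
  simp only [mul_comm (partialSum N u _)] at h2
  rw [h hu, h2]
  refine Finset.sum_nbij' (fun k => -k) (fun k => -k) (fun k => neg_mem_box) (fun k => neg_mem_box)
    (by simp) (by simp) fun k _ => ?_
  rw [neg_neg, mul_comm]

/-- The exponents above `2` are obtained by duality. -/
lemma exists_partialSum_bound {p : ℝ≥0∞} (hp : 1 < p) (hpt : p < ⊤) :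
    ∃ C : ℝ≥0, ∀ (N : ℕ) (f : T2 → ℂ), MemLp f p haarT →
      eLpNorm (partialSum N f) p haarT ≤ C * eLpNorm f p haarT := by
  rcases le_total p 2 with hp2 | hp2
  · exact exists_partialSum_bound_le_two hp hp2
  have hp0 : p ≠ 0 := (one_pos.trans hp).ne'
  set r := p.toReal with hr
  have hr2 : 2 ≤ r := by
    rw [hr, ← ENNReal.toReal_ofNat]; exact ENNReal.toReal_mono hpt.ne hp2
  have hrr := Real.HolderConjugate.conjExponent (p := r) (by linarith)
  set r' := Real.conjExponent r with hr'
  have hr'1 : 1 < r' := hrr.symm.lt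
  have hr'2 : r' ≤ 2 := by
    rw [hr', Real.conjExponent, div_le_iff₀ (by linarith)]; linarith
  have hp'1 : 1 < ENNReal.ofReal r' := ENNReal.one_lt_ofReal.2 hr'1
  obtain ⟨C, hC⟩ := exists_partialSum_bound_le_two hp'1
    (ENNReal.ofReal_le_of_le_toReal (by simpa using hr'2))
  refine ⟨C, fun N f hf => ?_⟩
  set g := partialSum N f with hg
  have hgc : Continuous g := continuous_partialSum N f
  -- the extremal test function for the norm of `g`
  set u : T2 → ℂ := fun t => starRingEnd ℂ (g t) * ((‖g t‖ ^ (r - 2) : ℝ) : ℂ) with hu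
  have huc : Continuous u := by
    refine (Complex.continuous_conj.comp hgc).mul (Complex.continuous_ofReal.comp ?_)
    exact hgc.norm.rpow_const fun _ => Or.inr (by linarith)
  have hgu : ∀ t, g t * u t = ((‖g t‖ ^ r : ℝ) : ℂ) := fun t => by
    have e : ‖g t‖ ^ r = ‖g t‖ ^ 2 * ‖g t‖ ^ (r - 2) := by
      rw [← Real.rpow_natCast, ← Real.rpow_add_of_nonneg (norm_nonneg _) (by norm_num)
        (by linarith)]
      congr 1; push_cast; ring
    rw [hu, e, ← mul_assoc, Complex.mul_conj']
    push_cast; rfl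
  have hun : ∀ t, ‖u t‖ₑ ^ r' = ‖g t‖ₑ ^ r := fun t => by
    have e : ‖u t‖ = ‖g t‖ ^ (r - 1) := by
      rw [hu, norm_mul, RCLike.norm_conj, Complex.norm_real, Real.norm_of_nonneg (by positivity)]
      conv_lhs => enter [1]; rw [← Real.rpow_one ‖g t‖]
      rw [← Real.rpow_add_of_nonneg (norm_nonneg _) zero_le_one (by linarith)]
      congr 1; ring
    rw [← ofReal_norm, ← ofReal_norm, e, ENNReal.ofReal_rpow_of_nonneg (by positivity)
      (by linarith), ENNReal.ofReal_rpow_of_nonneg (by positivity) (by linarith),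
      ← Real.rpow_mul (norm_nonneg _)]
    congr 2
    rw [hr', Real.conjExponent]
    field_simp [show r - 1 ≠ 0 by linarith]
  set I := ∫⁻ t, ‖g t‖ₑ ^ r ∂haarT with hI
  have hIg : eLpNorm g p haarT = I ^ (1 / r) :=
    eLpNorm_eq_lintegral_rpow_enorm_toReal hp0 hpt.ne
  have hItop : I ≠ ⊤ := by
    have := (memLp_of_continuous hgc p).2
    rw [hIg] at this
    exact ((ENNReal.rpow_lt_top_iff_of_pos (by positivity)).1 this).ne
  have hIle : I ≤ eLpNorm f p haarT * (C * I ^ (1 / r')) := by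
    have h1 : I = ‖∫ t, g t * u t ∂haarT‖ₑ := by
      simp only [hgu]
      have e : ∫ t, ((‖g t‖ ^ r : ℝ) : ℂ) ∂haarT = ((∫ t, ‖g t‖ ^ r ∂haarT : ℝ) : ℂ) :=
        integral_ofReal
      rw [e, ← ofReal_norm, Complex.norm_real,
        Real.norm_of_nonneg (integral_nonneg fun t => by positivity),
        ofReal_integral_eq_lintegral_ofReal]
      · rw [hI]
        congr 1; funext t
        rw [← ofReal_norm, ENNReal.ofReal_rpow_of_nonneg (by positivity) (by linarith)]
      · exact memLp_one_iff_integrable.1 ((memLp_of_continuous (f := fun t => ((‖g t‖ ^ r : ℝ) : ℂ))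
          (Complex.continuous_ofReal.comp (hgc.norm.rpow_const fun _ => Or.inr (by linarith))) 1).re)
      · exact Filter.Eventually.of_forall fun t => by positivity
    have hm := (continuous_partialSum N u).aestronglyMeasurable (μ := haarT)
    calc I = ‖∫ t, f t * partialSum N u t ∂haarT‖ₑ := by
          rw [← integral_partialSum_mul N (hf.integrable hp.le) (integrable_of_continuous huc), ← h1]
      _ ≤ ∫⁻ t, ‖f t‖ₑ * ‖partialSum N u t‖ₑ ∂haarT := by
          refine (enorm_integral_le_lintegral_enorm _).trans_eq ?_
          simp only [enorm_mul]
      _ ≤ (∫⁻ t, ‖f t‖ₑ ^ r ∂haarT) ^ (1 / r) *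
            (∫⁻ t, ‖partialSum N u t‖ₑ ^ r' ∂haarT) ^ (1 / r') :=
          ENNReal.lintegral_mul_le_Lp_mul_Lq _ hrr hf.1.enorm hm.enorm
      _ = eLpNorm f p haarT * eLpNorm (partialSum N u) (ENNReal.ofReal r') haarT := by
          rw [eLpNorm_eq_lintegral_rpow_enorm_toReal hp0 hpt.ne, eLpNorm_eq_lintegral_rpow_enorm_toReal
            (one_pos.trans hp'1).ne' ENNReal.ofReal_ne_top, ENNReal.toReal_ofReal (by linarith)]
      _ ≤ eLpNorm f p haarT * (C * eLpNorm u (ENNReal.ofReal r') haarT) := by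
          gcongr
          exact hC N u (memLp_of_continuous huc _)
      _ = _ := by
          rw [eLpNorm_eq_lintegral_rpow_enorm_toReal
            (one_pos.trans hp'1).ne' ENNReal.ofReal_ne_top, ENNReal.toReal_ofReal (by linarith)]
          simp only [hun, hI]
  rw [hIg]
  rcases eq_or_ne I 0 with h0 | h0
  · rw [h0, ENNReal.zero_rpow_of_pos (by positivity)]; exact zero_le
  have hsplit : I = I ^ (1 / r) * I ^ (1 / r') := by
    rw [← ENNReal.rpow_add _ _ h0 hItop]
    have : 1 / r + 1 / r' = 1 := by simpa using hrr.inv_add_inv_eq_one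
    rw [this, ENNReal.rpow_one]
  have h3 : I ^ (1 / r) * I ^ (1 / r') ≤ (C * eLpNorm f p haarT) * I ^ (1 / r') := by
    rw [← hsplit]
    refine hIle.trans_eq ?_
    ring
  have h4 : I ^ (1 / r') ≠ 0 := by
    simp [ENNReal.rpow_eq_zero_iff, h0, hItop]
  have h5 : I ^ (1 / r') ≠ ⊤ := ENNReal.rpow_ne_top_of_nonneg (by positivity) hItop
  exact (ENNReal.mul_le_mul_iff_left h4 h5).1 h3

/-! ### The rough modal projection -/

lemma norm_freq_le_of_mem_box {N : ℕ} {k : Fin 2 → ℤ} (hk : k ∈ box N) : ‖freq k‖ ≤ 2 * N := by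
  rw [mem_box] at hk
  have h : ∀ i, |(k i : ℝ)| ≤ N := fun i => by
    rw [abs_le]
    exact_mod_cast hk i
  rw [EuclideanSpace.norm_eq, Real.sqrt_le_left (by positivity), Fin.sum_univ_two]
  have h0 := sq_le_sq' (abs_le.1 (h 0)).1 (abs_le.1 (h 0)).2
  have h1 := sq_le_sq' (abs_le.1 (h 1)).1 (abs_le.1 (h 1)).2
  simp only [freq, Real.norm_eq_abs, sq_abs]
  nlinarith

lemma lt_norm_freq_of_notMem_box {N : ℕ} {k : Fin 2 → ℤ} (hk : k ∉ box N) : N < ‖freq k‖ := by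
  contrapose! hk
  rw [mem_box]
  intro i
  have := abs_le.1 ((abs_le_norm_freq k i).trans hk)
  exact_mod_cast this

lemma roughProj_eq (N : ℕ) {φ : Plane → ℂ} (hφ : MemLpPer 1 φ) :
    roughProj N φ = fun x => partialSum N (fun t => φ (sec t)) (toT x) := by
  funext x
  have hpi : (π : ℂ) ≠ 0 := by exact_mod_cast Real.pi_ne_zero
  have h1 : ∀ t, dirichlet N (x - sec t) * φ (sec t) =
      ∑ k ∈ box N, mFourier k (toT x) * (φ (sec t) * mFourier (-k) t) := fun t => by
    rw [dirichlet, Finset.sum_mul]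
    refine Finset.sum_congr rfl fun k _ => ?_
    rw [char_eq, toT_sub, toT_sec, mFourier_sub_apply]
    ring
  rw [roughProj, integral_cell]
  simp only [h1]
  rw [integral_finsetSum _ fun k _ =>
    (integrable_mul_mFourier (hφ.sec.integrable le_rfl) _).const_mul _]
  simp only [integral_const_mul, partialSum, trig]
  rw [Complex.real_smul, ← mul_assoc]
  have : 1 / (4 * (π : ℂ) ^ 2) * ((4 * π ^ 2 : ℝ) : ℂ) = 1 := by push_cast; field_simp
  rw [this, one_mul]
  refine Finset.sum_congr rfl fun k _ => ?_
  rw [coef, mul_comm]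

lemma isModal_roughProj : IsModal {N | 16 ≤ N} (fun N => 2 * π / (N : ℝ)) roughProj box
    (fun N k => if k ∈ box N then 1 else 0) (4 * π) (2 * π) where
  pos n hn := by
    have : (0 : ℝ) < n := by exact_mod_cast (show 0 < n from lt_of_lt_of_le (by norm_num) hn)
    positivity
  le_one n hn := by
    have : (16 : ℝ) ≤ n := by exact_mod_cast hn
    rw [div_le_one (by linarith)]
    linarith [Real.pi_lt_four]
  c₁_pos := by positivity
  c₂_pos := by positivity
  nonneg n _ k := by split_ifs <;> norm_num
  m_le_one n _ k := by split_ifs <;> norm_num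
  eq_zero n _ k hk := if_neg hk
  norm_le n hn k hk := by
    have hpi := Real.pi_pos
    have : (16 : ℝ) ≤ n := by exact_mod_cast hn
    refine (norm_freq_le_of_mem_box hk).trans_eq ?_
    field_simp
    norm_num
  eq_one n hn k hk := by
    have hpi := Real.pi_pos
    have : (16 : ℝ) ≤ n := by exact_mod_cast hn
    rw [div_div_cancel₀ (by positivity)] at hk
    by_contra h
    have h2 : k ∉ box n := fun h' => h (if_pos h')
    exact lt_asymm hk (lt_norm_freq_of_notMem_box h2)
  apply_eq n hn φ hφ := by
    rw [roughProj_eq n hφ]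
    funext x
    simp only [partialSum, trig]
    refine Finset.sum_congr rfl fun k hk => ?_
    rw [if_pos hk]; simp

theorem isTypeII_roughProj : IsTypeII {N | 16 ≤ N} (fun N => 2 * π / (N : ℝ)) roughProj := by
  refine isModal_roughProj.isTypeII fun p hp hpt => ?_
  obtain ⟨C, hC⟩ := exists_partialSum_bound hp hpt
  exact ⟨C, lp_bound_of_torus (Op := partialSum) (fun n _ φ hφ => roughProj_eq n hφ)
    (fun n _ f _ => (continuous_partialSum n f).aestronglyMeasurable) hp.le
    fun n _ f hf => hC n f hf⟩

/-! ### The smooth modal projection -/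

/-- A smooth compactly supported symbol, scaled by any factor, is a multiplier for the uniform
norm: it is the Fourier transform of an integrable function, so that it acts by averaging
translates. -/
lemma exists_sup_bound {ψ : Plane → ℝ} (hψ : ContDiff ℝ ∞ ψ) (hc : HasCompactSupport ψ) :
    ∃ B : ℝ, 0 ≤ B ∧ ∀ (R : ℝ) (s : Finset (Fin 2 → ℤ)) (c : (Fin 2 → ℤ) → ℂ) (M : ℝ),
      (∀ t, ‖trig s c t‖ ≤ M) → ∀ t, ‖trig s (fun k => ψ (R • freq k) * c k) t‖ ≤ B * M := by
  have hc' : HasCompactSupport fun x => (ψ x : ℂ) := hc.comp_left (g := fun y : ℝ => (y : ℂ)) rfl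
  have hψ' : ContDiff ℝ ∞ fun x => (ψ x : ℂ) := Complex.ofRealCLM.contDiff.comp hψ
  let Ψ : SchwartzMap Plane ℂ := hc'.toSchwartzMap hψ'
  set κ : SchwartzMap Plane ℂ := 𝓕⁻ Ψ with hκ
  have hF : ∀ ξ, (ψ ξ : ℂ) = ∫ v, Complex.exp (((-2 * π * inner ℝ v ξ : ℝ) : ℂ) * Complex.I) * κ v := by
    intro ξ
    have h1 : 𝓕 κ = Ψ := FourierTransform.fourier_fourierInv_eq Ψ
    have h2 : (𝓕 κ) ξ = (ψ ξ : ℂ) := by rw [h1]; rfl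
    rw [← h2, SchwartzMap.fourier_coe, Real.fourier_eq']
    rfl
  refine ⟨∫ v, ‖κ v‖, integral_nonneg fun v => norm_nonneg _, fun R s c M hM t => ?_⟩
  have hint : Integrable κ := κ.integrable
  have key : trig s (fun k => ψ (R • freq k) * c k) t =
      ∫ v, κ v * trig s c (t - toT ((2 * π * R) • v)) := by
    have h1 : ∀ v, κ v * trig s c (t - toT ((2 * π * R) • v)) =
        ∑ k ∈ s, (c k * mFourier k t) *
          (Complex.exp (((-2 * π * inner ℝ v (R • freq k) : ℝ) : ℂ) * Complex.I) * κ v) := by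
      intro v
      rw [trig, Finset.mul_sum]
      refine Finset.sum_congr rfl fun k _ => ?_
      rw [mFourier_sub_apply, ← char_eq, char]
      have : (inner ℝ (freq (-k)) ((2 * π * R) • v) : ℝ) = -2 * π * inner ℝ v (R • freq k) := by
        rw [freq_neg, inner_neg_left, inner_smul_right, inner_smul_right, real_inner_comm]
        ring
      rw [this]
      ring
    simp only [h1]
    rw [integral_finsetSum]
    · simp only [integral_const_mul, ← hF, trig]
      exact Finset.sum_congr rfl fun k _ => by ring
    · intro k _
      refine Integrable.const_mul ?_ _
      refine hint.bdd_mul (c := 1) (by fun_prop) (Filter.Eventually.of_forall fun v => ?_)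
      rw [Complex.norm_exp_ofReal_mul_I]
  rw [key, ← integral_mul_const]
  refine norm_integral_le_of_norm_le (hint.norm.mul_const M) (Filter.Eventually.of_forall fun v => ?_)
  rw [norm_mul]
  gcongr
  exact hM _

instance : haarT.IsNegInvariant := Measure.IsAddHaarMeasure.isNegInvariant_of_regular haarT

/-- If the multiplier with a finitely supported symbol is bounded for the uniform norm, then its
kernel is integrable with the same bound. -/
lemma lintegral_trig_le {s : Finset (Fin 2 → ℤ)} {m : (Fin 2 → ℤ) → ℝ} {B : ℝ} (hB : 0 ≤ B)
    (hs : ∀ k ∉ s, m k = 0)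
    (h : ∀ (s : Finset (Fin 2 → ℤ)) (c : (Fin 2 → ℤ) → ℂ) (M : ℝ), (∀ t, ‖trig s c t‖ ≤ M) →
      ∀ t, ‖trig s (fun k => m k * c k) t‖ ≤ B * M) :
    ∫⁻ t, ‖trig s (fun k => m k) t‖ₑ ∂haarT ≤ ENNReal.ofReal B := by
  set K : T2 → ℂ := fun t => trig s (fun k => m k) (-t) with hK
  have hKc : Continuous K := (continuous_trig _ _).comp continuous_neg
  -- pairing with the kernel, first for trigonometric polynomials and then for continuous functions
  have hpair : ∀ s' c, ∫ t, trig s' c t * K t ∂haarT = trig s' (fun k => m k * c k) 0 := by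
    intro s' c
    have h1 : ∀ t, trig s' c t * K t = ∑ k ∈ s, m k * (trig s' c t * mFourier (-k) t) := fun t => by
      simp only [hK]
      rw [trig, trig, Finset.mul_sum]
      exact Finset.sum_congr rfl fun k _ => by rw [mFourier_neg_apply]; ring
    simp only [h1]
    rw [integral_finsetSum _ fun k _ =>
      (integrable_mul_mFourier (integrable_of_continuous (continuous_trig _ _)) _).const_mul _]
    simp only [integral_const_mul]
    have h2 : ∀ k, ∫ t, trig s' c t * mFourier (-k) t ∂haarT = if k ∈ s' then c k else 0 :=
      fun k => coef_trig s' c k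
    have h3 : ∀ k, mFourier k (0 : T2) = 1 := fun k => by simp [UnitAddTorus.mFourier]
    simp only [h2]
    simp only [trig, h3, mul_one, mul_ite, mul_zero]
    rw [← Finset.sum_filter, Finset.filter_mem_eq_inter, Finset.inter_comm,
      ← Finset.filter_mem_eq_inter, Finset.sum_filter]
    refine Finset.sum_congr rfl fun k _ => ?_
    split_ifs with hk
    · rfl
    · rw [hs k hk]; simp
  have hcont : ∀ u : T2 → ℂ, Continuous u → (∀ t, ‖u t‖ ≤ 1) → ‖∫ t, u t * K t ∂haarT‖ ≤ B := by
    intro u hu hu1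
    obtain ⟨D, hD⟩ := (isCompact_range hKc).isBounded.exists_norm_le
    have hD0 : 0 ≤ D := (norm_nonneg _).trans (hD _ (mem_range_self 0))
    refine le_of_forall_pos_le_add fun δ hδ => ?_
    obtain ⟨ε, hε, hεδ⟩ : ∃ ε : ℝ, 0 < ε ∧ (B + D) * ε ≤ δ :=
      ⟨δ / (B + D + 1), by positivity, by
        rw [mul_div_assoc', div_le_iff₀ (by positivity)]; nlinarith⟩
    obtain ⟨s', c, hsc⟩ := exists_trig_near hu hε
    have e : ∫ t, u t * K t ∂haarT =
        ∫ t, trig s' c t * K t ∂haarT + ∫ t, (u t - trig s' c t) * K t ∂haarT := by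
      refine Eq.trans ?_ (integral_add (f := fun t => trig s' c t * K t)
        (g := fun t => (u t - trig s' c t) * K t)
        (integrable_of_continuous ((continuous_trig _ _).mul hKc))
        (integrable_of_continuous ((hu.sub (continuous_trig _ _)).mul hKc)))
      congr 1; funext t; ring
    rw [e]
    have h1 : ‖∫ t, trig s' c t * K t ∂haarT‖ ≤ B * (1 + ε) := by
      rw [hpair]
      refine h s' c _ (fun t => ?_) 0
      have : trig s' c t = u t - (u t - trig s' c t) := by ring
      rw [this]
      exact (norm_sub_le _ _).trans (add_le_add (hu1 t) (hsc t))
    have h2 : ‖∫ t, (u t - trig s' c t) * K t ∂haarT‖ ≤ ε * D := by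
      have := norm_integral_le_of_norm_le_const (μ := haarT)
        (f := fun t => (u t - trig s' c t) * K t) (C := ε * D)
        (Filter.Eventually.of_forall fun t => by
          rw [norm_mul]
          exact mul_le_mul (hsc t) (hD _ (mem_range_self t)) (norm_nonneg _) hε.le)
      simpa using this
    calc _ ≤ B * (1 + ε) + ε * D := (norm_add_le _ _).trans (add_le_add h1 h2)
      _ = B + (B + D) * ε := by ring
      _ ≤ B + δ := by gcongr
  have hmain : ∫ t, ‖K t‖ ∂haarT ≤ B := by
    refine le_of_forall_pos_le_add fun δ hδ => ?_
    have hden : ∀ t, (0 : ℝ) < ‖K t‖ + δ := fun t => by positivity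
    -- a continuous substitute for the conjugate sign of the kernel
    set u : T2 → ℂ := fun t => starRingEnd ℂ (K t) * (((‖K t‖ + δ)⁻¹ : ℝ) : ℂ) with hu
    have huc : Continuous u := by
      refine (Complex.continuous_conj.comp hKc).mul (Complex.continuous_ofReal.comp ?_)
      exact (hKc.norm.add continuous_const).inv₀ fun t => (hden t).ne'
    have hu1 : ∀ t, ‖u t‖ ≤ 1 := fun t => by
      rw [hu, norm_mul, RCLike.norm_conj, Complex.norm_real, Real.norm_of_nonneg
        (inv_nonneg.2 (hden t).le), ← div_eq_mul_inv, div_le_one (hden t)]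
      linarith
    have h1 := hcont u huc hu1
    have h2 : ∀ t, u t * K t = ((‖K t‖ ^ 2 / (‖K t‖ + δ) : ℝ) : ℂ) := fun t => by
      rw [hu]
      push_cast
      rw [div_eq_mul_inv, ← Complex.conj_mul']
      ring
    have h3 : ∫ t, ((‖K t‖ ^ 2 / (‖K t‖ + δ) : ℝ) : ℂ) ∂haarT =
        ((∫ t, ‖K t‖ ^ 2 / (‖K t‖ + δ) ∂haarT : ℝ) : ℂ) := integral_ofReal
    simp only [h2] at h1
    rw [h3, Complex.norm_real] at h1
    have hic : Continuous fun t => ‖K t‖ ^ 2 / (‖K t‖ + δ) :=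
      (hKc.norm.pow 2).div (hKc.norm.add continuous_const) fun t => (hden t).ne'
    have hint : ∀ {g : T2 → ℝ}, Continuous g → Integrable g haarT := fun {g} hg => by
      obtain ⟨D, hD⟩ := (isCompact_range hg).isBounded.exists_norm_le
      exact Integrable.of_bound hg.aestronglyMeasurable D
        (Filter.Eventually.of_forall fun t => hD _ (mem_range_self t))
    calc ∫ t, ‖K t‖ ∂haarT ≤ ∫ t, (‖K t‖ ^ 2 / (‖K t‖ + δ) + δ) ∂haarT := by
          refine integral_mono (hint hKc.norm) ((hint hic).add (integrable_const δ)) fun t => ?_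
          have : ‖K t‖ - δ ≤ ‖K t‖ ^ 2 / (‖K t‖ + δ) := by
            rw [le_div_iff₀ (hden t)]; nlinarith
          dsimp only
          linarith
      _ = ∫ t, ‖K t‖ ^ 2 / (‖K t‖ + δ) ∂haarT + δ := by
          rw [integral_add (hint hic) (integrable_const δ)]; simp
      _ ≤ B + δ := by
          gcongr
          exact (le_abs_self _).trans h1
  have h4 : ∫⁻ t, ‖trig s (fun k => m k) t‖ₑ ∂haarT = ∫⁻ t, ‖K t‖ₑ ∂haarT := by
    rw [← lintegral_neg_eq_self (μ := haarT)]
  rw [h4]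
  calc ∫⁻ t, ‖K t‖ₑ ∂haarT = ENNReal.ofReal (∫ t, ‖K t‖ ∂haarT) := by
        rw [ofReal_integral_norm_eq_lintegral_enorm (integrable_of_continuous hKc)]
    _ ≤ _ := ENNReal.ofReal_le_ofReal hmain

/-- Young's inequality for a multiplier with an integrable kernel. -/
lemma eLpNorm_trig_coef_le {s : Finset (Fin 2 → ℤ)} {m : (Fin 2 → ℤ) → ℝ} {B : ℝ≥0}
    (hK : ∫⁻ t, ‖trig s (fun k => m k) t‖ₑ ∂haarT ≤ B) {p : ℝ≥0∞} (hp : 1 ≤ p) {f : T2 → ℂ}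
    (hf : MemLp f p haarT) :
    eLpNorm (trig s fun k => m k * coef f k) p haarT ≤ B * eLpNorm f p haarT := by
  have hKc : Continuous (trig s fun k => (m k : ℂ)) := continuous_trig _ _
  refine eLpNorm_le_of_schur (k := fun x y => ‖trig s (fun k => (m k : ℂ)) (x - y)‖ₑ) ?_ ?_ ?_ hf.1
    (fun x => ?_) hp
  · exact (hKc.comp (continuous_fst.sub continuous_snd)).enorm.measurable
  · intro x
    rwa [lintegral_sub_left_eq_self (μ := haarT) (fun t => ‖trig s (fun k => (m k : ℂ)) t‖ₑ)]
  · intro y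
    rwa [lintegral_sub_right_eq_self (μ := haarT) (fun t => ‖trig s (fun k => (m k : ℂ)) t‖ₑ)]
  · have h1 : trig s (fun k => m k * coef f k) x =
        ∫ y, trig s (fun k => (m k : ℂ)) (x - y) * f y ∂haarT := by
      have h2 : ∀ y, trig s (fun k => (m k : ℂ)) (x - y) * f y =
          ∑ k ∈ s, (m k * mFourier k x) * (f y * mFourier (-k) y) := fun y => by
        rw [trig, Finset.sum_mul]
        refine Finset.sum_congr rfl fun k _ => ?_
        rw [mFourier_sub_apply]; ring
      simp only [h2]
      rw [integral_finsetSum _ fun k _ =>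
        (integrable_mul_mFourier (hf.integrable hp) _).const_mul _]
      simp only [integral_const_mul, trig, coef]
      exact Finset.sum_congr rfl fun k _ => by ring
    rw [h1]
    refine (enorm_integral_le_lintegral_enorm _).trans_eq ?_
    simp only [enorm_mul]

section SmoothProj

variable {ψ₀ : Plane → ℝ}

lemma IsLPBump.hasCompactSupport (H : IsLPBump ψ₀) : HasCompactSupport ψ₀ := by
  rw [HasCompactSupport, H.support_eq]
  exact isCompact_closedBall _ _

lemma IsLPBump.eq_zero (H : IsLPBump ψ₀) {ξ : Plane} (hξ : 1 / 2 < ‖ξ‖) : ψ₀ ξ = 0 := by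
  refine image_eq_zero_of_notMem_tsupport ?_
  rw [H.support_eq]
  simpa using hξ

/-- The Littlewood–Paley sum telescopes. -/
lemma sum_lpSymbol (ψ₀ : Plane → ℝ) (N : ℕ) (ξ : Plane) :
    ∑ j ∈ Finset.Icc (-1 : ℤ) (N : ℤ), lpSymbol ψ₀ j ξ = ψ₀ (((2 : ℝ) ^ (N + 1))⁻¹ • ξ) := by
  induction N with
  | zero =>
    have : Finset.Icc (-1 : ℤ) ((0 : ℕ) : ℤ) = {-1, 0} := rfl
    rw [this, Finset.sum_pair (by norm_num)]
    simp [lpSymbol]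
  | succ N ih =>
    have : Finset.Icc (-1 : ℤ) ((N + 1 : ℕ) : ℤ) =
        insert ((N + 1 : ℕ) : ℤ) (Finset.Icc (-1 : ℤ) (N : ℤ)) := by
      ext j
      simp only [Finset.mem_Icc, Finset.mem_insert]
      omega
    rw [this, Finset.sum_insert (by simp), ih, lpSymbol, if_neg (by omega), if_neg (by omega)]
    rw [zpow_neg, zpow_natCast, smul_smul]
    have e : (1 / 2 : ℝ) * (2 ^ (N + 1))⁻¹ = (2 ^ (N + 1 + 1))⁻¹ := by
      rw [pow_succ _ (N + 1), mul_inv]; ring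
    rw [e]
    ring

lemma lpSymbol_eq_zero (H : IsLPBump ψ₀) {N : ℕ} {j : ℤ} (hj : j ≤ N) {ξ : Plane}
    (hξ : 2 ^ N < ‖ξ‖) : lpSymbol ψ₀ j ξ = 0 := by
  have h1 : (1 : ℝ) ≤ 2 ^ N := one_le_pow₀ (by norm_num)
  rw [lpSymbol]
  split_ifs with h2 h3
  · rfl
  · exact H.eq_zero (by linarith)
  · have h4 : 1 < (2 : ℝ) ^ (-j) * ‖ξ‖ := by
      have : (2 : ℝ) ^ j ≤ 2 ^ N := by
        rw [← zpow_natCast]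
        exact zpow_le_zpow_right₀ (by norm_num) hj
      rw [zpow_neg, inv_mul_eq_div, one_lt_div (by positivity)]
      linarith
    have h5 : ‖(2 : ℝ) ^ (-j) • ξ‖ = (2 : ℝ) ^ (-j) * ‖ξ‖ := by
      rw [norm_smul, Real.norm_of_nonneg (by positivity)]
    rw [H.eq_zero (ξ := (2 : ℝ) ^ (-j) • ξ) (by rw [h5]; linarith), H.eq_zero, sub_zero]
    rw [norm_smul, h5, Real.norm_of_nonneg (by norm_num)]
    linarith

lemma smoothProj_eq (H : IsLPBump ψ₀) (N : ℕ) (φ : Plane → ℂ) : smoothProj ψ₀ N φ =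
    fun x => trig (box (2 ^ N)) (fun k => (ψ₀ (((2 : ℝ) ^ (N + 1))⁻¹ • freq k) : ℂ) *
      coef (fun t => φ (sec t)) k) (toT x) := by
  funext x
  have h1 : ∀ j ∈ Finset.Icc (-1 : ℤ) (N : ℤ), lpBlock ψ₀ j φ x = ∑ k ∈ box (2 ^ N),
      (lpSymbol ψ₀ j (freq k) : ℂ) * (coef (fun t => φ (sec t)) k * mFourier k (toT x)) := by
    intro j hj
    rw [lpBlock, tsum_eq_sum (s := box (2 ^ N))]
    · refine Finset.sum_congr rfl fun k _ => ?_
      rw [fourierCoef_eq, char_eq, mul_assoc]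
    · intro k hk
      have := lt_norm_freq_of_notMem_box hk
      push_cast at this
      rw [lpSymbol_eq_zero H (Finset.mem_Icc.1 hj).2 this]
      simp
  rw [smoothProj, Finset.sum_congr rfl h1, Finset.sum_comm, trig]
  refine Finset.sum_congr rfl fun k _ => ?_
  rw [← Finset.sum_mul, ← sum_lpSymbol ψ₀ N]
  push_cast
  ring

lemma isModal_smoothProj (H : IsLPBump ψ₀) : IsModal {N | 0 < N} (fun N => (2 : ℝ) ^ (-(N : ℝ)))
    (smoothProj ψ₀) (fun N => box (2 ^ N)) (fun N k => ψ₀ (((2 : ℝ) ^ (N + 1))⁻¹ • freq k))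
    2 (1 / 2) where
  pos n _ := by positivity
  le_one n _ := Real.rpow_le_one_of_one_le_of_nonpos (by norm_num) (by simp)
  c₁_pos := by norm_num
  c₂_pos := by norm_num
  nonneg n _ k := H.nonneg _
  m_le_one n _ k := H.le_one _
  eq_zero n _ k hk := by
    have := lt_norm_freq_of_notMem_box hk
    push_cast at this
    refine H.eq_zero ?_
    rw [norm_smul, norm_inv, norm_pow, Real.norm_ofNat, inv_mul_eq_div, div_lt_div_iff₀ (by norm_num)
      (by positivity), pow_succ]
    linarith
  norm_le n _ k hk := by
    refine (norm_freq_le_of_mem_box hk).trans_eq ?_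
    rw [Real.rpow_neg (by norm_num), Real.rpow_natCast]
    push_cast
    rw [div_inv_eq_mul]
  eq_one n _ k hk := by
    rw [Real.rpow_neg (by norm_num), Real.rpow_natCast, div_inv_eq_mul] at hk
    refine H.eq_one _ ?_
    rw [norm_smul, norm_inv, norm_pow, Real.norm_ofNat, inv_mul_eq_div, div_le_div_iff₀
      (by positivity) (by norm_num), pow_succ]
    linarith
  apply_eq n _ φ _ := smoothProj_eq H n φ

theorem endpointBounds_smoothProj (H : IsLPBump ψ₀) :
    EndpointBounds {N | 0 < N} (fun N => (2 : ℝ) ^ (-(N : ℝ))) (smoothProj ψ₀) := by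
  refine ⟨?_, (isModal_smoothProj H).l2_lp_bound⟩
  obtain ⟨B, hB, h⟩ := exists_sup_bound H.smooth H.hasCompactSupport
  refine ⟨B.toNNReal, fun p hp => lp_bound_of_torus
    (Op := fun n f => trig (box (2 ^ n)) fun k => (ψ₀ (((2 : ℝ) ^ (n + 1))⁻¹ • freq k) : ℂ) * coef f k)
    (fun n _ φ _ => smoothProj_eq H n φ)
    (fun _ _ _ _ => (continuous_trig _ _).aestronglyMeasurable) hp fun n hn f hf => ?_⟩
  exact eLpNorm_trig_coef_le (m := fun k => ψ₀ (((2 : ℝ) ^ (n + 1))⁻¹ • freq k))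
    (lintegral_trig_le hB ((isModal_smoothProj H).eq_zero n hn) (h _)) hp hf

theorem isTypeII_smoothProj (H : IsLPBump ψ₀) :
    IsTypeII {N | 0 < N} (fun N => (2 : ℝ) ^ (-(N : ℝ))) (smoothProj ψ₀) := by
  refine (isModal_smoothProj H).isTypeII fun p hp _ => ?_
  obtain ⟨C, hC⟩ := (endpointBounds_smoothProj H).lp_bound
  exact ⟨C, hC p hp.le⟩

end SmoothProj

/-! ### The mollifier -/

lemma bumpProfile_eq (x : Plane) : bumpProfile x = expNegInvGlue (1 - ‖x‖ ^ 2) := by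
  have h : ‖x‖ < 1 ↔ ¬ 1 - ‖x‖ ^ 2 ≤ 0 := by
    rw [not_le, sub_pos, sq_lt_one_iff₀ (norm_nonneg x)]
  rw [bumpProfile, expNegInvGlue]
  simp only [h, ite_not, neg_div, one_div]

lemma contDiff_bumpProfile : ContDiff ℝ ∞ bumpProfile := by
  rw [funext bumpProfile_eq]
  exact expNegInvGlue.contDiff.comp (contDiff_const.sub (contDiff_norm_sq ℝ))

lemma bumpProfile_nonneg (x : Plane) : 0 ≤ bumpProfile x := by
  rw [bumpProfile_eq]; exact expNegInvGlue.nonneg _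

lemma hasCompactSupport_bumpProfile : HasCompactSupport bumpProfile :=
  HasCompactSupport.intro (isCompact_closedBall 0 1) fun x hx => by
    rw [Metric.mem_closedBall, dist_zero_right, not_le] at hx
    rw [bumpProfile, if_neg (by linarith)]

lemma integral_bumpProfile_pos : 0 < ∫ y, bumpProfile y := by
  refine contDiff_bumpProfile.continuous.integral_pos_of_hasCompactSupport_nonneg_nonzero
    hasCompactSupport_bumpProfile bumpProfile_nonneg (x := 0) ?_
  rw [bumpProfile, if_pos (by simp)]
  exact (Real.exp_pos _).ne'

lemma contDiff_rho : ContDiff ℝ ∞ rho := contDiff_const.mul contDiff_bumpProfile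

lemma hasCompactSupport_rho : HasCompactSupport rho :=
  hasCompactSupport_bumpProfile.mul_left

lemma rho_nonneg (x : Plane) : 0 ≤ rho x :=
  mul_nonneg (inv_nonneg.2 integral_bumpProfile_pos.le) (bumpProfile_nonneg x)

lemma rho_eq_zero {x : Plane} (hx : 1 ≤ ‖x‖) : rho x = 0 := by
  rw [rho, bumpProfile, if_neg hx.not_gt, mul_zero]

lemma integral_rho : ∫ x, rho x = 1 := by
  simp only [rho]
  rw [integral_const_mul, inv_mul_cancel₀ integral_bumpProfile_pos.ne']

lemma integrable_rho : Integrable rho :=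
  contDiff_rho.continuous.integrable_of_hasCompactSupport hasCompactSupport_rho

/-- The probability measure with the density `rho`. -/
def rhoMeas : Measure Plane := volume.withDensity fun x => ENNReal.ofReal (rho x)

instance : IsProbabilityMeasure rhoMeas := ⟨by
  rw [rhoMeas, withDensity_apply _ MeasurableSet.univ, Measure.restrict_univ,
    ← ofReal_integral_eq_lintegral_ofReal integrable_rho (Filter.Eventually.of_forall rho_nonneg),
    integral_rho, ENNReal.ofReal_one]⟩

lemma integral_rhoMeas {E : Type*} [NormedAddCommGroup E] [NormedSpace ℝ E] (g : Plane → E) :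
    ∫ z, g z ∂rhoMeas = ∫ z, rho z • g z := by
  rw [rhoMeas, integral_withDensity_eq_integral_toReal_smul]
  · simp only [ENNReal.toReal_ofReal (rho_nonneg _)]
  · exact (contDiff_rho.continuous.measurable).ennreal_ofReal
  · exact Filter.Eventually.of_forall fun _ => ENNReal.ofReal_lt_top

lemma ae_rhoMeas : ∀ᵐ z ∂rhoMeas, ‖z‖ < 1 := by
  rw [rhoMeas, ae_withDensity_iff (contDiff_rho.continuous.measurable).ennreal_ofReal]
  refine Filter.Eventually.of_forall fun z hz => ?_
  contrapose! hz
  rw [rho_eq_zero hz, ENNReal.ofReal_zero]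

/-- Convolution with the rescaled mollifier is an average over translates. -/
lemma integral_rhoEps_mul {ε : ℝ} (hε : 0 < ε) (g : Plane → ℝ) (x : Plane) :
    ∫ y, rhoEps ε (x - y) * g y = ∫ z, g (x - ε • z) ∂rhoMeas := by
  rw [integral_rhoMeas, ← integral_sub_left_eq_self _ volume x]
  have h := Measure.integral_comp_inv_smul_of_nonneg (μ := (volume : Measure Plane))
    (fun z => rho z • g (x - ε • z)) hε.le
  rw [finrank_euclideanSpace_fin, smul_eq_mul, ← inv_mul_eq_iff_eq_mul₀ (by positivity)] at h
  rw [← h, ← integral_const_mul]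
  congr 1; funext y
  rw [sub_sub_cancel, rhoEps, smul_smul, mul_inv_cancel₀ hε.ne', one_smul, smul_eq_mul, mul_assoc]

/-- The Fourier transform of `rho` decays faster than any power. -/
lemma exists_rho_decay {β : ℝ} (hβ : 0 ≤ β) : ∃ C : ℝ, 0 ≤ C ∧ ∀ ξ : Plane,
    ‖ξ‖ ^ β * ‖∫ z, Complex.exp ((inner ℝ ξ z : ℝ) * Complex.I) ∂rhoMeas‖ ≤ C := by
  have hc' : HasCompactSupport fun x => (rho x : ℂ) :=
    hasCompactSupport_rho.comp_left (g := fun y : ℝ => (y : ℂ)) rfl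
  have hψ' : ContDiff ℝ ∞ fun x => (rho x : ℂ) := Complex.ofRealCLM.contDiff.comp contDiff_rho
  let R : SchwartzMap Plane ℂ := hc'.toSchwartzMap hψ'
  have hF : ∀ ξ : Plane, ∫ z, Complex.exp ((inner ℝ ξ z : ℝ) * Complex.I) ∂rhoMeas =
      (𝓕 R) ((-(2 * π)⁻¹) • ξ) := fun ξ => by
    rw [SchwartzMap.fourier_coe, Real.fourier_eq', integral_rhoMeas]
    congr 1; funext z
    have e : -2 * π * inner ℝ z ((-(2 * π)⁻¹) • ξ) = inner ℝ ξ z := by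
      rw [inner_smul_right, real_inner_comm]
      field_simp
    rw [e, Complex.real_smul, smul_eq_mul, mul_comm]
    rfl
  obtain ⟨C, hC0, hC⟩ := (𝓕 R).decay ⌈β⌉₊ 0
  obtain ⟨D, hD0, hD⟩ := (𝓕 R).decay 0 0
  simp only [norm_iteratedFDeriv_zero, pow_zero, one_mul] at hC hD
  refine ⟨(2 * π) ^ β * (D + C), by positivity, fun ξ => ?_⟩
  rw [hF]
  set η := (-(2 * π)⁻¹) • ξ with hη
  have hn : ‖ξ‖ = 2 * π * ‖η‖ := by
    rw [hη, norm_smul, norm_neg, Real.norm_of_nonneg (by positivity), ← mul_assoc,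
      mul_inv_cancel₀ (by positivity), one_mul]
  rw [hn, Real.mul_rpow (by positivity) (norm_nonneg _), mul_assoc]
  gcongr
  have h1 : ‖η‖ ^ β ≤ 1 + ‖η‖ ^ ⌈β⌉₊ := by
    rcases le_total ‖η‖ 1 with h | h
    · have := Real.rpow_le_one (norm_nonneg η) h hβ
      have : 0 ≤ ‖η‖ ^ ⌈β⌉₊ := by positivity
      linarith
    · have := Real.rpow_le_rpow_of_exponent_le h (Nat.le_ceil β)
      rw [Real.rpow_natCast] at this
      linarith
  calc ‖η‖ ^ β * ‖(𝓕 R) η‖ ≤ (1 + ‖η‖ ^ ⌈β⌉₊) * ‖(𝓕 R) η‖ := by gcongr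
    _ = ‖(𝓕 R) η‖ + ‖η‖ ^ ⌈β⌉₊ * ‖(𝓕 R) η‖ := by ring
    _ ≤ D + C := add_le_add (hD η) (hC η)

/-! ### Partitions of unity and their mollification -/

section Partition

variable {ι : Type*} {s : Finset ι} {m : ℝ} {a b : ι → T2 → ℝ}

/-- A measurable partition of unity `a i`, `i ∈ s`, on the torus whose members all have the
integral `m`. -/
structure IsPartition (s : Finset ι) (m : ℝ) (a : ι → T2 → ℝ) : Prop where
  measurable : ∀ i, Measurable (a i)
  nonneg : ∀ i t, 0 ≤ a i t
  sum_eq : ∀ t, ∑ i ∈ s, a i t = 1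
  integral_eq : ∀ i ∈ s, ∫ t, a i t ∂haarT = m

namespace IsPartition

lemma le_one (H : IsPartition s m a) {i : ι} (hi : i ∈ s) (t : T2) : a i t ≤ 1 :=
  (Finset.single_le_sum (f := fun i => a i t) (fun j _ => H.nonneg j t) hi).trans_eq (H.sum_eq t)

lemma norm_le_one (H : IsPartition s m a) {i : ι} (hi : i ∈ s) (t : T2) : ‖a i t‖ ≤ 1 := by
  rw [Real.norm_of_nonneg (H.nonneg i t)]; exact H.le_one hi t

lemma integrable (H : IsPartition s m a) {i : ι} (hi : i ∈ s) : Integrable (a i) haarT :=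
  Integrable.of_bound (H.measurable i).aestronglyMeasurable 1
    (Filter.Eventually.of_forall (H.norm_le_one hi))

section Mollify

variable {X : Type*} [MeasurableSpace X] {μ : Measure X} [IsProbabilityMeasure μ] {g : X → T2}

lemma integrable_comp (H : IsPartition s m a) (hg : Measurable g) {i : ι} (hi : i ∈ s) (t : T2) :
    Integrable (fun z => a i (t - g z)) μ :=
  Integrable.of_bound ((H.measurable i).comp (measurable_const.sub hg)).aestronglyMeasurable 1
    (Filter.Eventually.of_forall fun _ => H.norm_le_one hi _)

lemma measurable_uncurry (H : IsPartition s m a) (hg : Measurable g) (i : ι) :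
    Measurable fun p : T2 × X => a i (p.1 - g p.2) :=
  (H.measurable i).comp (measurable_fst.sub (hg.comp measurable_snd))

/-- Averages over translates of a partition of unity. -/
lemma mollify (H : IsPartition s m a) (hg : Measurable g) :
    IsPartition s m fun i t => ∫ z, a i (t - g z) ∂μ where
  measurable i :=
    ((H.measurable_uncurry hg i).stronglyMeasurable.integral_prod_right (ν := μ)).measurable
  nonneg i t := integral_nonneg fun z => H.nonneg i _
  sum_eq t := by
    rw [← integral_finsetSum _ fun i hi => H.integrable_comp hg hi t]
    simp [H.sum_eq]
  integral_eq i hi := by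
    rw [integral_integral_swap]
    · simp [integral_sub_right_eq_self (μ := haarT) (a i), H.integral_eq i hi]
    · exact Integrable.of_bound (H.measurable_uncurry hg i).aestronglyMeasurable 1
        (Filter.Eventually.of_forall fun _ => H.norm_le_one hi _)

/-- Averaging over translates multiplies the Fourier coefficients by those of the average. -/
lemma coef_mollify (H : IsPartition s m a) (hg : Measurable g) {i : ι} (hi : i ∈ s)
    (k : Fin 2 → ℤ) : coef (fun t => ((∫ z, a i (t - g z) ∂μ : ℝ) : ℂ)) k =
      (∫ z, mFourier (-k) (g z) ∂μ) * coef (fun t => (a i t : ℂ)) k := by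
  have h1 : ∀ t, ((∫ z, a i (t - g z) ∂μ : ℝ) : ℂ) * mFourier (-k) t =
      ∫ z, (a i (t - g z) : ℂ) * mFourier (-k) t ∂μ := fun t => by
    rw [integral_mul_const]
    congr 1
    exact integral_ofReal.symm
  rw [coef]
  simp only [h1]
  rw [integral_integral_swap]
  · rw [← integral_mul_const]
    congr 1; funext z
    exact coef_translate (fun t => (a i t : ℂ)) (g z) k
  · have hmeas : Measurable fun p : T2 × X => (a i (p.1 - g p.2) : ℂ) * mFourier (-k) p.1 :=
      (Complex.measurable_ofReal.comp (H.measurable_uncurry hg i)).mul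
        ((mFourier (-k)).continuous.measurable.comp measurable_fst)
    refine Integrable.of_bound hmeas.aestronglyMeasurable 1 (Filter.Eventually.of_forall fun p => ?_)
    rw [Function.uncurry, norm_mul, norm_mFourier_apply, mul_one, Complex.norm_real]
    exact H.norm_le_one hi _

end Mollify

end IsPartition

end Partition

/-! ### The partition into squares -/

section Squares

variable {M : ℕ} {α : Fin 2 → ℤ}

lemma side_pos (hM : 0 < M) : 0 < side M := by
  have : (0 : ℝ) < M := by exact_mod_cast hM
  rw [side]; positivity

lemma mem_square_iff (hM : 0 < M) {x : Plane} :
    x ∈ square M α ↔ α = fun i => ⌊x i / side M⌋ := by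
  have h := side_pos hM
  rw [funext_iff]
  refine forall_congr' fun i => ?_
  rw [eq_comm, Int.floor_eq_iff, le_div_iff₀ h, div_lt_iff₀ h, mem_Ico]

lemma mem_Ico_of_mem_square (hM : 0 < M) (hα : α ∈ idx M) {x : Plane} (hx : x ∈ square M α)
    (i : Fin 2) : x i ∈ Ico (-π) π := by
  have hM' : (0 : ℝ) < M := by exact_mod_cast hM
  have h := side_pos hM
  have hs : (M : ℝ) * side M = π := by rw [side]; field_simp
  have hα' := Finset.mem_Ico.1 (Fintype.mem_piFinset.1 hα i)
  have h1 : -(M : ℝ) ≤ α i := by exact_mod_cast hα'.1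
  have h2 : (α i : ℝ) + 1 ≤ M := by exact_mod_cast hα'.2
  have := hx i
  exact ⟨by nlinarith [this.1], by nlinarith [this.2]⟩

/-- The indicator of a square, as a function on the torus. -/
def chi (M : ℕ) (α : Fin 2 → ℤ) (t : T2) : ℝ := (square M α).indicator (fun _ => 1) (sec t)

/-- The covering map separates points up to periods. -/
lemma exists_eq_add_period {x y : Plane} (h : toT x = toT y) :
    ∃ k, y = x + (2 * π) • freq k := by
  have hpi := Real.pi_pos
  have h1 : ∀ i, ∃ n : ℤ, (n : ℝ) = y i / (2 * π) - x i / (2 * π) := fun i => by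
    have h2 : (((y i / (2 * π) - x i / (2 * π) : ℝ)) : UnitAddCircle) = 0 := by
      rw [AddCircle.coe_sub, sub_eq_zero]
      exact (congrFun h i).symm
    obtain ⟨n, hn⟩ := AddCircle.coe_eq_zero_iff (1 : ℝ) |>.1 h2
    exact ⟨n, by simpa using hn⟩
  choose k hk using h1
  refine ⟨k, ?_⟩
  ext i
  have := hk i
  simp only [PiLp.add_apply, PiLp.smul_apply, freq, smul_eq_mul, this]
  field_simp
  ring

/-- Exactly one period translate of `x` lies in the cell `[-π, π)²`, which contains the square. -/
lemma psi_eq (hM : 0 < M) (hα : α ∈ idx M) (x : Plane) : psi M α x = chi M α (toT x) := by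
  obtain ⟨k₀, hk₀⟩ := exists_eq_add_period (toT_sec (toT x)).symm
  rw [psi, tsum_eq_single k₀, chi, ← hk₀]
  intro k hk
  refine indicator_of_notMem (fun hmem => hk ?_) _
  have h1 := sec_toT (mem_Ico_of_mem_square hM hα hmem)
  rw [toT_add_period, hk₀, add_right_inj] at h1
  have hpi : (2 * π) ≠ 0 := by positivity
  have h2 := smul_right_injective Plane hpi h1
  funext i
  have h3 := congrArg (fun x : Plane => x i) h2
  simp only [freq] at h3
  exact_mod_cast h3.symm

lemma measurableSet_square : MeasurableSet (square M α) := by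
  rw [square, ofPred_forall]
  exact MeasurableSet.iInter fun i => measurableSet_Ico.preimage (by fun_prop)

lemma volume_square (hM : 0 < M) : volume (square M α) = ENNReal.ofReal (side M ^ 2) := by
  have h := side_pos hM
  have e : square M α = (WithLp.ofLp : Plane → Fin 2 → ℝ) ⁻¹'
      (univ.pi fun i => Ico ((α i : ℝ) * side M) (((α i : ℝ) + 1) * side M)) := by
    ext x; simp [square]
  rw [e, (PiLp.volume_preserving_ofLp (Fin 2)).measure_preimage
    (MeasurableSet.univ_pi fun i => measurableSet_Ico).nullMeasurableSet, Real.volume_pi_Ico,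
    Fin.prod_univ_two, ← ENNReal.ofReal_mul (by nlinarith)]
  congr 1
  ring

lemma integral_chi (hM : 0 < M) (hα : α ∈ idx M) :
    ∫ t, chi M α t ∂haarT = 1 / (4 * (M : ℝ) ^ 2) := by
  have hM' : (0 : ℝ) < M := by exact_mod_cast hM
  have h1 := integral_cell ((square M α).indicator fun _ => (1 : ℝ))
  have h2 : square M α ⊆ cell := fun x hx i =>
    Ico_subset_Icc_self (mem_Ico_of_mem_square hM hα hx i)
  rw [integral_indicator measurableSet_square, cellMeasure,
    Measure.restrict_restrict measurableSet_square, inter_eq_self_of_subset_left h2,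
    setIntegral_const, Measure.real, volume_square hM, ENNReal.toReal_ofReal (by positivity)] at h1
  simp only [smul_eq_mul, mul_one] at h1
  have h3 : side M ^ 2 = 4 * π ^ 2 * ∫ t, chi M α t ∂haarT := h1
  have hpi := Real.pi_pos
  rw [side] at h3
  field_simp at h3 ⊢
  linarith

lemma isPartition_chi (hM : 0 < M) : IsPartition (idx M) (1 / (4 * (M : ℝ) ^ 2)) (chi M) where
  measurable α := (measurable_const.indicator measurableSet_square).comp measurable_sec
  nonneg α t := indicator_nonneg (fun _ _ => zero_le_one) _
  sum_eq t := by
    have hM' : (0 : ℝ) < M := by exact_mod_cast hM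
    have h := side_pos hM
    have hs : (M : ℝ) * side M = π := by rw [side]; field_simp
    classical
    simp only [chi, indicator_apply, mem_square_iff hM]
    rw [Finset.sum_ite_eq' , if_pos]
    refine Fintype.mem_piFinset.2 fun i => Finset.mem_Ico.2 ⟨?_, ?_⟩
    · rw [Int.le_floor, le_div_iff₀ h]
      push_cast
      linarith [(sec_mem t i).1]
    · rw [Int.floor_lt, div_lt_iff₀ h]
      push_cast
      linarith [(sec_mem t i).2]
  integral_eq α hα := integral_chi hM hα

/-- The point of the torus below `ε z`, where `ε = h / 10`. -/
def shift (M : ℕ) (z : Plane) : T2 := toT ((side M / 10) • z)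

lemma measurable_shift : Measurable (shift M) :=
  measurable_toT.comp (by fun_prop)

/-- The mollified indicator of a square, as a function on the torus. -/
def Psi (M : ℕ) (α : Fin 2 → ℤ) (t : T2) : ℝ := ∫ z, chi M α (t - shift M z) ∂rhoMeas

lemma psiT_eq (hM : 0 < M) (hα : α ∈ idx M) (x : Plane) : psiT M α x = Psi M α (toT x) := by
  have := side_pos hM
  rw [psiT, integral_rhoEps_mul (by positivity), Psi]
  simp only [psi_eq hM hα, toT_sub, shift]

lemma isPartition_Psi (hM : 0 < M) : IsPartition (idx M) (1 / (4 * (M : ℝ) ^ 2)) (Psi M) :=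
  (isPartition_chi hM).mollify measurable_shift

lemma norm_circle_le {p x y : ℝ} (h : |x - y| ≤ p) : ‖(x : UnitAddCircle) - (y : UnitAddCircle)‖ ≤ p := by
  rw [← AddCircle.coe_sub]
  exact (QuotientAddGroup.norm_mk_le_norm).trans h

/-- A mollified indicator is supported in a square of side `1.2 h`. -/
lemma norm_sub_le_of_Psi_ne_zero (hM : 0 < M) {t t' : T2} (h : Psi M α t ≠ 0)
    (h' : Psi M α t' ≠ 0) (i : Fin 2) : ‖(t - t') i‖ ≤ 3 / (5 * M) := by
  have hM' : (0 : ℝ) < M := by exact_mod_cast hM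
  have hpos := side_pos hM
  have key : ∀ {t}, Psi M α t ≠ 0 → ∃ z, ‖z‖ < 1 ∧ sec (t - shift M z) ∈ square M α := by
    intro t ht
    by_contra! hcon
    refine ht (integral_eq_zero_of_ae ?_)
    filter_upwards [ae_rhoMeas] with z hz
    exact indicator_of_notMem (hcon z hz) _
  have hshift : ∀ {z : Plane}, ‖z‖ < 1 → ‖shift M z i‖ ≤ 1 / (20 * M) := by
    intro z hz
    have h1 : |(side M / 10 * z i) / (2 * π) - 0| ≤ 1 / (20 * M) := by
      have h2 : |z i| ≤ 1 := (PiLp.norm_apply_le z i).trans hz.le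
      have e : (side M / 10 * z i) / (2 * π) - 0 = 1 / (20 * M) * z i := by
        have := Real.pi_pos
        rw [side]; field_simp; ring
      rw [e, abs_mul, abs_of_nonneg (by positivity)]
      exact mul_le_of_le_one_right (by positivity) h2
    simpa [shift, toT] using norm_circle_le h1
  obtain ⟨z, hz, hzs⟩ := key h
  obtain ⟨z', hz', hzs'⟩ := key h'
  set u := t - shift M z
  set u' := t' - shift M z'
  have hu : ‖(u - u') i‖ ≤ 1 / (2 * M) := by
    have h1 : |sec u i / (2 * π) - sec u' i / (2 * π)| ≤ 1 / (2 * M) := by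
      rw [← sub_div, abs_div, abs_of_pos (show 0 < 2 * π by positivity), div_le_iff₀ (by positivity)]
      have e : 1 / (2 * M) * (2 * π) = side M := by rw [side]; field_simp
      rw [e, abs_le]
      have a1 := hzs i
      have a2 := hzs' i
      constructor <;> nlinarith [a1.1, a1.2, a2.1, a2.2]
    have h2 := norm_circle_le h1
    have e1 : ∀ v : T2, ((sec v i / (2 * π) : ℝ) : UnitAddCircle) = v i := fun v =>
      congrFun (toT_sec v) i
    rwa [e1, e1] at h2
  have e : (t - t') i = (u - u') i + shift M z i - shift M z' i := by
    simp only [u, u', Pi.sub_apply]; abel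
  rw [e]
  calc _ ≤ ‖(u - u') i‖ + ‖shift M z i‖ + ‖shift M z' i‖ :=
        (norm_sub_le _ _).trans (by gcongr; exact norm_add_le _ _)
    _ ≤ 1 / (2 * M) + 1 / (20 * M) + 1 / (20 * M) := by
        gcongr
        · exact hshift hz
        · exact hshift hz'
    _ = 3 / (5 * M) := by field_simp; norm_num

/-- The Fourier multiplier of the mollification at the scale `h / 10` decays faster than any power
of `h |k|`. -/
lemma exists_mollifier_decay {β : ℝ} (hβ : 0 ≤ β) : ∃ C : ℝ, 0 ≤ C ∧ ∀ M : ℕ, 0 < M →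
    ∀ k : Fin 2 → ℤ, ‖freq k‖ ^ β * ‖∫ z, mFourier (-k) (shift M z) ∂rhoMeas‖ ≤
      C * side M ^ (-β) := by
  obtain ⟨C, hC0, hC⟩ := exists_rho_decay hβ
  refine ⟨10 ^ β * C, by positivity, fun M hM k => ?_⟩
  have hpos := side_pos hM
  have h := hC ((-(side M / 10)) • freq k)
  have e : ∀ z : Plane, Complex.exp ((inner ℝ ((-(side M / 10)) • freq k) z : ℝ) * Complex.I) =
      mFourier (-k) (shift M z) := fun z => by
    rw [shift, ← char_eq, char, freq_neg, inner_smul_left, inner_neg_left, inner_smul_right]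
    congr 3
    simp
  simp only [e] at h
  rw [norm_smul, norm_neg, Real.norm_of_nonneg (by positivity),
    Real.mul_rpow (by positivity) (norm_nonneg _), mul_assoc] at h
  set X := ‖freq k‖ ^ β * ‖∫ z, mFourier (-k) (shift M z) ∂rhoMeas‖
  have h1 : (side M / 10) ^ β = side M ^ β / 10 ^ β := Real.div_rpow hpos.le (by norm_num) _
  rw [h1, div_mul_eq_mul_div, div_le_iff₀ (by positivity)] at h
  rw [Real.rpow_neg hpos.le, ← div_eq_mul_inv, le_div_iff₀ (by positivity)]
  linarith

end Squares

/-! ### Averaging operators -/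

section Averaging

lemma eLpNorm_two_sq (f : T2 → ℂ) : eLpNorm f 2 haarT ^ 2 = ∫⁻ t, ‖f t‖ₑ ^ 2 ∂haarT := by
  rw [eLpNorm_eq_lintegral_rpow_enorm_toReal two_ne_zero ENNReal.ofNat_ne_top, ← ENNReal.rpow_natCast,
    ← ENNReal.rpow_mul]
  norm_num

variable {ι : Type*} {s : Finset ι} {m : ℝ} {a b : ι → T2 → ℝ}

/-- The averaging operator `f ↦ ∑ i, m⁻¹ (∫ f b i) a i`. -/
def avgOp (s : Finset ι) (m : ℝ) (a b : ι → T2 → ℝ) (f : T2 → ℂ) (t : T2) : ℂ :=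
  ∑ i ∈ s, ((m⁻¹ : ℝ) : ℂ) * (∫ u, f u * b i u ∂haarT) * a i t

/-- The kernel of `avgOp`. -/
def avgKer (s : Finset ι) (m : ℝ) (a b : ι → T2 → ℝ) (t u : T2) : ℝ :=
  ∑ i ∈ s, m⁻¹ * (a i t * b i u)

lemma avgKer_comm (s : Finset ι) (m : ℝ) (a b : ι → T2 → ℝ) (t u : T2) :
    avgKer s m a b t u = avgKer s m b a u t := by
  simp only [avgKer, mul_comm (a _ t)]

namespace IsPartition

lemma integrable_mul (H : IsPartition s m b) {i : ι} (hi : i ∈ s) {f : T2 → ℂ}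
    (hf : Integrable f haarT) : Integrable (fun u => f u * b i u) haarT :=
  hf.mul_bdd (c := 1) (Complex.measurable_ofReal.comp (H.measurable i)).aestronglyMeasurable
    (Filter.Eventually.of_forall fun t => by
      rw [Complex.norm_real]; exact H.norm_le_one hi t)

lemma avgOp_linear (Hb : IsPartition s m b) {f g : T2 → ℂ} (hf : Integrable f haarT)
    (hg : Integrable g haarT) (c d : ℂ) (t : T2) :
    avgOp s m a b (fun u => c * f u + d * g u) t =
      c * avgOp s m a b f t + d * avgOp s m a b g t := by
  rw [avgOp, avgOp, avgOp, Finset.mul_sum, Finset.mul_sum, ← Finset.sum_add_distrib]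
  refine Finset.sum_congr rfl fun i hi => ?_
  have h : ∫ u, (c * f u + d * g u) * b i u ∂haarT =
      c * ∫ u, f u * b i u ∂haarT + d * ∫ u, g u * b i u ∂haarT := by
    rw [← integral_const_mul, ← integral_const_mul, ← integral_add
      ((Hb.integrable_mul hi hf).const_mul c) ((Hb.integrable_mul hi hg).const_mul d)]
    congr 1; funext u; ring
  rw [h]
  ring

lemma measurable_avgOp (Ha : IsPartition s m a) (f : T2 → ℂ) : Measurable (avgOp s m a b f) :=
  Finset.measurable_fun_sum _ fun i _ =>
    (Complex.measurable_ofReal.comp (Ha.measurable i)).const_mul _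

lemma measurable_avgKer (Ha : IsPartition s m a) (Hb : IsPartition s m b) :
    Measurable (Function.uncurry (avgKer s m a b)) :=
  Finset.measurable_fun_sum _ fun i _ => (((Ha.measurable i).comp measurable_fst).mul
    ((Hb.measurable i).comp measurable_snd)).const_mul _

lemma avgKer_nonneg (Ha : IsPartition s m a) (Hb : IsPartition s m b) (hm : 0 < m) (t u : T2) :
    0 ≤ avgKer s m a b t u :=
  Finset.sum_nonneg fun i _ => mul_nonneg (inv_nonneg.2 hm.le)
    (mul_nonneg (Ha.nonneg i t) (Hb.nonneg i u))

lemma avgKer_le (Ha : IsPartition s m a) (Hb : IsPartition s m b) (hm : 0 < m) (t u : T2) :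
    avgKer s m a b t u ≤ m⁻¹ := by
  rw [avgKer, ← Finset.mul_sum]
  refine mul_le_of_le_one_right (inv_nonneg.2 hm.le) ?_
  rw [← Ha.sum_eq t]
  exact Finset.sum_le_sum fun i hi => mul_le_of_le_one_right (Ha.nonneg i t) (Hb.le_one hi u)

lemma norm_avgKer_le (Ha : IsPartition s m a) (Hb : IsPartition s m b) (hm : 0 < m) (t u : T2) :
    ‖(avgKer s m a b t u : ℂ)‖ ≤ m⁻¹ := by
  rw [Complex.norm_real, Real.norm_of_nonneg (Ha.avgKer_nonneg Hb hm t u)]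
  exact Ha.avgKer_le Hb hm t u

lemma measurable_avgKer_right (Ha : IsPartition s m a) (Hb : IsPartition s m b) (t : T2) :
    Measurable (avgKer s m a b t) := (Ha.measurable_avgKer Hb).comp measurable_prodMk_left

lemma integrable_avgKer_mul (Ha : IsPartition s m a) (Hb : IsPartition s m b) (hm : 0 < m) (t : T2)
    {f : T2 → ℂ} (hf : Integrable f haarT) :
    Integrable (fun u => (avgKer s m a b t u : ℂ) * f u) haarT :=
  hf.bdd_mul (c := m⁻¹)
    (Complex.measurable_ofReal.comp (Ha.measurable_avgKer_right Hb t)).aestronglyMeasurable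
    (Filter.Eventually.of_forall fun u => Ha.norm_avgKer_le Hb hm t u)

lemma integral_avgKer (Ha : IsPartition s m a) (Hb : IsPartition s m b) (hm : 0 < m) (t : T2) :
    ∫ u, avgKer s m a b t u ∂haarT = 1 := by
  simp only [avgKer]
  rw [integral_finsetSum _ fun i hi => ((Hb.integrable hi).const_mul _).const_mul _]
  simp only [integral_const_mul]
  refine Eq.trans (Finset.sum_congr rfl fun i hi => ?_) (Ha.sum_eq t)
  rw [Hb.integral_eq i hi]
  field_simp

lemma lintegral_avgKer (Ha : IsPartition s m a) (Hb : IsPartition s m b) (hm : 0 < m) (t : T2) :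
    ∫⁻ u, ENNReal.ofReal (avgKer s m a b t u) ∂haarT = 1 := by
  rw [← ofReal_integral_eq_lintegral_ofReal _ (Filter.Eventually.of_forall
    (Ha.avgKer_nonneg Hb hm t)), Ha.integral_avgKer Hb hm, ENNReal.ofReal_one]
  refine Integrable.of_bound (Ha.measurable_avgKer_right Hb t).aestronglyMeasurable m⁻¹
    (Filter.Eventually.of_forall fun u => ?_)
  rw [Real.norm_of_nonneg (Ha.avgKer_nonneg Hb hm t u)]
  exact Ha.avgKer_le Hb hm t u

lemma avgOp_eq_integral (Hb : IsPartition s m b) {f : T2 → ℂ} (hf : Integrable f haarT) (t : T2) :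
    avgOp s m a b f t = ∫ u, (avgKer s m a b t u : ℂ) * f u ∂haarT := by
  have h1 : ∀ u, (avgKer s m a b t u : ℂ) * f u =
      ∑ i ∈ s, ((m⁻¹ : ℝ) * a i t : ℂ) * (f u * b i u) := fun u => by
    rw [avgKer]
    push_cast
    rw [Finset.sum_mul]
    exact Finset.sum_congr rfl fun i _ => by ring
  simp only [h1]
  rw [integral_finsetSum _ fun i hi => (Hb.integrable_mul hi hf).const_mul _, avgOp]
  refine Finset.sum_congr rfl fun i _ => ?_
  rw [integral_const_mul]
  ring

lemma enorm_avgKer (Ha : IsPartition s m a) (Hb : IsPartition s m b) (hm : 0 < m) (t u : T2) :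
    ‖(avgKer s m a b t u : ℂ)‖ₑ = ENNReal.ofReal (avgKer s m a b t u) := by
  rw [← ofReal_norm, Complex.norm_real, Real.norm_of_nonneg (Ha.avgKer_nonneg Hb hm t u)]

lemma enorm_avgOp_le (Ha : IsPartition s m a) (Hb : IsPartition s m b) (hm : 0 < m) {f : T2 → ℂ}
    (hf : Integrable f haarT) (t : T2) :
    ‖avgOp s m a b f t‖ₑ ≤ ∫⁻ u, ENNReal.ofReal (avgKer s m a b t u) * ‖f u‖ₑ ∂haarT := by
  rw [Hb.avgOp_eq_integral hf]
  refine (enorm_integral_le_lintegral_enorm _).trans_eq ?_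
  simp only [enorm_mul, Ha.enorm_avgKer Hb hm]

/-- The averaging operators are contractions of all the spaces `L^p`. -/
lemma eLpNorm_avgOp_le (Ha : IsPartition s m a) (Hb : IsPartition s m b) (hm : 0 < m) {p : ℝ≥0∞}
    (hp : 1 ≤ p) {f : T2 → ℂ} (hf : MemLp f p haarT) :
    eLpNorm (avgOp s m a b f) p haarT ≤ eLpNorm f p haarT := by
  have h := eLpNorm_le_of_schur (μ := haarT) (A := 1)
    (k := fun t u => ENNReal.ofReal (avgKer s m a b t u))
    (Ha.measurable_avgKer Hb).ennreal_ofReal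
    (fun t => (Ha.lintegral_avgKer Hb hm t).le)
    (fun u => by
      simp only [avgKer_comm s m a b]
      exact (Hb.lintegral_avgKer Ha hm u).le)
    hf.1 (Ha.enorm_avgOp_le Hb hm (hf.integrable hp)) hp
  simpa using h

/-- The averages of a square integrable function are bounded, by the Cauchy–Schwarz
inequality. -/
lemma enorm_avgOp_le_eLpNorm_two (Ha : IsPartition s m a) (Hb : IsPartition s m b) (hm : 0 < m)
    {f : T2 → ℂ} (hf : MemLp f 2 haarT) (t : T2) :
    ‖avgOp s m a b f t‖ₑ ≤ ENNReal.ofReal (√m)⁻¹ * eLpNorm f 2 haarT := by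
  rw [← ENNReal.pow_le_pow_left_iff two_ne_zero, mul_pow, ← ENNReal.ofReal_pow (by positivity),
    inv_pow, Real.sq_sqrt hm.le]
  have h1 := lintegral_mul_rpow_le (μ := haarT) (F := fun u => ‖f u‖ₑ) (A := 1) (r := 2)
    (Ha.measurable_avgKer_right Hb t).ennreal_ofReal.aemeasurable hf.1.enorm (by norm_num)
    (Ha.lintegral_avgKer Hb hm t).le
  simp only [ENNReal.one_rpow, one_mul, ENNReal.rpow_two] at h1
  calc ‖avgOp s m a b f t‖ₑ ^ 2
      ≤ (∫⁻ u, ENNReal.ofReal (avgKer s m a b t u) * ‖f u‖ₑ ∂haarT) ^ 2 :=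
        pow_le_pow_left₀ zero_le (Ha.enorm_avgOp_le Hb hm (hf.integrable (by norm_num)) t) 2
    _ ≤ _ := h1
    _ ≤ ∫⁻ u, ENNReal.ofReal m⁻¹ * ‖f u‖ₑ ^ 2 ∂haarT := by
        gcongr with u
        exact Ha.avgKer_le Hb hm t u
    _ = _ := by
        rw [lintegral_const_mul' _ _ ENNReal.ofReal_ne_top, eLpNorm_two_sq]

end IsPartition

end Averaging

/-! ### Approximation by local averages -/

section Approximation

lemma eLpNorm_two_eq_hdotT {f : T2 → ℂ} (hf : MemLp f 2 haarT) (h0 : coef f 0 = 0) :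
    eLpNorm f 2 haarT = hdotT 0 f := by
  have h : ∑' k : {k : Fin 2 → ℤ // k ≠ 0},
      ENNReal.ofReal (‖freq k.1‖ ^ (2 * (0 : ℝ))) * ‖coef f k.1‖ₑ ^ 2 = eLpNorm f 2 haarT ^ 2 := by
    rw [← tsum_coef_sq hf]
    simp only [mul_zero, Real.rpow_zero, ENNReal.ofReal_one, one_mul]
    refine tsum_subtype_eq_of_support_subset (s := {k : Fin 2 → ℤ | k ≠ 0})
      (f := fun k => ‖coef f k‖ₑ ^ 2) fun k hk => ?_
    rintro rfl
    simp [h0] at hk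
  unfold hdotT
  rw [h, ← ENNReal.rpow_natCast, ← ENNReal.rpow_mul]
  norm_num

lemma norm_one_sub_mFourier_le {r : ℝ} {v : T2} (hv : ∀ i, ‖v i‖ ≤ r) (k : Fin 2 → ℤ) :
    ‖1 - mFourier k v‖ ≤ 4 * π * r * ‖freq k‖ := by
  have hpi := Real.pi_pos
  have h1 : ∀ i, |sec v i| ≤ 2 * π * r := fun i => by
    have h2 : ((sec v i / (2 * π) : ℝ) : UnitAddCircle) = v i := congrFun (toT_sec v) i
    have h3 := sec_mem v i
    have h4 : |sec v i / (2 * π)| ≤ |(1 : ℝ)| / 2 := by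
      rw [abs_div, abs_of_pos (show 0 < 2 * π by positivity), abs_one,
        div_le_div_iff₀ (by positivity) (by norm_num)]
      have := abs_le.2 ⟨h3.1, h3.2.le⟩
      linarith
    have h5 := (AddCircle.norm_coe_eq_abs_iff 1 one_ne_zero).2 h4
    rw [h2] at h5
    have h6 := hv i
    rw [h5, abs_div, abs_of_pos (show 0 < 2 * π by positivity), div_le_iff₀ (by positivity)] at h6
    linarith
  have h2 : ‖sec v‖ ≤ 4 * π * r := by
    have hr : 0 ≤ r := (norm_nonneg _).trans (hv 0)
    rw [EuclideanSpace.norm_eq, Real.sqrt_le_left (by positivity), Fin.sum_univ_two]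
    simp only [Real.norm_eq_abs]
    have a0 := pow_le_pow_left₀ (abs_nonneg _) (h1 0) 2
    have a1 := pow_le_pow_left₀ (abs_nonneg _) (h1 1) 2
    nlinarith [sq_nonneg (2 * π * r)]
  have h3 : mFourier k v = Complex.exp (Complex.I * (inner ℝ (freq k) (sec v) : ℝ)) := by
    rw [mul_comm, ← char, char_eq, toT_sec]
  rw [h3, norm_sub_rev]
  refine (Real.norm_exp_I_mul_ofReal_sub_one_le).trans ?_
  rw [mul_comm]
  refine (norm_inner_le_norm _ _).trans ?_
  gcongr

/-- The modulus of continuity in `L²` of a function with `β` derivatives in `L²`. -/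
lemma eLpNorm_sub_translate_le {β : ℝ} (hβ : 0 < β) (hβ1 : β ≤ 1) {f : T2 → ℂ}
    (hf : MemLp f 2 haarT) {r : ℝ} {v : T2} (hv : ∀ i, ‖v i‖ ≤ r) :
    eLpNorm (fun t => f t - f (t - v)) 2 haarT ≤
      ENNReal.ofReal (2 * (4 * π * r) ^ β) * hdotT β f := by
  have hr : 0 ≤ r := (norm_nonneg _).trans (hv 0)
  have hpi := Real.pi_pos
  have hft : MemLp (fun t => f (t - v)) 2 haarT :=
    hf.comp_measurePreserving (measurePreserving_sub_right haarT v)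
  have hc : ∀ k, coef (fun t => f t - f (t - v)) k = (1 - mFourier (-k) v) * coef f k := fun k => by
    rw [coef_sub (hf.integrable (by norm_num)) (hft.integrable (by norm_num)), coef_translate]
    ring
  have hmem : MemLp (fun t => f t - f (t - v)) 2 haarT := hf.sub hft
  rw [eLpNorm_two_eq_hdotT hmem]
  · refine hdotT_le fun k hk => ?_
    rw [hc, Real.rpow_zero, ENNReal.ofReal_one, one_mul, enorm_mul, ← mul_assoc]
    gcongr
    rw [← ofReal_norm, ← ENNReal.ofReal_mul (by positivity)]
    refine ENNReal.ofReal_le_ofReal ?_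
    rw [mul_assoc, ← Real.mul_rpow (by positivity) (norm_nonneg _)]
    have h1 := norm_one_sub_mFourier_le hv (-k)
    rw [freq_neg, norm_neg] at h1
    set x := 4 * π * r * ‖freq k‖
    have hx0 : 0 ≤ x := by positivity
    -- the modulus is at most `min x 2`, hence at most `2 x^β`
    rcases le_total x 1 with hx | hx
    · have h2 : x ≤ x ^ β := Real.self_le_rpow_of_le_one hx0 hx hβ1
      linarith
    · have h2 : 1 ≤ x ^ β := Real.one_le_rpow hx hβ.le
      have h3 : ‖1 - mFourier (-k) v‖ ≤ 1 + 1 := by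
        refine (norm_sub_le _ _).trans ?_
        rw [norm_one, norm_mFourier_apply]
      linarith
  · have := hc 0
    rw [neg_zero, UnitAddTorus.mFourier_zero] at this
    simpa using this

lemma haarT_ball_le {r : ℝ} (hr : 0 ≤ r) :
    haarT {v | ∀ i, ‖v i‖ ≤ r} ≤ ENNReal.ofReal ((2 * r) ^ 2) := by
  have e : {v : T2 | ∀ i, ‖v i‖ ≤ r} = univ.pi fun _ => Metric.closedBall 0 r := by
    ext v; simp
  have h1 : AddCircle.haarAddCircle (Metric.closedBall (0 : UnitAddCircle) r) ≤
      ENNReal.ofReal (2 * r) := by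
    have h := AddCircle.volume_closedBall (1 : ℝ) (x := 0) r
    rw [AddCircle.volume_eq_smul_haarAddCircle] at h
    simp only [ENNReal.ofReal_one, one_smul] at h
    rw [h]
    exact ENNReal.ofReal_le_ofReal (min_le_right _ _)
  rw [e, haarT, Measure.pi_pi, Fin.prod_univ_two, sq, ENNReal.ofReal_mul (by positivity)]
  gcongr

variable {ι : Type*} {s : Finset ι} {m : ℝ} {a b : ι → T2 → ℝ}

namespace IsPartition

lemma enorm_sub_avgOp_le (Ha : IsPartition s m a) (Hb : IsPartition s m b) (hm : 0 < m)
    {f : T2 → ℂ} (hf : Integrable f haarT) (t : T2) : ‖f t - avgOp s m a b f t‖ₑ ≤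
      ∫⁻ u, ENNReal.ofReal (avgKer s m a b t u) * ‖f t - f u‖ₑ ∂haarT := by
  have h : f t - avgOp s m a b f t =
      ∫ u, (avgKer s m a b t u : ℂ) * (f t - f u) ∂haarT := by
    have h1 : ∫ u, (avgKer s m a b t u : ℂ) * f t ∂haarT = f t := by
      have h2 : ∫ u, (avgKer s m a b t u : ℂ) ∂haarT = ((1 : ℝ) : ℂ) := by
        exact integral_ofReal.trans (congrArg _ (Ha.integral_avgKer Hb hm t))
      rw [integral_mul_const, h2, Complex.ofReal_one, one_mul]
    simp only [mul_sub]
    rw [integral_sub (Ha.integrable_avgKer_mul Hb hm t (integrable_const (f t)))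
      (Ha.integrable_avgKer_mul Hb hm t hf), h1, Hb.avgOp_eq_integral hf]
  rw [h]
  refine (enorm_integral_le_lintegral_enorm _).trans_eq ?_
  simp only [enorm_mul, Ha.enorm_avgKer Hb hm]

/-- Averages over sets of size `r` approximate a function up to its modulus of continuity. -/
lemma eLpNorm_sub_avgOp_le (Ha : IsPartition s m a) (hm : 0 < m) {r : ℝ} (hr : 0 ≤ r)
    (hsupp : ∀ i ∈ s, ∀ t u, a i t ≠ 0 → a i u ≠ 0 → ∀ j, ‖(t - u) j‖ ≤ r) {β : ℝ} (hβ : 0 < β)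
    (hβ1 : β ≤ 1) {f : T2 → ℂ} (hf : MemLp f 2 haarT) :
    eLpNorm (fun t => f t - avgOp s m a a f t) 2 haarT ≤
      ENNReal.ofReal (2 * r * (√m)⁻¹ * (2 * (4 * π * r) ^ β)) * hdotT β f := by
  have hpi := Real.pi_pos
  have hfi : Integrable f haarT := hf.integrable (by norm_num)
  set B : Set T2 := {v | ∀ i, ‖v i‖ ≤ r} with hB
  have hBm : MeasurableSet B := by
    rw [hB, ofPred_forall]
    exact MeasurableSet.iInter fun i => measurableSet_le (by fun_prop) measurable_const
  have hker : ∀ t v, ENNReal.ofReal (avgKer s m a a t (t - v)) ≤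
      B.indicator (fun _ => ENNReal.ofReal m⁻¹) v := fun t v => by
    by_cases hv : v ∈ B
    · rw [indicator_of_mem hv]
      exact ENNReal.ofReal_le_ofReal (Ha.avgKer_le Ha hm _ _)
    · rw [indicator_of_notMem hv, nonpos_iff_eq_zero, ENNReal.ofReal_eq_zero]
      refine (Finset.sum_eq_zero fun i hi => ?_).le
      by_contra hne
      have h1 := mul_ne_zero_iff.1 (mul_ne_zero_iff.1 hne).2
      refine hv fun j => ?_
      have := hsupp i hi _ _ h1.1 h1.2 j
      rwa [sub_sub_cancel] at this
  -- the Cauchy–Schwarz inequality for the kernel, in the variable `v = t - u`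
  have hpt : ∀ t, ‖f t - avgOp s m a a f t‖ₑ ^ 2 ≤
      ∫⁻ v, B.indicator (fun _ => ENNReal.ofReal m⁻¹) v * ‖f t - f (t - v)‖ₑ ^ 2 ∂haarT := fun t => by
    have h1 := lintegral_mul_rpow_le (μ := haarT) (F := fun u => ‖f t - f u‖ₑ) (A := 1) (r := 2)
      (Ha.measurable_avgKer_right Ha t).ennreal_ofReal.aemeasurable
      (aestronglyMeasurable_const.sub hf.1).enorm (by norm_num) (Ha.lintegral_avgKer Ha hm t).le
    simp only [ENNReal.one_rpow, one_mul, ENNReal.rpow_two] at h1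
    calc _ ≤ _ := pow_le_pow_left₀ zero_le (Ha.enorm_sub_avgOp_le Ha hm hfi t) 2
      _ ≤ _ := h1
      _ = ∫⁻ v, ENNReal.ofReal (avgKer s m a a t (t - v)) * ‖f t - f (t - v)‖ₑ ^ 2 ∂haarT :=
        (lintegral_sub_left_eq_self (μ := haarT)
          (fun u => ENNReal.ofReal (avgKer s m a a t u) * ‖f t - f u‖ₑ ^ 2) t).symm
      _ ≤ _ := by
        gcongr with v
        exact hker t v
  set E := ENNReal.ofReal (2 * (4 * π * r) ^ β) * hdotT β f with hE
  rw [← ENNReal.pow_le_pow_left_iff two_ne_zero, eLpNorm_two_sq]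
  calc ∫⁻ t, ‖f t - avgOp s m a a f t‖ₑ ^ 2 ∂haarT
      ≤ ∫⁻ t, ∫⁻ v, B.indicator (fun _ => ENNReal.ofReal m⁻¹) v * ‖f t - f (t - v)‖ₑ ^ 2 ∂haarT
          ∂haarT := lintegral_mono hpt
    _ = ∫⁻ v, ∫⁻ t, B.indicator (fun _ => ENNReal.ofReal m⁻¹) v * ‖f t - f (t - v)‖ₑ ^ 2 ∂haarT
          ∂haarT := by
        refine lintegral_lintegral_swap ?_
        refine AEMeasurable.mul
          ((measurable_const.indicator hBm).comp measurable_snd).aemeasurable ?_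
        refine AEMeasurable.pow_const (AEStronglyMeasurable.enorm ?_) 2
        exact hf.1.comp_fst.sub (hf.1.comp_quasiMeasurePreserving
          (quasiMeasurePreserving_sub_of_right_invariant haarT haarT))
    _ ≤ ∫⁻ v, B.indicator (fun _ => ENNReal.ofReal m⁻¹ * E ^ 2) v ∂haarT := by
        refine lintegral_mono fun v => ?_
        by_cases hv : v ∈ B
        · simp only [indicator_of_mem hv]
          rw [lintegral_const_mul' _ _ ENNReal.ofReal_ne_top,
            ← eLpNorm_two_sq (fun t => f t - f (t - v))]
          gcongr
          exact eLpNorm_sub_translate_le hβ hβ1 hf hv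
        · simp [indicator_of_notMem hv]
    _ = ENNReal.ofReal m⁻¹ * E ^ 2 * haarT B := by
        rw [lintegral_indicator_const hBm]
    _ ≤ ENNReal.ofReal m⁻¹ * E ^ 2 * ENNReal.ofReal ((2 * r) ^ 2) := by
        gcongr
        exact haarT_ball_le hr
    _ = _ := by
        rw [ENNReal.ofReal_mul (p := 2 * r * (√m)⁻¹) (by positivity), mul_assoc (ENNReal.ofReal _),
          mul_assoc (ENNReal.ofReal _), ← hE,
          mul_pow _ E, ← ENNReal.ofReal_pow (by positivity), mul_pow _ (√m)⁻¹, inv_pow, Real.sq_sqrt hm.le,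
          ENNReal.ofReal_mul (by positivity)]
        ring

end IsPartition

end Approximation

/-! ### Negative norms by duality -/

section Duality

variable {ι : Type*} {s : Finset ι} {m : ℝ} {a : ι → T2 → ℝ}

lemma enorm_integral_mul_le {f g : T2 → ℂ} (hf : AEStronglyMeasurable f haarT)
    (hg : AEStronglyMeasurable g haarT) :
    ‖∫ t, f t * g t ∂haarT‖ₑ ≤ eLpNorm f 2 haarT * eLpNorm g 2 haarT := by
  have h := ENNReal.lintegral_mul_le_Lp_mul_Lq haarT Real.HolderConjugate.two_two
    (f := fun t => ‖f t‖ₑ) (g := fun t => ‖g t‖ₑ) hf.enorm hg.enorm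
  have e : ∀ f : T2 → ℂ, (∫⁻ t, ‖f t‖ₑ ^ (2 : ℝ) ∂haarT) ^ (1 / 2 : ℝ) = eLpNorm f 2 haarT :=
    fun f => by
      rw [eLpNorm_eq_lintegral_rpow_enorm_toReal two_ne_zero ENNReal.ofNat_ne_top]
      norm_num
  rw [e, e] at h
  refine (enorm_integral_le_lintegral_enorm _).trans ?_
  simpa only [enorm_mul, Pi.mul_apply] using h

open scoped ComplexConjugate in
/-- The averaging operator of a single partition of unity is symmetric. -/
lemma IsPartition.integral_avgOp_mul_conj (Ha : IsPartition s m a) {f g : T2 → ℂ}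
    (hg : Integrable g haarT) :
    ∫ t, avgOp s m a a f t * conj (g t) ∂haarT =
      ∑ i ∈ s, ((m⁻¹ : ℝ) : ℂ) * (∫ u, f u * a i u ∂haarT) * conj (∫ u, g u * a i u ∂haarT) := by
  have h1 : ∀ t, avgOp s m a a f t * conj (g t) = ∑ i ∈ s,
      (((m⁻¹ : ℝ) : ℂ) * ∫ u, f u * a i u ∂haarT) * conj (g t * a i t) := fun t => by
    rw [avgOp, Finset.sum_mul]
    refine Finset.sum_congr rfl fun i _ => ?_
    rw [map_mul, Complex.conj_ofReal]
    ring
  have h2 : ∀ i ∈ s, Integrable (fun t => conj (g t * a i t)) haarT := fun i hi =>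
    (LinearIsometryEquiv.integrable_comp_iff (Complex.conjLIE)).2 (Ha.integrable_mul hi hg)
  simp only [h1]
  rw [integral_finsetSum _ fun i hi => (h2 i hi).const_mul _]
  refine Finset.sum_congr rfl fun i _ => ?_
  rw [integral_const_mul]
  congr 1
  exact integral_conj

open scoped ComplexConjugate in
/-- By duality, an approximation estimate from `Ḣ^β` to `L²` for a symmetric operator gives one
from `L²` to `Ḣ^{-β}`. -/
lemma IsPartition.hdotT_neg_sub_avgOp_le (Ha : IsPartition s m a) (hm : 0 < m) {β : ℝ} {D : ℝ≥0∞}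
    (hD : ∀ g, MemLp g 2 haarT →
      eLpNorm (fun t => g t - avgOp s m a a g t) 2 haarT ≤ D * hdotT β g)
    {f : T2 → ℂ} (hf : MemLp f 2 haarT) :
    hdotT (-β) (fun t => f t - avgOp s m a a f t) ≤ D * eLpNorm f 2 haarT := by
  have hOp : ∀ {g}, MemLp g 2 haarT → MemLp (avgOp s m a a g) 2 haarT := fun {g} hg =>
    ⟨(Ha.measurable_avgOp g).aestronglyMeasurable,
      (Ha.eLpNorm_avgOp_le Ha hm (by norm_num) hg).trans_lt hg.2⟩
  set g : T2 → ℂ := fun t => f t - avgOp s m a a f t with hg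
  have hgm : MemLp g 2 haarT := hf.sub (hOp hf)
  rw [hdotT_eq]
  have key : ∀ F : Finset {k : Fin 2 → ℤ // k ≠ 0},
      ∑ k ∈ F, (ENNReal.ofReal (‖freq k.1‖ ^ (-β)) * ‖coef g k.1‖ₑ) ^ 2 ≤
        (D * eLpNorm f 2 haarT) ^ 2 := by
    intro F
    set S := ∑ k ∈ F, (ENNReal.ofReal (‖freq k.1‖ ^ (-β)) * ‖coef g k.1‖ₑ) ^ 2 with hS
    have hST : S ≠ ⊤ := by
      exact ENNReal.sum_ne_top.2 fun k _ => by finiteness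
    -- the test function that detects the norm of the frequencies in `F`
    set c : (Fin 2 → ℤ) → ℂ := fun k => ((‖freq k‖ ^ (-(2 * β)) : ℝ) : ℂ) * coef g k with hc
    set F' : Finset (Fin 2 → ℤ) := F.map (Function.Embedding.subtype _) with hF'
    set χ := trig F' c with hχ
    have hχm : MemLp χ 2 haarT := memLp_of_continuous (continuous_trig _ _) 2
    have hχi : Integrable χ haarT := hχm.integrable (by norm_num)
    have hpair : ∫ t, g t * conj (χ t) ∂haarT =
        ((∑ k ∈ F, (‖freq k.1‖ ^ (-β) * ‖coef g k.1‖) ^ 2 : ℝ) : ℂ) := by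
      have h1 : ∀ t, g t * conj (χ t) = ∑ k ∈ F', conj (c k) * (g t * mFourier (-k) t) := fun t => by
        rw [hχ, trig, map_sum, Finset.mul_sum]
        refine Finset.sum_congr rfl fun k _ => ?_
        rw [map_mul, UnitAddTorus.mFourier_neg]
        ring
      simp only [h1]
      rw [integral_finsetSum _ fun k _ =>
        (integrable_mul_mFourier (hgm.integrable (by norm_num)) _).const_mul _]
      rw [hF', Finset.sum_map, Complex.ofReal_sum]
      refine Finset.sum_congr rfl fun k _ => ?_
      rw [integral_const_mul]
      have h2 : ∫ t, g t * mFourier (-k.1) t ∂haarT = coef g k.1 := rfl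
      have h3 : ‖freq k.1‖ ^ (-(2 * β)) = (‖freq k.1‖ ^ (-β)) ^ 2 := by
        rw [← Real.rpow_natCast, ← Real.rpow_mul (norm_nonneg _)]
        push_cast; ring_nf
      simp only [hc, Function.Embedding.coe_subtype, h2, map_mul, Complex.conj_ofReal, h3]
      rw [mul_assoc, Complex.conj_mul']
      push_cast
      ring
    have hSe : ‖∫ t, g t * conj (χ t) ∂haarT‖ₑ = S := by
      rw [hpair, ← ofReal_norm, Complex.norm_real, Real.norm_of_nonneg
        (Finset.sum_nonneg fun _ _ => sq_nonneg _), hS, ENNReal.ofReal_sum_of_nonneg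
        fun _ _ => sq_nonneg _]
      refine Finset.sum_congr rfl fun k _ => ?_
      rw [ENNReal.ofReal_pow (by positivity), ENNReal.ofReal_mul (by positivity), ofReal_norm]
    have hsymm : ∫ t, g t * conj (χ t) ∂haarT =
        ∫ t, f t * conj (χ t - avgOp s m a a χ t) ∂haarT := by
      have i1 : ∀ {u v : T2 → ℂ}, MemLp u 2 haarT → MemLp v 2 haarT →
          Integrable (fun t => u t * conj (v t)) haarT := fun hu hv =>
        hu.integrable_mul (q := 2) hv.star
      have e1 : ∀ t, g t * conj (χ t) = f t * conj (χ t) - avgOp s m a a f t * conj (χ t) :=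
        fun t => sub_mul _ _ _
      have e2 : ∀ t, f t * conj (χ t - avgOp s m a a χ t) =
          f t * conj (χ t) - f t * conj (avgOp s m a a χ t) := fun t => by
        rw [map_sub, mul_sub]
      simp only [e1, e2]
      rw [integral_sub (i1 hf hχm) (i1 (hOp hf) hχm), integral_sub (i1 hf hχm) (i1 hf (hOp hχm)),
        Ha.integral_avgOp_mul_conj hχi]
      congr 1
      have h3 : ∫ t, f t * conj (avgOp s m a a χ t) ∂haarT =
          conj (∫ t, avgOp s m a a χ t * conj (f t) ∂haarT) := by
        rw [← integral_conj]
        congr 1; funext t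
        rw [map_mul, Complex.conj_conj, mul_comm]
      rw [h3, Ha.integral_avgOp_mul_conj (hf.integrable (by norm_num)), map_sum]
      refine Finset.sum_congr rfl fun i _ => ?_
      rw [map_mul, map_mul, Complex.conj_ofReal, Complex.conj_conj]
      ring
    have hχd : hdotT β χ = S ^ (1 / 2 : ℝ) := by
      rw [hdotT_eq, hS]
      congr 1
      have h1 : ∀ k : {k : Fin 2 → ℤ // k ≠ 0}, k ∉ F →
          (ENNReal.ofReal (‖freq k.1‖ ^ β) * ‖coef χ k.1‖ₑ) ^ 2 = 0 := fun k hk => by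
        rw [hχ, coef_trig, if_neg]
        · simp
        · rw [hF', Finset.mem_map]
          rintro ⟨k', hk', e⟩
          exact hk (by rwa [← Subtype.ext e])
      rw [tsum_eq_sum h1]
      refine Finset.sum_congr rfl fun k hk => ?_
      have hkF : k.1 ∈ F' := Finset.mem_map.2 ⟨k, hk, rfl⟩
      rw [hχ, coef_trig, if_pos hkF, hc]
      dsimp only
      rw [enorm_mul, ← ofReal_norm (_ : ℂ), Complex.norm_real,
        Real.norm_of_nonneg (by positivity), ← mul_assoc, ← ENNReal.ofReal_mul (by positivity),
        ← Real.rpow_add (norm_freq_pos k.2)]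
      ring_nf
    have hle : S ≤ D * eLpNorm f 2 haarT * S ^ (1 / 2 : ℝ) := by
      calc S = ‖∫ t, f t * conj (χ t - avgOp s m a a χ t) ∂haarT‖ₑ := by rw [← hSe, hsymm]
        _ ≤ eLpNorm f 2 haarT * eLpNorm (fun t => conj (χ t - avgOp s m a a χ t)) 2 haarT :=
          enorm_integral_mul_le hf.1 (hχm.sub (hOp hχm)).star.1
        _ = eLpNorm f 2 haarT * eLpNorm (fun t => χ t - avgOp s m a a χ t) 2 haarT := by
          congr 1
          exact eLpNorm_congr_norm_ae (Filter.Eventually.of_forall fun t => RCLike.norm_conj _)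
        _ ≤ eLpNorm f 2 haarT * (D * S ^ (1 / 2 : ℝ)) := by
          rw [← hχd]
          gcongr
          exact hD χ hχm
        _ = _ := by ring
    set σ := S ^ (1 / 2 : ℝ) with hσ
    have hσS : S = σ ^ 2 := by
      rw [hσ, ← ENNReal.rpow_natCast, ← ENNReal.rpow_mul]; norm_num
    rcases eq_or_ne σ 0 with h0 | h0
    · rw [hσS, h0]; simp
    · have hσT : σ ≠ ⊤ := ENNReal.rpow_ne_top_of_nonneg (by norm_num) hST
      rw [hσS, sq] at hle
      rw [hσS]
      exact pow_le_pow_left₀ zero_le ((ENNReal.mul_le_mul_iff_left h0 hσT).1 hle) 2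
  calc _ ≤ ((D * eLpNorm f 2 haarT) ^ 2) ^ (1 / 2 : ℝ) := by
        gcongr
        exact ENNReal.summable.tsum_le_of_sum_le key
    _ = _ := by rw [← ENNReal.rpow_natCast, ← ENNReal.rpow_mul]; norm_num

end Duality

/-! ### Volume elements on the torus -/

section VolumeElements

variable {M : ℕ}

/-- The interpolation by volume elements, as an operator on functions on the torus. -/
def volOp (M : ℕ) (f : T2 → ℂ) : T2 → ℂ :=
  avgOp (idx M) (1 / (4 * (M : ℝ) ^ 2)) (Psi M) (Psi M) f

lemma one_div_four_mul_sq_pos (hM : 0 < M) : (0 : ℝ) < 1 / (4 * (M : ℝ) ^ 2) := by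
  have : (0 : ℝ) < M := by exact_mod_cast hM
  positivity

lemma integral_psiT (hM : 0 < M) {α : Fin 2 → ℤ} (hα : α ∈ idx M) :
    ∫ x, psiT M α x ∂cellMeasure = 4 * π ^ 2 * (1 / (4 * (M : ℝ) ^ 2)) := by
  rw [integral_cell, smul_eq_mul]
  simp only [psiT_eq hM hα, toT_sec]
  rw [(isPartition_Psi hM).integral_eq α hα]

lemma avg_psiT (hM : 0 < M) {α : Fin 2 → ℤ} (hα : α ∈ idx M) :
    avg (psiT M α) = 1 / (4 * (M : ℝ) ^ 2) := by
  have hpi := Real.pi_pos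
  rw [avg, integral_psiT hM hα]
  field_simp

lemma localAvg_eq (hM : 0 < M) {α : Fin 2 → ℤ} (hα : α ∈ idx M) (φ : Plane → ℂ) :
    localAvg M α φ = (((1 / (4 * (M : ℝ) ^ 2))⁻¹ : ℝ) : ℂ) *
      ∫ t, φ (sec t) * Psi M α t ∂haarT := by
  have hM' : (M : ℂ) ≠ 0 := by exact_mod_cast hM.ne'
  have hpi : (π : ℂ) ≠ 0 := by exact_mod_cast Real.pi_ne_zero
  rw [localAvg, integral_psiT hM hα, integral_cell]
  simp only [psiT_eq hM hα, toT_sec]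
  rw [Complex.real_smul]
  push_cast
  field_simp

lemma volElt_eq (hM : 0 < M) (φ : Plane → ℂ) :
    volElt M φ = fun x => volOp M (fun t => φ (sec t)) (toT x) := by
  funext x
  refine Finset.sum_congr rfl fun α hα => ?_
  rw [localAvg_eq hM hα, psiT_eq hM hα]

lemma coef_zero (f : T2 → ℂ) : coef f 0 = ∫ t, f t ∂haarT := by
  simp [coef, UnitAddTorus.mFourier_zero]

/-- The shift subtracts the mean value of the function, as the mollified squares form a partition
of unity with equal integrals. -/
lemma volEltShift_eq (hM : 0 < M) {φ : Plane → ℂ} (hφ : MemLpPer 1 φ) : volEltShift M φ =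
    fun x => volOp M (fun t => φ (sec t)) (toT x) - coef (fun t => φ (sec t)) 0 := by
  have H := isPartition_Psi hM
  have hi := hφ.sec.integrable le_rfl
  have hm := (one_div_four_mul_sq_pos hM).ne'
  have h1 : coef (fun t => φ (sec t)) 0 =
      ∑ α ∈ idx M, ∫ t, φ (sec t) * Psi M α t ∂haarT := by
    rw [coef_zero, ← integral_finsetSum _ fun α hα => H.integrable_mul hα hi]
    congr 1; funext t
    rw [← Finset.mul_sum, ← Complex.ofReal_sum, H.sum_eq]
    simp
  funext x
  rw [h1, ← congrFun (volElt_eq hM φ) x, volElt, ← Finset.sum_sub_distrib]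
  refine Finset.sum_congr rfl fun α hα => ?_
  rw [avg_psiT hM hα, Complex.ofReal_sub, mul_sub, localAvg_eq hM hα]
  congr 1
  rw [mul_right_comm, ← Complex.ofReal_mul, inv_mul_cancel₀ hm, Complex.ofReal_one, one_mul]

lemma measurable_volOp (hM : 0 < M) (f : T2 → ℂ) : Measurable (volOp M f) :=
  (isPartition_Psi hM).measurable_avgOp f

lemma eLpNorm_volOp_le (hM : 0 < M) {p : ℝ≥0∞} (hp : 1 ≤ p) {f : T2 → ℂ} (hf : MemLp f p haarT) :
    eLpNorm (volOp M f) p haarT ≤ eLpNorm f p haarT :=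
  (isPartition_Psi hM).eLpNorm_avgOp_le (isPartition_Psi hM) (one_div_four_mul_sq_pos hM) hp hf

lemma memLp_volOp (hM : 0 < M) {p : ℝ≥0∞} (hp : 1 ≤ p) {f : T2 → ℂ} (hf : MemLp f p haarT) :
    MemLp (volOp M f) p haarT :=
  ⟨(measurable_volOp hM f).aestronglyMeasurable, (eLpNorm_volOp_le hM hp hf).trans_lt hf.2⟩

lemma inv_sqrt_one_div (hM : 0 < M) : (√(1 / (4 * (M : ℝ) ^ 2)))⁻¹ = 2 * M := by
  have : 1 / (4 * (M : ℝ) ^ 2) = ((2 * (M : ℝ))⁻¹) ^ 2 := by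
    field_simp; norm_num
  rw [this, Real.sqrt_sq (by positivity), inv_inv]

lemma two_mul_eq_inv_side (hM : 0 < M) : 2 * (M : ℝ) = 2 * π * (side M)⁻¹ := by
  have := Real.pi_pos
  rw [side]; field_simp

lemma enorm_volOp_le (hM : 0 < M) {f : T2 → ℂ} (hf : MemLp f 2 haarT) (t : T2) :
    ‖volOp M f t‖ₑ ≤ (2 * π).toNNReal * ENNReal.ofReal (side M)⁻¹ * eLpNorm f 2 haarT := by
  have h := (isPartition_Psi hM).enorm_avgOp_le_eLpNorm_two (isPartition_Psi hM)
    (one_div_four_mul_sq_pos hM) hf t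
  rwa [inv_sqrt_one_div hM, two_mul_eq_inv_side hM, ENNReal.ofReal_mul (by positivity)] at h

/-- The mollification of the squares is a rapidly decaying Fourier multiplier, so that the
interpolants are smooth at the scale `h`. -/
lemma exists_hdotT_volOp_le {β : ℝ} (hβ : 0 ≤ β) : ∃ C : ℝ≥0, ∀ M : ℕ, 0 < M →
    ∀ f : T2 → ℂ, MemLp f 2 haarT →
      hdotT β (volOp M f) ≤ C * ENNReal.ofReal (side M ^ (-β)) * eLpNorm f 2 haarT := by
  obtain ⟨C, hC0, hC⟩ := exists_mollifier_decay hβ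
  refine ⟨C.toNNReal, fun M hM f hf => ?_⟩
  have H := isPartition_chi hM
  have H' := isPartition_Psi hM
  have hm := one_div_four_mul_sq_pos hM
  -- `volOp M f` is the mollification of the step function `g`
  set g := avgOp (idx M) (1 / (4 * (M : ℝ) ^ 2)) (chi M) (Psi M) f with hg
  have hgm : MemLp g 2 haarT := ⟨(H.measurable_avgOp f).aestronglyMeasurable,
    (H.eLpNorm_avgOp_le H' hm (by norm_num) hf).trans_lt hf.2⟩
  have hint : ∀ {a : (Fin 2 → ℤ) → T2 → ℝ}, IsPartition (idx M) (1 / (4 * (M : ℝ) ^ 2)) a →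
      ∀ (c : (Fin 2 → ℤ) → ℂ), ∀ α ∈ idx M, Integrable (fun t => c α * (a α t : ℂ)) haarT :=
    fun Ha c α hα => (Ha.integrable hα).ofReal.const_mul (c α)
  let c : (Fin 2 → ℤ) → ℂ := fun α =>
    (((1 / (4 * (M : ℝ) ^ 2))⁻¹ : ℝ) : ℂ) * ∫ u, f u * Psi M α u ∂haarT
  have hcoef : ∀ k, coef (volOp M f) k =
      (∫ z, mFourier (-k) (shift M z) ∂rhoMeas) * coef g k := fun k => by
    have e1 := coef_sum (idx M) (hint H' c) k
    have e2 := coef_sum (idx M) (hint H c) k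
    refine e1.trans (Eq.trans ?_ (congrArg _ e2.symm))
    rw [Finset.mul_sum]
    refine Finset.sum_congr rfl fun α hα => ?_
    rw [coef_const_mul, coef_const_mul, mul_left_comm]
    congr 1
    exact H.coef_mollify measurable_shift hα k
  calc hdotT β (volOp M f) ≤ C.toNNReal * ENNReal.ofReal (side M ^ (-β)) * hdotT 0 g := by
        refine hdotT_le fun k _ => ?_
        rw [hcoef, Real.rpow_zero, ENNReal.ofReal_one, one_mul, enorm_mul, ← mul_assoc]
        gcongr ?_ * _
        rw [← ofReal_norm, ← ENNReal.ofReal_mul (by positivity)]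
        refine (ENNReal.ofReal_le_ofReal (hC M hM k)).trans_eq ?_
        rw [ENNReal.ofReal_mul hC0]
        rfl
    _ ≤ _ := by
        gcongr
        exact (hdotT_zero_le hgm).trans (H.eLpNorm_avgOp_le H' hm (by norm_num) hf)

/-- The mollified squares have the size `r = 3 / (5 M)` on the torus of period one, and
`4 π r = 12 h / 5`. -/
lemma exists_eLpNorm_sub_volOp_le {β : ℝ} (hβ : 0 < β) (hβ1 : β ≤ 1) : ∃ C : ℝ≥0, ∀ M : ℕ, 0 < M →
    ∀ f : T2 → ℂ, MemLp f 2 haarT → eLpNorm (fun t => f t - volOp M f t) 2 haarT ≤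
      C * ENNReal.ofReal (side M ^ β) * hdotT β f := by
  refine ⟨(24 / 5 * (12 / 5 : ℝ) ^ β).toNNReal, fun M hM f hf => ?_⟩
  have hM' : (0 : ℝ) < M := by exact_mod_cast hM
  have hpos := side_pos hM
  have h := (isPartition_Psi hM).eLpNorm_sub_avgOp_le (one_div_four_mul_sq_pos hM)
    (r := 3 / (5 * M)) (by positivity)
    (fun α _ t u ht hu j => norm_sub_le_of_Psi_ne_zero hM ht hu j) hβ hβ1 hf
  refine h.trans_eq ?_
  rw [inv_sqrt_one_div hM]
  have e : 2 * (3 / (5 * (M : ℝ))) * (2 * M) * (2 * (4 * π * (3 / (5 * M))) ^ β) =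
      24 / 5 * (12 / 5 : ℝ) ^ β * side M ^ β := by
    have e1 : 4 * π * (3 / (5 * (M : ℝ))) = 12 / 5 * side M := by rw [side]; ring
    rw [e1, Real.mul_rpow (by norm_num) hpos.le]
    field_simp
    norm_num
  rw [e, ENNReal.ofReal_mul (by positivity)]
  rfl

lemma exists_hdotT_neg_sub_volOp_le {β : ℝ} (hβ : 0 < β) (hβ1 : β ≤ 1) : ∃ C : ℝ≥0, ∀ M : ℕ,
    0 < M → ∀ f : T2 → ℂ, MemLp f 2 haarT → hdotT (-β) (fun t => f t - volOp M f t) ≤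
      C * ENNReal.ofReal (side M ^ β) * eLpNorm f 2 haarT := by
  obtain ⟨C, hC⟩ := exists_eLpNorm_sub_volOp_le hβ hβ1
  exact ⟨C, fun M hM f hf => (isPartition_Psi hM).hdotT_neg_sub_avgOp_le
    (one_div_four_mul_sq_pos hM) (fun g hg => hC M hM g hg) hf⟩

end VolumeElements

/-! ### Volume elements are of Type I -/

section TypeI

variable {M : ℕ}

lemma volOp_linear (hM : 0 < M) {f g : T2 → ℂ} (hf : Integrable f haarT) (hg : Integrable g haarT)
    (c d : ℂ) (t : T2) : volOp M (fun u => c * f u + d * g u) t =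
      c * volOp M f t + d * volOp M g t :=
  (isPartition_Psi hM).avgOp_linear hf hg c d t

/-- The shifted interpolation by volume elements, as an operator on functions on the torus. -/
def volShiftOp (M : ℕ) (f : T2 → ℂ) (t : T2) : ℂ := volOp M f t - coef f 0

lemma enorm_coef_zero_le {p : ℝ≥0∞} (hp : 1 ≤ p) {f : T2 → ℂ} (hf : MemLp f p haarT) :
    ‖coef f 0‖ₑ ≤ eLpNorm f p haarT :=
  (enorm_coef_le 0).trans (eLpNorm_le_eLpNorm_of_exponent_le hp hf.1)

lemma eLpNorm_volShiftOp_le (hM : 0 < M) {p : ℝ≥0∞} (hp : 1 ≤ p) {f : T2 → ℂ}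
    (hf : MemLp f p haarT) : eLpNorm (volShiftOp M f) p haarT ≤ (2 : ℝ≥0) * eLpNorm f p haarT := by
  have h1 : eLpNorm (fun _ : T2 => coef f 0) p haarT = ‖coef f 0‖ₑ := by
    rw [eLpNorm_const _ (one_pos.trans_le hp).ne' (NeZero.ne _)]
    simp
  calc _ ≤ eLpNorm (volOp M f) p haarT + eLpNorm (fun _ : T2 => coef f 0) p haarT :=
        eLpNorm_sub_le (measurable_volOp hM f).aestronglyMeasurable aestronglyMeasurable_const hp
    _ ≤ eLpNorm f p haarT + eLpNorm f p haarT := by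
        rw [h1]
        exact add_le_add (eLpNorm_volOp_le hM hp hf) (enorm_coef_zero_le hp hf)
    _ = _ := by rw [← two_mul]; rfl

lemma measurable_volShiftOp (hM : 0 < M) (f : T2 → ℂ) : Measurable (volShiftOp M f) :=
  (measurable_volOp hM f).sub measurable_const

lemma enorm_volShiftOp_le (hM : 0 < M) {f : T2 → ℂ} (hf : MemLp f 2 haarT) (t : T2) :
    ‖volShiftOp M f t‖ₑ ≤ (3 * π).toNNReal * ENNReal.ofReal (side M)⁻¹ * eLpNorm f 2 haarT := by
  have hpi := Real.pi_pos
  have hM1 : (1 : ℝ) ≤ M := by exact_mod_cast hM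
  -- the side length is at most `π`
  have h1 : 1 ≤ ENNReal.ofReal π * ENNReal.ofReal (side M)⁻¹ := by
    rw [← ENNReal.ofReal_mul hpi.le, ENNReal.one_le_ofReal]
    have := two_mul_eq_inv_side hM
    linarith
  calc ‖volShiftOp M f t‖ₑ ≤ ‖volOp M f t‖ₑ + ‖coef f 0‖ₑ := enorm_sub_le
    _ ≤ (2 * π).toNNReal * ENNReal.ofReal (side M)⁻¹ * eLpNorm f 2 haarT +
        ENNReal.ofReal π * ENNReal.ofReal (side M)⁻¹ * eLpNorm f 2 haarT := by
      refine add_le_add (enorm_volOp_le hM hf t) ?_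
      exact (enorm_coef_zero_le (by norm_num) hf).trans (le_mul_of_one_le_left zero_le h1)
    _ = _ := by
      have e : ((3 * π).toNNReal : ℝ≥0∞) = (2 * π).toNNReal + ENNReal.ofReal π := by
        have : 3 * π = 2 * π + π := by ring
        rw [this, Real.toNNReal_add (by positivity) hpi.le]
        push_cast
        rfl
      rw [e]
      ring

lemma hdotT_volShiftOp (hM : 0 < M) {f : T2 → ℂ} (hf : Integrable f haarT) (σ : ℝ) :
    hdotT σ (volShiftOp M f) = hdotT σ (volOp M f) := by
  have hi := (memLp_volOp hM le_rfl (memLp_one_iff_integrable.2 hf)).integrable le_rfl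
  refine hdotT_congr fun k hk => ?_
  have h1 : coef (fun _ : T2 => coef f 0) k = 0 := by
    have h2 := coef_const_mul (coef f 0) (mFourier 0) k
    rw [coef_mFourier, if_neg hk.symm, mul_zero, UnitAddTorus.mFourier_zero] at h2
    simpa using h2
  have h3 := coef_sub hi (integrable_const (coef f 0)) k
  rw [h1, sub_zero] at h3
  exact h3

lemma pos_of_three_le {n : ℕ} (hn : n ∈ {M : ℕ | 3 ≤ M}) : 0 < n := lt_of_lt_of_le (by norm_num) hn

theorem endpointBounds_volElt : EndpointBounds {M | 3 ≤ M} side volElt where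
  lp_bound := ⟨1, fun p hp => lp_bound_of_torus (Op := volOp)
    (fun n hn φ _ => volElt_eq (pos_of_three_le hn) φ)
    (fun n hn f _ => (measurable_volOp (pos_of_three_le hn) f).aestronglyMeasurable) hp
    fun n hn f hf => by simpa using eLpNorm_volOp_le (pos_of_three_le hn) hp hf⟩
  l2_lp_bound := l2_lp_bound_of_torus (Op := volOp) (fun n hn => side_pos (pos_of_three_le hn))
    (fun n hn φ _ => volElt_eq (pos_of_three_le hn) φ)
    (fun n hn f _ => (measurable_volOp (pos_of_three_le hn) f).aestronglyMeasurable) (C := 1)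
    (fun n hn f hf => by simpa using eLpNorm_volOp_le (pos_of_three_le hn) (by norm_num) hf)
    (fun n hn f hf t => enorm_volOp_le (pos_of_three_le hn) hf t)

theorem endpointBounds_volEltShift : EndpointBounds {M | 3 ≤ M} side volEltShift where
  lp_bound := ⟨2, fun p hp => lp_bound_of_torus (Op := volShiftOp)
    (fun n hn φ hφ => volEltShift_eq (pos_of_three_le hn) hφ)
    (fun n hn f _ => (measurable_volShiftOp (pos_of_three_le hn) f).aestronglyMeasurable) hp
    fun n hn f hf => eLpNorm_volShiftOp_le (pos_of_three_le hn) hp hf⟩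
  l2_lp_bound := l2_lp_bound_of_torus (Op := volShiftOp) (fun n hn => side_pos (pos_of_three_le hn))
    (fun n hn φ hφ => volEltShift_eq (pos_of_three_le hn) hφ)
    (fun n hn f _ => (measurable_volShiftOp (pos_of_three_le hn) f).aestronglyMeasurable)
    (fun n hn f hf => eLpNorm_volShiftOp_le (pos_of_three_le hn) (by norm_num) hf)
    (fun n hn f hf t => enorm_volShiftOp_le (pos_of_three_le hn) hf t)

/-- The endpoint bounds contain the basic ones, apart from linearity and the Sobolev bound. -/
lemma EndpointBounds.basicBounds {S : Set ℕ} {h : ℕ → ℝ} {J : ℕ → (Plane → ℂ) → Plane → ℂ}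
    (E : EndpointBounds S h J)
    (hlin : ∀ n ∈ S, ∀ φ η : Plane → ℂ, MemLpPer 1 φ → MemLpPer 1 η → ∀ a b : ℂ,
      J n (a • φ + b • η) = a • J n φ + b • J n η)
    (hdot : ∀ β : ℝ, 0 ≤ β → ∃ C : ℝ≥0, ∀ n ∈ S, ∀ φ, MemLpPer 2 φ →
      hdotNorm β (J n φ) ≤ C * ENNReal.ofReal (h n ^ (-β)) * lpNorm 2 φ) : BasicBounds S h J where
  linear := hlin
  lp_bound p hp _ := by
    obtain ⟨C, hC⟩ := E.lp_bound
    exact ⟨C, hC p hp.le⟩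
  l2_lp_bound p hp _ := by
    obtain ⟨C, hC⟩ := E.l2_lp_bound
    exact ⟨C, hC p hp⟩
  l2_hdot_bound β hβ := by
    obtain ⟨C, hC⟩ := hdot β hβ
    obtain ⟨D, hD⟩ := E.lp_bound
    refine ⟨C, fun n hn φ hφ => ⟨⟨(hD 2 (by norm_num) n hn φ hφ).1, ?_⟩, hC n hn φ hφ⟩⟩
    have : lpNorm 2 φ < ⊤ := hφ.2.2
    exact (hC n hn φ hφ).trans_lt (by finiteness)

lemma basicBounds_volElt : BasicBounds {M | 3 ≤ M} side volElt := by
  refine endpointBounds_volElt.basicBounds (fun n hn φ η hφ hη a b => ?_) fun β hβ => ?_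
  · have hM := pos_of_three_le hn
    rw [volElt_eq hM, volElt_eq hM, volElt_eq hM]
    funext x
    exact volOp_linear hM (hφ.sec.integrable le_rfl) (hη.sec.integrable le_rfl) a b _
  · obtain ⟨C, hC⟩ := exists_hdotT_volOp_le hβ
    refine ⟨C, fun n hn φ hφ => ?_⟩
    have hM := pos_of_three_le hn
    rw [hdotNorm_eq, volElt_eq hM]
    simp only [toT_sec]
    refine (hC n hM _ hφ.sec).trans ?_
    gcongr
    exact eLpNorm_sec_le φ

lemma basicBounds_volEltShift : BasicBounds {M | 3 ≤ M} side volEltShift := by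
  refine endpointBounds_volEltShift.basicBounds (fun n hn φ η hφ hη a b => ?_) fun β hβ => ?_
  · have hM := pos_of_three_le hn
    rw [volEltShift_eq hM hφ, volEltShift_eq hM hη, volEltShift_eq hM (hφ.linear_comb hη a b)]
    have h1 := hφ.sec.integrable le_rfl
    have h2 := hη.sec.integrable le_rfl
    funext x
    have h3 := volOp_linear hM h1 h2 a b (toT x)
    have h4 := coef_add (h1.const_mul a) (h2.const_mul b) 0
    rw [coef_const_mul, coef_const_mul] at h4
    calc _ = (a * volOp n (fun t => φ (sec t)) (toT x) + b * volOp n (fun t => η (sec t)) (toT x)) -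
          (a * coef (fun t => φ (sec t)) 0 + b * coef (fun t => η (sec t)) 0) :=
        congrArg₂ (· - ·) h3 h4
      _ = _ := by simp only [Pi.add_apply, Pi.smul_apply, smul_eq_mul]; ring
  · obtain ⟨C, hC⟩ := exists_hdotT_volOp_le hβ
    refine ⟨C, fun n hn φ hφ => ?_⟩
    have hM := pos_of_three_le hn
    have hφ1 : MemLpPer 1 φ := hφ.mono (by norm_num)
    rw [hdotNorm_eq, volEltShift_eq hM hφ1]
    simp only [toT_sec]
    refine (hdotT_volShiftOp hM (hφ1.sec.integrable le_rfl) β).trans_le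
      ((hC n hM _ hφ.sec).trans ?_)
    gcongr
    exact eLpNorm_sec_le φ

lemma exists_volElt_approx {β : ℝ} (hβ : 0 < β) (hβ1 : β ≤ 1) : ∃ C : ℝ≥0, ∀ n ∈ {M | 3 ≤ M},
    ∀ φ, MemLpPer 2 φ →
      lpNorm 2 (φ - volElt n φ) ≤ C * ENNReal.ofReal (side n ^ β) * hdotNorm β φ := by
  obtain ⟨C, hC⟩ := exists_eLpNorm_sub_volOp_le hβ hβ1
  obtain ⟨K, hK⟩ : ∃ K : ℝ≥0, (K : ℝ≥0∞) =
      ENNReal.ofReal (4 * π ^ 2) ^ (1 / (2 : ℝ≥0∞).toReal) :=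
    ⟨_, ENNReal.coe_toNNReal (ENNReal.rpow_ne_top_of_nonneg (by positivity) ENNReal.ofReal_ne_top)⟩
  refine ⟨K * C, fun n hn φ hφ => ?_⟩
  have hM := pos_of_three_le hn
  rw [lpNorm_eq, ← hK, volElt_eq hM, hdotNorm_eq, ENNReal.coe_mul, mul_assoc, mul_assoc]
  simp only [Pi.sub_apply, toT_sec]
  rw [← mul_assoc (C : ℝ≥0∞)]
  gcongr
  exact hC n hM _ hφ.sec

lemma exists_volElt_approx_neg {β : ℝ} (hβ : 0 < β) (hβ1 : β ≤ 1) : ∃ C : ℝ≥0, ∀ n ∈ {M | 3 ≤ M},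
    ∀ φ, MemLpPer 2 φ →
      hdotNorm (-β) (φ - volElt n φ) ≤ C * ENNReal.ofReal (side n ^ β) * lpNorm 2 φ := by
  obtain ⟨C, hC⟩ := exists_hdotT_neg_sub_volOp_le hβ hβ1
  refine ⟨C, fun n hn φ hφ => ?_⟩
  have hM := pos_of_three_le hn
  rw [volElt_eq hM, hdotNorm_eq]
  simp only [Pi.sub_apply, toT_sec]
  refine (hC n hM _ hφ.sec).trans ?_
  gcongr
  exact eLpNorm_sec_le φ

theorem isTypeI_volElt : IsTypeI {M | 3 ≤ M} side volElt HdotPer {φ | MemLpPer 2 φ} where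
  toBasicBounds := basicBounds_volElt
  approx β hβ hβ1 := by
    obtain ⟨C, hC⟩ := exists_volElt_approx hβ hβ1
    exact ⟨C, fun n hn φ hφ => hC n hn φ hφ.1⟩
  approx_neg β hβ hβ1 := exists_volElt_approx_neg hβ hβ1

/-- The shift does not change the interpolant of a function with mean zero. -/
lemma volEltShift_eq_volElt (hM : 0 < M) {φ : Plane → ℂ} (hφ : MemLpPer 1 φ)
    (h0 : fourierCoef φ 0 = 0) : volEltShift M φ = volElt M φ := by
  rw [fourierCoef_eq] at h0
  rw [volEltShift_eq hM hφ, volElt_eq hM, h0]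
  simp

/-- The mean value is continuous in the `H^β` norm and vanishes on the approximants. -/
lemma fourierCoef_zero_of_mem_V {β : ℝ} {φ : Plane → ℂ} (hφ : φ ∈ V β) : fourierCoef φ 0 = 0 := by
  rw [← enorm_eq_zero, ← nonpos_iff_eq_zero]
  refine le_of_forall_gt_imp_ge_of_dense fun ε hε => ?_
  obtain ⟨q, ⟨s, c, hs, rfl⟩, hq⟩ := hφ.2 ε hε
  refine le_of_lt (lt_of_le_of_lt ?_ hq)
  set q : Plane → ℂ := fun x => ∑ k ∈ s, c k * char k x with hqdef
  have hq1 : (fun t => q (sec t)) = trig s c := by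
    funext t
    simp only [hqdef, trig, char_eq, toT_sec]
  have h1 : fourierCoef (φ - q) 0 = fourierCoef φ 0 := by
    have hφi : Integrable (fun t => φ (sec t)) haarT := hφ.1.sec.integrable (by norm_num)
    have h2 := coef_sub hφi (integrable_of_continuous (continuous_trig s c)) 0
    rw [coef_trig, if_neg hs, sub_zero, ← hq1] at h2
    rw [fourierCoef_eq, fourierCoef_eq]
    exact h2
  have h2 : ‖freq 0‖ = 0 := norm_freq_zero
  have h3 := ENNReal.le_tsum (f := fun k : Fin 2 → ℤ =>
    ENNReal.ofReal ((1 + ‖freq k‖ ^ 2) ^ β) * ‖fourierCoef (φ - q) k‖ₑ ^ 2) 0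
  simp only [h2, h1] at h3
  norm_num at h3
  calc ‖fourierCoef φ 0‖ₑ = (‖fourierCoef φ 0‖ₑ ^ 2) ^ (1 / 2 : ℝ) := by
        rw [← ENNReal.rpow_natCast, ← ENNReal.rpow_mul]; norm_num
    _ ≤ _ := by
        rw [hNorm]
        gcongr

lemma fourierCoef_zero_of_mem_meanZero {φ : Plane → ℂ} (hφ : φ ∈ MeanZero) :
    fourierCoef φ 0 = 0 := by
  have h := hφ.2
  rw [integral_cell, smul_eq_zero] at h
  have hpi := Real.pi_pos
  rw [fourierCoef_eq, coef_zero]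
  exact h.resolve_left (by positivity)

theorem isTypeI_volEltShift :
    IsTypeI {M | 3 ≤ M} side volEltShift V ({φ | MemLpPer 2 φ} ∩ MeanZero) where
  toBasicBounds := basicBounds_volEltShift
  approx β hβ hβ1 := by
    obtain ⟨C, hC⟩ := exists_volElt_approx hβ hβ1
    refine ⟨C, fun n hn φ hφ => ?_⟩
    rw [volEltShift_eq_volElt (pos_of_three_le hn) (hφ.1.mono (by norm_num))
      (fourierCoef_zero_of_mem_V hφ)]
    exact hC n hn φ hφ.1
  approx_neg β hβ hβ1 := by
    obtain ⟨C, hC⟩ := exists_volElt_approx_neg hβ hβ1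
    refine ⟨C, fun n hn φ hφ => ?_⟩
    rw [volEltShift_eq_volElt (pos_of_three_le hn) hφ.2.1
      (fourierCoef_zero_of_mem_meanZero hφ.2)]
    exact hC n hn φ hφ.1

end TypeI

end TorusInterp

end

theorem propositionA1 :
    (TorusInterp.IsTypeI {M | 3 ≤ M} TorusInterp.side TorusInterp.volElt
        TorusInterp.HdotPer {φ | TorusInterp.MemLpPer 2 φ} ∧
      TorusInterp.EndpointBounds {M | 3 ≤ M} TorusInterp.side TorusInterp.volElt) ∧
    (TorusInterp.IsTypeI {M | 3 ≤ M} TorusInterp.side TorusInterp.volEltShift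
        TorusInterp.V ({φ | TorusInterp.MemLpPer 2 φ} ∩ TorusInterp.MeanZero) ∧
      TorusInterp.EndpointBounds {M | 3 ≤ M} TorusInterp.side TorusInterp.volEltShift) ∧
    TorusInterp.IsTypeII {N | 16 ≤ N} (fun N => 2 * Real.pi / (N : ℝ)) TorusInterp.roughProj ∧
    (∀ ψ₀ : TorusInterp.Plane → ℝ, TorusInterp.IsLPBump ψ₀ →
      TorusInterp.IsTypeII {N | 0 < N} (fun N => (2 : ℝ) ^ (-(N : ℝ)))
          (TorusInterp.smoothProj ψ₀) ∧
        TorusInterp.EndpointBounds {N | 0 < N} (fun N => (2 : ℝ) ^ (-(N : ℝ)))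
          (TorusInterp.smoothProj ψ₀)) := by
  exact ⟨⟨TorusInterp.isTypeI_volElt, TorusInterp.endpointBounds_volElt⟩,
    ⟨TorusInterp.isTypeI_volEltShift, TorusInterp.endpointBounds_volEltShift⟩,
    TorusInterp.isTypeII_roughProj, fun ψ₀ H =>
      ⟨TorusInterp.isTypeII_smoothProj H, TorusInterp.endpointBounds_smoothProj H⟩⟩
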